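/- Let $\mathfrak g$ be $\mathfrak{so}(2n+1)$ ($n\ge1$), $\mathfrak{sp}(2n)$ ($n\ge 1$) or $\mathfrak{so}(2n)$ ($n\ge 3$) over $\mathbb C$, with Cartan subalgebra $\mathfrak h$ of diagonal matrices in the natural representation $\mathbb C^N$, whose basis $w_1,\dots,w_N$ is a weight basis with weights $\varepsilon_i$, $\varepsilon_{N+1-i}=-\varepsilon_i$, where $\varepsilon_1,\dots,\varepsilon_n$ is an orthonormal basis of $\mathfrak h^*$; the subalgebras $\mathfrak g_\pm$ are strictly upper and lower triangular. Let $U_q(\mathfrak g)$ be the Drinfeld–Jimbo quantum group generated by $e_{\pm\alpha}$, $q^{\pm h_\alpha}$ ($\alpha$ a simple root), with $[e_\alpha,e_{-\beta}]=\delta_{\alpha\beta}\,\frac{[h_\alpha]_q}{[(\alpha,\alpha)/2]_q}$, and comultiplication $\Delta(e_\alpha)=e_\alpha\otimes1+q^{h_\alpha}\otimes e_\alpha$, $\Delta(e_{-\alpha})=e_{-\alpha}\otimes q^{-h_\alpha}+1\otimes e_{-\alpha}$, $\Delta(q^{\pm h_\alpha})=q^{\pm h_\alpha}\otimes q^{\pm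 h_\alpha}$. It acts on $\mathbb C^N$ by its natural representation: $e_\alpha\mapsto\sum e_{lr}$ and $e_{-\alpha}\mapsto c_\alpha\sum e_{rl}$, summed over the pairs with $\varepsilon_l-\varepsilon_r=\alpha$, where $c_\alpha=[1/2]_q^{-1}$ if $\mathfrak g=\mathfrak{so}(2n+1)$ and $\alpha=\varepsilon_n$, and $c_\alpha=1$ otherwise; $q^{h_\alpha}w_i=q^{(\alpha,\varepsilon_i)}w_i$. Let $\mathfrak k\subset\mathfrak g$ be the centralizer of a point $x$ of the maximal torus, with positive roots $\mathrm R^+_{\mathfrak k}\subset\mathrm R^+$, simple roots $\Pi^+_{\mathfrak k}$ and negative part $\mathfrak k_-=\mathfrak k\cap\mathfrak g_-$. Let $\rho$, $\rho_{\mathfrak k}$ be the half-sums of $\mathrm R^+$, $\mathrm R^+_{\mathfrak k}$. Let $I_{\mathfrak k}$ be the set of those $j\in\{1,\dots,N\}$ for which there is no $i$ with $w_j\in U(\mathfrak k_-)\mathfrak k_-w_i$. Let $\mathfrak C^*_{\mathfrak k,reg}$ be the set of formal expressions $\lambda=\frac1\hbar\lambda^0+\lambda^1$ with $\lambda^0,\lambda^1\in\mathfrak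 h^*$ such that, for every $\alpha\in\mathrm R^+$, $e^{2(\lambda^0,\alpha)}=1$ if and only if $\alpha\in \mathrm R^+_{\mathfrak k}$ (that is, $\mathfrak k$ is exactly the centralizer of $e^{2h_{\lambda^0}}$), and $(\lambda^1+\rho-\rho_{\mathfrak k},\alpha)=0$ for all $\alpha\in\mathrm R^+_{\mathfrak k}$. For $q\ne 1$ near $1$ put $\hbar=\log q$ (principal value) and $q^z=e^{\hbar z}$, so that $q^{(\lambda,\alpha)}=e^{(\lambda^0,\alpha)}q^{(\lambda^1,\alpha)}$. Let $M^{\mathfrak k}_\lambda$ be the quotient of the Verma module $U_q(\mathfrak g)\otimes_{U_q(\mathfrak b_+)}\mathbb C_\lambda$ by the submodule generated by the singular vectors of weights $\lambda-\alpha$, $\alpha\in\Pi^+_{\mathfrak k}$, let $v_\lambda$ be its highest weight vector, and let $V^{\mathfrak k}_j\subset\mathbb C^N\otimes M^{\mathfrak k}_\lambda$ be the $U_q(\mathfrak g)$-submodule generated by $w_i\otimes v_\lambda$, $i\le j$ ($V^{\mathfrak k}_0=0$). **Statement.** For each $\lambda\in\mathfrak C^*_{\mathfrak k,reg}$ there is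 a neighbourhood $\Omega$ of $1$ in $\mathbb C$ such that for all $q\in\Omega$ that are not roots of unity: (i) for every $j=1,\dots,N$ the submodule $V^{\mathfrak k}_j$ is generated by the vectors $w_i\otimes v_\lambda$ with $i\le j$ and $i\in I_{\mathfrak k}$; (ii) the canonical homomorphism $\bigoplus_{j\in I_{\mathfrak k}}V^{\mathfrak k}_j/V^{\mathfrak k}_{j-1}\to\operatorname{gr}V^{\mathfrak k}_\bullet=\bigoplus_{j=1}^N V^{\mathfrak k}_j/V^{\mathfrak k}_{j-1}$ is an isomorphism. -/

import Mathlib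

open scoped TensorProduct Topology DirectSum Matrix

noncomputable section

namespace QOrtho

/-! ### Root data of the orthogonal and symplectic Lie algebras -/

/-- The three series: `B` is `so(2n+1)`, `C` is `sp(2n)`, `D` is `so(2n)`. -/
inductive Series
  | B
  | C
  | D

/-- `N`, the dimension of the natural representation. -/
def dimN : Series → ℕ → ℕ
  | .B, n => 2 * n + 1
  | .C, n => 2 * n
  | .D, n => 2 * n

/-- The weight `ε_i` of the basis vector `w_i`, in the coordinates of the orthonormal basis
`ε_1, …, ε_n` of `𝔥*`. Indices start from `0` here, and `i' = Fin.rev i`, so that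
`ε_{i'} = - ε_i`. -/
def eps (t : Series) (n : ℕ) (i : Fin (dimN t n)) : Fin n → ℤ :=
  if h : (i : ℕ) < n then Pi.single ⟨i, h⟩ 1
  else if h : (i.rev : ℕ) < n then - Pi.single ⟨i.rev, h⟩ 1
  else 0

/-- The simple roots `α_i = ε_i - ε_{i+1}` for `i < n`, and `α_n = ε_n`, `2ε_n`, `ε_{n-1} + ε_n`
for the series `B`, `C`, `D`. -/
def simpleRoot (t : Series) (n : ℕ) (i : Fin n) : Fin n → ℤ :=
  if h : (i : ℕ) + 1 < n then Pi.single i 1 - Pi.single ⟨i + 1, h⟩ 1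
  else match t with
    | .B => Pi.single i 1
    | .C => Pi.single i 2
    | .D => Pi.single ⟨(i : ℕ) - 1, by omega⟩ 1 + Pi.single i 1

/-- The positive roots: `ε_a ± ε_b` for `a < b`, together with `ε_a` (series `B`) or
`2ε_a` (series `C`). -/
def posRoots (t : Series) (n : ℕ) : Finset (Fin n → ℤ) :=
  ((Finset.univ.filter fun p : Fin n × Fin n => p.1 < p.2).image
      fun p => Pi.single p.1 1 - Pi.single p.2 1) ∪
  ((Finset.univ.filter fun p : Fin n × Fin n => p.1 < p.2).image
      fun p => Pi.single p.1 1 + Pi.single p.2 1) ∪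
  (match t with
    | .B => Finset.univ.image fun a : Fin n => Pi.single a 1
    | .C => Finset.univ.image fun a : Fin n => Pi.single a 2
    | .D => ∅)

/-- The inner product of a weight `μ ∈ 𝔥*` with an integral weight. -/
def pair {n : ℕ} (μ : Fin n → ℂ) (α : Fin n → ℤ) : ℂ := ∑ a, μ a * (α a : ℂ)

/-- Half the sum of a finite set of roots. -/
def halfSum {n : ℕ} (S : Finset (Fin n → ℤ)) : Fin n → ℂ :=
  fun a => (∑ α ∈ S, (α a : ℂ)) / 2

/-! ### The quantum group -/

/-- The quantum number `[z]_q`. For `q ≠ 0` the power `q ^ z` is `exp (z * log q)`, with the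
principal value of the logarithm. -/
def qnum (q z : ℂ) : ℂ := (q ^ z - q ^ (-z)) / (q - q⁻¹)

/-- The quantum factorial `[m]_p!`. -/
def qfact (p : ℂ) (m : ℕ) : ℂ := ∏ k ∈ Finset.range m, qnum p ((k : ℂ) + 1)

/-- The quantum binomial coefficient. -/
def qbinom (p : ℂ) (m s : ℕ) : ℂ := qfact p m / (qfact p s * qfact p (m - s))

/-- Generators of `U_q(𝔤)`: `E i = e_{α_i}`, `F i = e_{-α_i}`, `K i = q^{h_{α_i}}`,
`Kinv i = q^{-h_{α_i}}`. -/
inductive Gen (n : ℕ)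
  | E (i : Fin n)
  | F (i : Fin n)
  | K (i : Fin n)
  | Kinv (i : Fin n)

/-- The free algebra on the generators. -/
abbrev Free (n : ℕ) : Type := FreeAlgebra ℂ (Gen n)

namespace Free
/-- A generator as an element of the free algebra. -/
def gen {n : ℕ} (g : Gen n) : Free n := FreeAlgebra.ι ℂ g
end Free

open Free (gen)

/-- `q_i = q^{(α_i, α_i)/2}`. -/
def qi (t : Series) (n : ℕ) (q : ℂ) (i : Fin n) : ℂ :=
  q ^ (((simpleRoot t n i ⬝ᵥ simpleRoot t n i : ℤ) : ℂ) / 2)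

/-- The exponent `1 - a_{ij}` of the Serre relation, `a_{ij} = 2(α_i, α_j)/(α_i, α_i)`
(an exact division). -/
def serreExp (t : Series) (n : ℕ) (i j : Fin n) : ℕ :=
  (1 - 2 * (simpleRoot t n i ⬝ᵥ simpleRoot t n j) /
    (simpleRoot t n i ⬝ᵥ simpleRoot t n i)).toNat

/-- The left side of the quantum Serre relation of degree `m` in `X` and `1` in `Y`. -/
def serre {n : ℕ} (p : ℂ) (m : ℕ) (X Y : Free n) : Free n :=
  ∑ s ∈ Finset.range (m + 1), ((-1) ^ s * qbinom p m s) • (X ^ (m - s) * Y * X ^ s)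

/-- The defining relations of `U_q(𝔤)`. Note that
`[h_α]_q / [(α,α)/2]_q = (K_α - K_α⁻¹) / ((q - q⁻¹) [(α,α)/2]_q)`. -/
inductive UqRel (t : Series) (n : ℕ) (q : ℂ) : Free n → Free n → Prop
  | K_Kinv (i) : UqRel t n q (gen (.K i) * gen (.Kinv i)) 1
  | Kinv_K (i) : UqRel t n q (gen (.Kinv i) * gen (.K i)) 1
  | K_K (i j) : UqRel t n q (gen (.K i) * gen (.K j)) (gen (.K j) * gen (.K i))
  | K_E (i j) : UqRel t n q (gen (.K i) * gen (.E j) * gen (.Kinv i))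
      (q ^ (simpleRoot t n i ⬝ᵥ simpleRoot t n j : ℤ) • gen (.E j))
  | K_F (i j) : UqRel t n q (gen (.K i) * gen (.F j) * gen (.Kinv i))
      (q ^ (-(simpleRoot t n i ⬝ᵥ simpleRoot t n j : ℤ)) • gen (.F j))
  | E_F_same (i) : UqRel t n q (gen (.E i) * gen (.F i) - gen (.F i) * gen (.E i))
      (((q - q⁻¹) * qnum q (((simpleRoot t n i ⬝ᵥ simpleRoot t n i : ℤ) : ℂ) / 2))⁻¹ •
        (gen (.K i) - gen (.Kinv i)))
  | E_F (i j) (h : i ≠ j) :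
      UqRel t n q (gen (.E i) * gen (.F j) - gen (.F j) * gen (.E i)) 0
  | serre_E (i j) (h : i ≠ j) :
      UqRel t n q (serre (qi t n q i) (serreExp t n i j) (gen (.E i)) (gen (.E j))) 0
  | serre_F (i j) (h : i ≠ j) :
      UqRel t n q (serre (qi t n q i) (serreExp t n i j) (gen (.F i)) (gen (.F j))) 0

/-- The quantum group `U_q(𝔤)`. -/
abbrev Uq (t : Series) (n : ℕ) (q : ℂ) : Type := RingQuot (UqRel t n q)

/-- The image of a generator in `U_q(𝔤)`. -/
def ugen (t : Series) (n : ℕ) (q : ℂ) (g : Gen n) : Uq t n q :=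
  RingQuot.mkAlgHom ℂ (UqRel t n q) (gen g)

/-! ### Verma modules and generalized parabolic Verma modules -/

/-- The left ideal of `U_q(𝔤)` generated by `e_α` and `q^{h_α} - q^{(μ,α)}`, `α` simple. -/
def vermaIdeal (t : Series) (n : ℕ) (q : ℂ) (μ : Fin n → ℂ) : Submodule (Uq t n q) (Uq t n q) :=
  Submodule.span (Uq t n q)
    (Set.range (fun i => ugen t n q (.E i)) ∪
     Set.range (fun i => ugen t n q (.K i) -
       algebraMap ℂ (Uq t n q) (q ^ pair μ (simpleRoot t n i))))

/-- The Verma module of highest weight `μ`, i.e. `U_q(𝔤) ⊗_{U_q(𝔟₊)} ℂ_μ`. -/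
abbrev Verma (t : Series) (n : ℕ) (q : ℂ) (μ : Fin n → ℂ) : Type :=
  Uq t n q ⧸ vermaIdeal t n q μ

/-- `v` is zero or a singular vector, of weight `ν`. -/
def IsSingular {t : Series} {n : ℕ} {q : ℂ} {μ : Fin n → ℂ} (ν : Fin n → ℂ)
    (v : Verma t n q μ) : Prop :=
  (∀ i, ugen t n q (.E i) • v = 0) ∧
  (∀ i, ugen t n q (.K i) • v = (q ^ pair ν (simpleRoot t n i)) • v)

/-- The value `x^α` of the character `α` at a point `x` of the maximal torus. -/
def char {n : ℕ} (x : Fin n → ℂˣ) (α : Fin n → ℤ) : ℂˣ := ∏ a, x a ^ α a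

open Classical in
/-- The positive roots of the centralizer `𝔨` of the torus point `x`. -/
def posRootsK (t : Series) (n : ℕ) (x : Fin n → ℂˣ) : Finset (Fin n → ℤ) :=
  (posRoots t n).filter fun α => char x α = 1

/-- The simple positive roots of `𝔨`: those that are not sums of two positive roots of `𝔨`. -/
def simpleRootsK (t : Series) (n : ℕ) (x : Fin n → ℂˣ) : Set (Fin n → ℤ) :=
  {α | α ∈ posRootsK t n x ∧
    ¬ ∃ β ∈ posRootsK t n x, ∃ γ ∈ posRootsK t n x, α = β + γ}

/-- The submodule of the Verma module generated by the singular vectors of the weights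
`μ - α`, for `α` a simple positive root of `𝔨`. -/
def singularSubmodule (t : Series) (n : ℕ) (q : ℂ) (x : Fin n → ℂˣ) (μ : Fin n → ℂ) :
    Submodule (Uq t n q) (Verma t n q μ) :=
  Submodule.span (Uq t n q)
    {v | ∃ α ∈ simpleRootsK t n x, IsSingular (μ - fun a => (α a : ℂ)) v}

/-- The generalized parabolic Verma module `M^𝔨_μ`. -/
abbrev ParVerma (t : Series) (n : ℕ) (q : ℂ) (x : Fin n → ℂˣ) (μ : Fin n → ℂ) : Type :=
  Verma t n q μ ⧸ singularSubmodule t n q x μ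

/-- The highest weight vector of `M^𝔨_μ`. -/
def hwVec (t : Series) (n : ℕ) (q : ℂ) (x : Fin n → ℂˣ) (μ : Fin n → ℂ) : ParVerma t n q x μ :=
  (singularSubmodule t n q x μ).mkQ ((vermaIdeal t n q μ).mkQ 1)

/-! ### The natural representation and the tensor product -/

/-- `∑ e_{lr}` over all pairs `(l, r)` with `ε_l - ε_r = α`. -/
def raising (t : Series) (n : ℕ) (α : Fin n → ℤ) : Matrix (Fin (dimN t n)) (Fin (dimN t n)) ℂ :=
  Matrix.of fun l r => if eps t n l - eps t n r = α then 1 else 0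

open Classical in
/-- The natural representation on the generators. The lowering operator is normalized by
`f_i = e_{-α_i}`, except that `f_n = [1/2]_q e_{-α_n}` for the series `B`;
`e_{α_i}` and `f_i` act by `∑ e_{lr}` and `∑ e_{rl}`. -/
def natRep (t : Series) (n : ℕ) (q : ℂ) : Gen n → Matrix (Fin (dimN t n)) (Fin (dimN t n)) ℂ
  | .E i => raising t n (simpleRoot t n i)
  | .F i => (if t = .B ∧ (i : ℕ) + 1 = n then (qnum q (1 / 2))⁻¹ else 1) •
      (raising t n (simpleRoot t n i))ᵀ
  | .K i => Matrix.diagonal fun l => q ^ (simpleRoot t n i ⬝ᵥ eps t n l : ℤ)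
  | .Kinv i => Matrix.diagonal fun l => q ^ (-(simpleRoot t n i ⬝ᵥ eps t n l : ℤ))

/-- The underlying space of `ℂ^N ⊗ M^𝔨_μ`. -/
def Tens (t : Series) (n : ℕ) (q : ℂ) (x : Fin n → ℂˣ) (μ : Fin n → ℂ) : Type :=
  (Fin (dimN t n) → ℂ) ⊗[ℂ] ParVerma t n q x μ

instance (t : Series) (n : ℕ) (q : ℂ) (x : Fin n → ℂˣ) (μ : Fin n → ℂ) :
    AddCommGroup (Tens t n q x μ) :=
  inferInstanceAs (AddCommGroup ((Fin (dimN t n) → ℂ) ⊗[ℂ] ParVerma t n q x μ))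

instance (t : Series) (n : ℕ) (q : ℂ) (x : Fin n → ℂˣ) (μ : Fin n → ℂ) :
    Module ℂ (Tens t n q x μ) :=
  inferInstanceAs (Module ℂ ((Fin (dimN t n) → ℂ) ⊗[ℂ] ParVerma t n q x μ))

/-- The operator by which a generator acts on `ℂ^N`. -/
def actN (t : Series) (n : ℕ) (q : ℂ) (g : Gen n) :
    (Fin (dimN t n) → ℂ) →ₗ[ℂ] (Fin (dimN t n) → ℂ) :=
  Matrix.toLin' (natRep t n q g)

/-- The operator by which a generator acts on `M^𝔨_μ`. -/
def actM (t : Series) (n : ℕ) (q : ℂ) (x : Fin n → ℂˣ) (μ : Fin n → ℂ) (g : Gen n) :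
    ParVerma t n q x μ →ₗ[ℂ] ParVerma t n q x μ :=
  Algebra.lsmul ℂ ℂ (ParVerma t n q x μ) (ugen t n q g)

/-- The action of the generators on `ℂ^N ⊗ M^𝔨_μ` through the comultiplication
`Δ(e_α) = e_α ⊗ 1 + q^{h_α} ⊗ e_α`, `Δ(e_{-α}) = e_{-α} ⊗ q^{-h_α} + 1 ⊗ e_{-α}`,
`Δ(q^{±h_α}) = q^{±h_α} ⊗ q^{±h_α}`. -/
def actT (t : Series) (n : ℕ) (q : ℂ) (x : Fin n → ℂˣ) (μ : Fin n → ℂ) :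
    Gen n → Module.End ℂ ((Fin (dimN t n) → ℂ) ⊗[ℂ] ParVerma t n q x μ)
  | .E i => TensorProduct.map (actN t n q (.E i)) LinearMap.id +
      TensorProduct.map (actN t n q (.K i)) (actM t n q x μ (.E i))
  | .F i => TensorProduct.map (actN t n q (.F i)) (actM t n q x μ (.Kinv i)) +
      TensorProduct.map LinearMap.id (actM t n q x μ (.F i))
  | .K i => TensorProduct.map (actN t n q (.K i)) (actM t n q x μ (.K i))
  | .Kinv i => TensorProduct.map (actN t n q (.Kinv i)) (actM t n q x μ (.Kinv i))

/-- The `U_q(𝔤)`-action on `ℂ^N ⊗ M^𝔨_μ`, inflated along the surjection from the free algebra on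
the generators to `U_q(𝔤)`. Submodules, quotients and module homomorphisms are the same over the
free algebra as over `U_q(𝔤)`. -/
instance tensModule (t : Series) (n : ℕ) (q : ℂ) (x : Fin n → ℂˣ) (μ : Fin n → ℂ) :
    Module (Free n) (Tens t n q x μ) :=
  Module.compHom ((Fin (dimN t n) → ℂ) ⊗[ℂ] ParVerma t n q x μ)
    (FreeAlgebra.lift ℂ (actT t n q x μ)).toRingHom

/-- The vector `w_i ⊗ v_μ`. -/
def wv (t : Series) (n : ℕ) (q : ℂ) (x : Fin n → ℂˣ) (μ : Fin n → ℂ) (i : Fin (dimN t n)) :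
    Tens t n q x μ :=
  ((Pi.single i 1 : Fin (dimN t n) → ℂ) ⊗ₜ[ℂ] hwVec t n q x μ :
    (Fin (dimN t n) → ℂ) ⊗[ℂ] ParVerma t n q x μ)

/-! ### The centralizer `𝔨` and the set `I_𝔨` -/

/-- The skew-diagonal form on `ℂ^N`, with `(w_i, w_{i'}) = ±1`; the signs are those for which
the matrices `∑ e_{lr}` and `∑ e_{rl}` over `ε_l - ε_r = α`, `α` simple, lie in `𝔤`. -/
def form (t : Series) (n : ℕ) : Matrix (Fin (dimN t n)) (Fin (dimN t n)) ℂ :=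
  Matrix.of fun i j => if j = i.rev then
    (match t with
      | .B => (-1) ^ (i : ℕ)
      | .C => (-1) ^ (i : ℕ)
      | .D => (-1) ^ (min (i : ℕ) (i.rev : ℕ))) else 0

/-- `𝔤`, the orthogonal or symplectic Lie algebra of the form. -/
def gAlg (t : Series) (n : ℕ) : Submodule ℂ (Matrix (Fin (dimN t n)) (Fin (dimN t n)) ℂ) :=
  skewAdjointMatricesSubmodule (form t n)

/-- The torus point `x` as a diagonal matrix. -/
def torusMat (t : Series) (n : ℕ) (x : Fin n → ℂˣ) :
    Matrix (Fin (dimN t n)) (Fin (dimN t n)) ℂ :=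
  Matrix.diagonal fun i => (char x (eps t n i) : ℂ)

/-- The generalized Levi subalgebra `𝔨`: the centralizer of `x` in `𝔤`. -/
def kAlg (t : Series) (n : ℕ) (x : Fin n → ℂˣ) :
    Set (Matrix (Fin (dimN t n)) (Fin (dimN t n)) ℂ) :=
  {A | A ∈ gAlg t n ∧ A * torusMat t n x = torusMat t n x * A}

/-- `𝔨₋`: the strictly lower triangular matrices in `𝔨`. -/
def kMinus (t : Series) (n : ℕ) (x : Fin n → ℂˣ) :
    Set (Matrix (Fin (dimN t n)) (Fin (dimN t n)) ℂ) :=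
  {A | A ∈ kAlg t n x ∧ ∀ r l, r ≤ l → A r l = 0}

/-- The subspace `U(𝔨₋)𝔨₋ w_i` of `ℂ^N`: the smallest one that contains `𝔨₋ w_i` and is stable
under `𝔨₋`. -/
def lowerSpan (t : Series) (n : ℕ) (x : Fin n → ℂˣ) (i : Fin (dimN t n)) :
    Submodule ℂ (Fin (dimN t n) → ℂ) :=
  sInf {W | ∀ A ∈ kMinus t n x, A *ᵥ Pi.single i 1 ∈ W ∧ ∀ v ∈ W, A *ᵥ v ∈ W}

/-- The relation `i ⋖ j`: the vector `w_j` lies in `U(𝔨₋)𝔨₋ w_i`. -/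
def below (t : Series) (n : ℕ) (x : Fin n → ℂˣ) (i j : Fin (dimN t n)) : Prop :=
  (Pi.single j 1 : Fin (dimN t n) → ℂ) ∈ lowerSpan t n x i

/-- The set `I_𝔨` of minimal indices: they label the highest weight vectors of the irreducible
`𝔨`-submodules of `ℂ^N`. -/
def indexK (t : Series) (n : ℕ) (x : Fin n → ℂˣ) : Set (Fin (dimN t n)) :=
  {j | ∀ i, ¬ below t n x i j}

/-! ### Weights and filtration -/

/-- `λ = ħ⁻¹ λ⁰ + λ¹` belongs to `ℭ*_{𝔨,reg}`: the centralizer of `e^{2 h_{λ⁰}}` is exactly `𝔨`, and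
`λ¹ - ρ_𝔨 + ρ` is orthogonal to the roots of `𝔨`. -/
def IsRegWeight (t : Series) (n : ℕ) (x : Fin n → ℂˣ) (lam0 lam1 : Fin n → ℂ) : Prop :=
  (∀ α ∈ posRoots t n, Complex.exp (2 * pair lam0 α) = 1 ↔ α ∈ posRootsK t n x) ∧
  (∀ α ∈ posRootsK t n x,
    pair (lam1 - halfSum (posRootsK t n x) + halfSum (posRoots t n)) α = 0)

/-- The weight `λ = ħ⁻¹ λ⁰ + λ¹` at `ħ = log q`. -/
def wt {n : ℕ} (lam0 lam1 : Fin n → ℂ) (q : ℂ) : Fin n → ℂ :=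
  (Complex.log q)⁻¹ • lam0 + lam1

/-- The submodule `V^𝔨_j`, generated by `w_i ⊗ v_μ`, `i ≤ j`. -/
def V (t : Series) (n : ℕ) (q : ℂ) (x : Fin n → ℂˣ) (μ : Fin n → ℂ) (j : Fin (dimN t n)) :
    Submodule (Free n) (Tens t n q x μ) :=
  Submodule.span (Free n) (wv t n q x μ '' {i | i ≤ j})

/-- The preceding submodule `V^𝔨_{j-1}`, which is zero if `j` is the first index. -/
def Vprev (t : Series) (n : ℕ) (q : ℂ) (x : Fin n → ℂˣ) (μ : Fin n → ℂ) (j : Fin (dimN t n)) :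
    Submodule (Free n) (Tens t n q x μ) :=
  Submodule.span (Free n) (wv t n q x μ '' {i | i < j})

/-- The quotient `V^𝔨_j / V^𝔨_{j-1}`. -/
abbrev GrV (t : Series) (n : ℕ) (q : ℂ) (x : Fin n → ℂˣ) (μ : Fin n → ℂ) (j : Fin (dimN t n)) :
    Type :=
  V t n q x μ j ⧸ (Vprev t n q x μ j).submoduleOf (V t n q x μ j)

/-- The canonical map of the direct sum of `V^𝔨_j / V^𝔨_{j-1}` over `j ∈ I_𝔨` to the graded module
`gr V^𝔨 = ⨁_j V^𝔨_j / V^𝔨_{j-1}`. -/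
def grInclusion (t : Series) (n : ℕ) (q : ℂ) (x : Fin n → ℂˣ) (μ : Fin n → ℂ) :
    (⨁ j : indexK t n x, GrV t n q x μ j) →ₗ[Free n] (⨁ j, GrV t n q x μ j) :=
  DirectSum.toModule (Free n) (indexK t n x) (⨁ j, GrV t n q x μ j)
    fun j => DirectSum.lof (Free n) (Fin (dimN t n)) (GrV t n q x μ) j

end QOrtho

end

set_option linter.unusedSectionVars false
set_option linter.unusedSimpArgs false

noncomputable section

namespace QOrtho

open Free (gen)

/-! ### Roots and weights as integral vectors -/

/-! The whole statement reduces to one claim: for `j ∉ I_𝔨` the vector `w_j ⊗ v_λ` already lies in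
`V_{j-1}`. Both assertions then follow formally (`V_eq_span_indexK`, `grInclusion_bijective`).

For such `j` there is an `i` for which `α = ε_i - ε_j` is a simple root of `𝔨`
(`exists_simpleRootsK`). Let `θ` in the negative part give a singular vector `θ v_λ` of weight `λ -
α`, so that `θ v_λ` vanishes in `M^𝔨_λ`. Replacing `w ⊗ F y` by `F (w ⊗ y) - F w ⊗ K⁻¹ y`, letter by
letter, turns `w_i ⊗ θ v_λ` into a nonzero multiple of `θ_{ij} w_j ⊗ v_λ`, modulo the submodule
generated by preceding vectors. Here `θ_{ij}` is an entry of the transposed natural representation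
(`tw_iota_sub_mem`, `wv_mem_Vprev`). What remains is a singular `θ` with `θ_{ij} ≠ 0` for `q` near
`1` (`eventually_exists_sing`).

It is built by induction on the height of `α`, in the spirit of Malikov, Feigin and Fuchs. If `α` is
simple in `𝔤`, then `θ` is a generator. Otherwise some simple root `β` pairs positively with `α`,
the data reflected in `β` satisfy the same hypotheses (`Cond.reflect`), and `θ` should arise from
the vector `θ'` of the reflected problem by multiplying with complex powers of `f = f_β` on both
sides. No localization is used. By the Serre relations, `f ^ L θ'` with `L` large is a sum of
elements `X` satisfying `X f = d ^ l f X` (`Fg_pow_mul_mem`), and conjugation by a complex power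
multiplies such an `X` by `P ^ l` (`twist`). The image satisfies an explicit equation
(`twist_singular`) that allows division by the surplus power of `f` (`exists_div`, `exists_sing`).
The division requires `P ^ 2` to avoid finitely many powers of `q`. This holds near `q = 1`: as `α`
is simple in `𝔨` and `α - β` is a positive root, the classical value of `P ^ 2` is not `1`.

The entry stays nonzero because a row of the representation at the bottom of its `β`-string kills
left multiples of `f`. Comparing derivatives before and after the twist shows that the row of a
derivative of `θ` is nonzero (`twist_map_eq_zero`), and the commutator with the raising operator
(`rep_commutator`) climbs from that row to row `i` (`reflect_step`). -/

/-- The squared length of an integral vector. -/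
def nsq {n : ℕ} (v : Fin n → ℤ) : ℤ := v ⬝ᵥ v

lemma nsq_add {n : ℕ} (v w : Fin n → ℤ) : nsq (v + w) = nsq v + 2 * (v ⬝ᵥ w) + nsq w := by
  simp only [nsq, add_dotProduct, dotProduct_add, dotProduct_comm w v]; ring

lemma nsq_neg {n : ℕ} (v : Fin n → ℤ) : nsq (-v) = nsq v := by
  simp [nsq]

lemma nsq_sub {n : ℕ} (v w : Fin n → ℤ) : nsq (v - w) = nsq v - 2 * (v ⬝ᵥ w) + nsq w := by
  rw [sub_eq_add_neg, nsq_add, nsq_neg, dotProduct_neg]; ring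

lemma nsq_smul {n : ℕ} (c : ℤ) (v : Fin n → ℤ) : nsq (c • v) = c ^ 2 * nsq v := by
  simp only [nsq, smul_dotProduct, dotProduct_smul, smul_eq_mul]; ring

lemma nsq_nonneg {n : ℕ} (v : Fin n → ℤ) : 0 ≤ nsq v := by
  rw [nsq, dotProduct]
  exact Finset.sum_nonneg fun i _ => mul_self_nonneg _

lemma nsq_eq_zero {n : ℕ} {v : Fin n → ℤ} : nsq v = 0 ↔ v = 0 := dotProduct_self_eq_zero

lemma nsq_single {n : ℕ} (a : Fin n) (e : ℤ) : nsq (Pi.single a e) = e ^ 2 := by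
  simp [nsq, sq]

lemma dot_sq_le {n : ℕ} (v w : Fin n → ℤ) : (v ⬝ᵥ w) ^ 2 ≤ nsq v * nsq w := by
  have := Finset.sum_mul_sq_le_sq_mul_sq Finset.univ v w
  simpa [nsq, dotProduct, sq] using this

/-- Removing a nonzero coordinate lowers the squared length by its square, which leaves nothing. -/
lemma nsq_eq_one {n : ℕ} {v : Fin n → ℤ} (h : nsq v = 1) :
    ∃ a e, e ^ 2 = 1 ∧ v = Pi.single a e := by
  have h0 : v ≠ 0 := by rintro rfl; simp [nsq] at h
  obtain ⟨a, ha⟩ := Function.ne_iff.mp h0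
  have hd := nsq_sub v (Pi.single a (v a))
  rw [h, nsq_single, dotProduct_single] at hd
  have h1 : 1 ≤ v a ^ 2 := Int.add_one_le_iff.mpr (sq_pos_of_ne_zero ha)
  have h2 := nsq_nonneg (v - Pi.single a (v a))
  have h3 : v a ^ 2 = 1 := by nlinarith
  refine ⟨a, v a, h3, ?_⟩
  rw [← sub_eq_zero, ← nsq_eq_zero]; nlinarith

lemma nsq_eq_two {n : ℕ} {v : Fin n → ℤ} (h : nsq v = 2) :
    ∃ a b e e', a < b ∧ e ^ 2 = 1 ∧ e' ^ 2 = 1 ∧ v = Pi.single a e + Pi.single b e' := by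
  have h0 : v ≠ 0 := by rintro rfl; simp [nsq] at h
  obtain ⟨a, ha⟩ := Function.ne_iff.mp h0
  have hd := nsq_sub v (Pi.single a (v a))
  rw [h, nsq_single, dotProduct_single] at hd
  have h1 : 1 ≤ v a ^ 2 := Int.add_one_le_iff.mpr (sq_pos_of_ne_zero ha)
  have h2 := nsq_nonneg (v - Pi.single a (v a))
  have hle : v a ^ 2 ≤ 2 := by nlinarith
  have h3 : v a ^ 2 = 1 := by
    have : v a ≤ 1 := by nlinarith
    have : -1 ≤ v a := by nlinarith
    interval_cases h : v a <;> simp_all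
  obtain ⟨b, e, he, hb⟩ := nsq_eq_one (v := v - Pi.single a (v a)) (by nlinarith)
  have hab : a ≠ b := by
    rintro rfl
    have := congrFun hb a
    simp at this
    simp [← this] at he
  have hv : v = Pi.single a (v a) + Pi.single b e := by rw [← hb]; abel
  rcases lt_or_gt_of_ne hab with hl | hl
  · exact ⟨a, b, v a, e, hl, h3, he, hv⟩
  · exact ⟨b, a, e, v a, hl, he, h3, by rw [add_comm]; exact hv⟩

/-- The roots are the integral vectors of certain lengths. -/
def IsRoot {n : ℕ} (t : Series) (v : Fin n → ℤ) : Prop :=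
  match t with
  | .B => nsq v = 1 ∨ nsq v = 2
  | .C => nsq v = 2 ∨ nsq v = 4 ∧ ∃ u : Fin n → ℤ, v = (2 : ℤ) • u
  | .D => nsq v = 2

/-- A shift that depends on the series. -/
def htShift : Series → ℤ
  | .B => 0
  | .C => 1
  | .D => 2

/-- The functional `2(ρ^∨, ·)` up to a normalization: it has value `2` on simple roots. -/
def ht (t : Series) {n : ℕ} (v : Fin n → ℤ) : ℤ :=
  ∑ a : Fin n, (2 * ((n : ℤ) - a) - htShift t) * v a

lemma ht_add (t : Series) {n : ℕ} (v w : Fin n → ℤ) : ht t (v + w) = ht t v + ht t w := by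
  simp [ht, mul_add, Finset.sum_add_distrib]

lemma ht_neg (t : Series) {n : ℕ} (v : Fin n → ℤ) : ht t (-v) = - ht t v := by
  simp [ht]

lemma ht_sub (t : Series) {n : ℕ} (v w : Fin n → ℤ) : ht t (v - w) = ht t v - ht t w := by
  rw [sub_eq_add_neg, ht_add, ht_neg]; ring

lemma ht_smul (t : Series) {n : ℕ} (c : ℤ) (v : Fin n → ℤ) : ht t (c • v) = c * ht t v := by
  simp only [ht, Pi.smul_apply, smul_eq_mul, Finset.mul_sum]
  exact Finset.sum_congr rfl fun _ _ => by ring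

lemma ht_zero (t : Series) {n : ℕ} : ht t (0 : Fin n → ℤ) = 0 := by simp [ht]

lemma ht_single (t : Series) {n : ℕ} (a : Fin n) (e : ℤ) : ht t (Pi.single a e) =
    (2 * ((n : ℤ) - a) - htShift t) * e := by
  simp only [ht]
  rw [Finset.sum_eq_single a]
  · simp
  · intro b _ hb; simp [hb]
  · simp

lemma IsRoot.neg {t : Series} {n : ℕ} {v : Fin n → ℤ} (h : IsRoot t v) : IsRoot t (-v) := by
  cases t
  · simpa [IsRoot, nsq_neg] using h
  · rcases h with h | ⟨h, u, rfl⟩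
    · exact Or.inl (by rwa [nsq_neg])
    · exact Or.inr ⟨by rwa [nsq_neg], -u, by simp⟩
  · simpa [IsRoot, nsq_neg] using h

lemma sq_eq_one_cases {e : ℤ} (h : e ^ 2 = 1) : e = 1 ∨ e = -1 := by
  rcases mul_eq_zero.mp (show (e - 1) * (e + 1) = 0 by linarith [h, sq e]) with h | h <;> omega

lemma single_dot_single {n : ℕ} {a b : Fin n} (h : a ≠ b) (x y : ℤ) :
    (Pi.single a x : Fin n → ℤ) ⬝ᵥ Pi.single b y = 0 := by
  simp [h.symm]

lemma ht_two_term (t : Series) {n : ℕ} (a b : Fin n) (e e' : ℤ) :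
    ht t (Pi.single a e + Pi.single b e') =
    (2 * ((n : ℤ) - a) - htShift t) * e +
    (2 * ((n : ℤ) - b) - htShift t) * e' := by
  rw [ht_add, ht_single, ht_single]

lemma nsq_two_term {n : ℕ} {a b : Fin n} (h : a ≠ b) (e e' : ℤ) :
    nsq (Pi.single a e + Pi.single b e') = e ^ 2 + e' ^ 2 := by
  rw [nsq_add, nsq_single, nsq_single, single_dot_single h]; ring

lemma IsRoot.of_nsq_two {t : Series} {n : ℕ} {v : Fin n → ℤ} (h : nsq v = 2) : IsRoot t v := by
  cases t <;> simp [IsRoot, h]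

lemma mem_posRoots_of_two {t : Series} {n : ℕ} {v : Fin n → ℤ}
    (h : nsq v = 2) (hv : 0 < ht t v) : v ∈ posRoots t n := by
  obtain ⟨a, b, e, e', hab, he, he', rfl⟩ := nsq_eq_two h
  rw [ht_two_term] at hv
  have hab' : (a : ℕ) < b := hab
  have hbn := b.2
  unfold posRoots
  rw [Finset.mem_union, Finset.mem_union]
  left
  rcases sq_eq_one_cases he with rfl | rfl
  · rcases sq_eq_one_cases he' with rfl | rfl
    · right
      exact Finset.mem_image.mpr ⟨(a, b), by simpa using hab, rfl⟩
    · left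
      refine Finset.mem_image.mpr ⟨(a, b), by simpa using hab, ?_⟩
      simp [sub_eq_add_neg, Pi.single_neg]
  · exfalso
    rcases sq_eq_one_cases he' with rfl | rfl <;> cases t <;> simp only [htShift] at hv <;> omega

/-- This trades the explicit list for two invariants, length (with evenness for the long roots of
`C`) and the sign of `ht`. Reflections are then easy to handle, since they preserve the first. -/
lemma mem_posRoots_iff {t : Series} {n : ℕ} {v : Fin n → ℤ} :
    v ∈ posRoots t n ↔ IsRoot t v ∧ 0 < ht t v := by
  constructor
  · intro h
    unfold posRoots at h
    rw [Finset.mem_union, Finset.mem_union] at h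
    rcases h with (h | h) | h
    · obtain ⟨⟨a, b⟩, hab, rfl⟩ := Finset.mem_image.mp h
      have hab : a < b := by simpa using hab
      have hab' : (a : ℕ) < b := hab
      have hbn := b.2
      rw [sub_eq_add_neg, ← Pi.single_neg]
      refine ⟨IsRoot.of_nsq_two (by rw [nsq_two_term hab.ne]; norm_num), ?_⟩
      rw [ht_two_term]
      cases t <;> simp only [htShift] <;> omega
    · obtain ⟨⟨a, b⟩, hab, rfl⟩ := Finset.mem_image.mp h
      have hab : a < b := by simpa using hab
      have hab' : (a : ℕ) < b := hab
      have hbn := b.2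
      refine ⟨IsRoot.of_nsq_two (by rw [nsq_two_term hab.ne]; norm_num), ?_⟩
      rw [ht_two_term]
      cases t <;> simp only [htShift] <;> omega
    · cases t
      · obtain ⟨a, -, rfl⟩ := Finset.mem_image.mp h
        have := a.2
        refine ⟨Or.inl (by rw [nsq_single]; norm_num), ?_⟩
        rw [ht_single]; simp only [htShift]; omega
      · obtain ⟨a, -, rfl⟩ := Finset.mem_image.mp h
        have := a.2
        refine ⟨Or.inr ⟨by rw [nsq_single]; norm_num, Pi.single a 1, ?_⟩, ?_⟩
        · rw [← Pi.single_smul]; rfl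
        · rw [ht_single]; simp only [htShift]; omega
      · simp at h
  · rintro ⟨h, hv⟩
    cases t
    · rcases h with h | h
      · obtain ⟨a, e, he, rfl⟩ := nsq_eq_one h
        rw [ht_single] at hv
        have := a.2
        rcases sq_eq_one_cases he with rfl | rfl
        · unfold posRoots
          exact Finset.mem_union_right _ (Finset.mem_image_of_mem _ (Finset.mem_univ a))
        · simp only [htShift] at hv; omega
      · exact mem_posRoots_of_two h hv
    · rcases h with h | ⟨h, u, rfl⟩
      · exact mem_posRoots_of_two h hv
      · rw [nsq_smul] at h
        obtain ⟨a, e, he, rfl⟩ := nsq_eq_one (v := u) (by omega)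
        rw [ht_smul, ht_single] at hv
        have := a.2
        rcases sq_eq_one_cases he with rfl | rfl
        · unfold posRoots
          refine Finset.mem_union_right _ (Finset.mem_image.mpr ⟨a, Finset.mem_univ a, ?_⟩)
          rw [← Pi.single_smul]; rfl
        · simp only [htShift] at hv; omega
    · exact mem_posRoots_of_two h hv

lemma IsRoot.ht_ne_zero {t : Series} {n : ℕ} {v : Fin n → ℤ} (h : IsRoot t v) : ht t v ≠ 0 := by
  have h2 : nsq v = 2 → ht t v ≠ 0 := by
    intro h
    obtain ⟨a, b, e, e', hab, he, he', rfl⟩ := nsq_eq_two h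
    rw [ht_two_term]
    have hab' : (a : ℕ) < b := hab
    have hbn := b.2
    rcases sq_eq_one_cases he with rfl | rfl <;> rcases sq_eq_one_cases he' with rfl | rfl <;>
      cases t <;> simp only [htShift] <;> omega
  cases t
  · rcases h with h | h
    · obtain ⟨a, e, he, rfl⟩ := nsq_eq_one h
      rw [ht_single]
      have := a.2
      rcases sq_eq_one_cases he with rfl | rfl <;> simp only [htShift] <;> omega
    · exact h2 h
  · rcases h with h | ⟨h, u, rfl⟩
    · exact h2 h
    · rw [nsq_smul] at h
      obtain ⟨a, e, he, rfl⟩ := nsq_eq_one (v := u) (by omega)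
      rw [ht_smul, ht_single]
      have := a.2
      rcases sq_eq_one_cases he with rfl | rfl <;> simp only [htShift] <;> omega
  · exact h2 h

lemma IsRoot.pos_or_neg {t : Series} {n : ℕ} {v : Fin n → ℤ} (h : IsRoot t v) :
    v ∈ posRoots t n ∨ -v ∈ posRoots t n := by
  rcases lt_or_gt_of_ne h.ht_ne_zero with h' | h'
  · exact Or.inr (mem_posRoots_iff.mpr ⟨h.neg, by rw [ht_neg]; omega⟩)
  · exact Or.inl (mem_posRoots_iff.mpr ⟨h, h'⟩)

lemma IsRoot.nsq_mem {t : Series} {n : ℕ} {v : Fin n → ℤ} (h : IsRoot t v) :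
    nsq v = 1 ∧ t = .B ∨ nsq v = 2 ∨ nsq v = 4 ∧ t = .C ∧ ∃ u : Fin n → ℤ, v = (2 : ℤ) • u := by
  cases t
  · rcases h with h | h <;> simp [h]
  · exact Or.inr (h.imp id fun h => ⟨h.1, rfl, h.2⟩)
  · have h : nsq v = 2 := h
    simp [h]

/-! ### Cartan integers and reflections. -/

/-- The integer `2(v, β)/(β, β)`. -/
def cart {n : ℕ} (v β : Fin n → ℤ) : ℤ := 2 * (v ⬝ᵥ β) / nsq β

/-- The reflection of `v` in `β`. -/
def srefl {n : ℕ} (β v : Fin n → ℤ) : Fin n → ℤ := v - cart v β • β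

/-- The division in `cart` is exact. For squared length `4` the missing factor `2` comes from `β = 2
u`. -/
lemma IsRoot.cart_mul {t : Series} {n : ℕ} {β : Fin n → ℤ} (h : IsRoot t β) (v : Fin n → ℤ) :
    cart v β * nsq β = 2 * (v ⬝ᵥ β) := by
  unfold cart
  apply Int.ediv_mul_cancel
  rcases h.nsq_mem with ⟨h, -⟩ | h | ⟨h, -, u, rfl⟩
  · simp [h]
  · simp [h]
  · rw [h, two_smul, dotProduct_add]; exact ⟨v ⬝ᵥ u, by ring⟩

lemma IsRoot.nsq_pos {t : Series} {n : ℕ} {β : Fin n → ℤ} (h : IsRoot t β) : 0 < nsq β := by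
  rcases h.nsq_mem with ⟨h, -⟩ | h | ⟨h, -⟩ <;> omega

lemma IsRoot.nsq_refl {t : Series} {n : ℕ} {β : Fin n → ℤ} (h : IsRoot t β) (v : Fin n → ℤ) :
    nsq (srefl β v) = nsq v := by
  have := h.cart_mul v
  rw [srefl, nsq_sub, dotProduct_smul, nsq_smul, smul_eq_mul]
  linear_combination (cart v β) * this

lemma IsRoot.reflect {t : Series} {n : ℕ} {β v : Fin n → ℤ} (h : IsRoot t β) (hv : IsRoot t v) :
    IsRoot t (srefl β v) := by
  have hn := h.nsq_refl v
  cases t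
  · rcases hv with hv | hv
    · exact Or.inl (hn.trans hv)
    · exact Or.inr (hn.trans hv)
  · rcases hv with hv | ⟨hv, u, rfl⟩
    · exact Or.inl (hn.trans hv)
    · refine Or.inr ⟨hn.trans hv, srefl β u, ?_⟩
      have h1 := h.cart_mul u
      have h2 := h.cart_mul ((2 : ℤ) • u)
      rw [two_smul, add_dotProduct] at h2
      have h3 : cart ((2 : ℤ) • u) β = 2 * cart u β := by
        apply mul_right_cancel₀ h.nsq_pos.ne'
        rw [two_smul, h2]; linarith
      rw [srefl, srefl, h3, smul_sub, mul_smul]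
  · exact hn.trans hv

lemma IsRoot.dot_self {t : Series} {n : ℕ} {β : Fin n → ℤ} (h : IsRoot t β) : cart β β = 2 := by
  apply mul_right_cancel₀ h.nsq_pos.ne'
  rw [h.cart_mul]; rfl

/-- A root of positive Cartan pairing with `β` differs from `β` by a root. -/
lemma IsRoot.sub_of_cart_pos {t : Series} {n : ℕ} {β v : Fin n → ℤ} (h : IsRoot t β)
    (hv : IsRoot t v) (hne : v ≠ β) (hc : 0 < cart v β) :
    IsRoot t (v - β) ∧ (cart v β = 1 ∨ cart v β = 2) := by
  have hcm := h.cart_mul v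
  have hcs := dot_sq_le v β
  have hb := h.nsq_pos
  have hn := nsq_sub v β
  have hn0 : 0 < nsq (v - β) := lt_of_le_of_ne (nsq_nonneg _) fun h0 =>
    hne (sub_eq_zero.mp (nsq_eq_zero.mp h0.symm))
  by_cases h1 : cart v β = 1
  · refine ⟨?_, Or.inl h1⟩
    have := h.reflect hv
    rwa [srefl, h1, one_smul] at this
  -- Cauchy–Schwarz and the possible root lengths exclude Cartan integers of three or more.
  · have hle : cart v β ≤ 2 := by
      by_contra hgt
      have h3 : 3 ≤ cart v β := by omega
      have hv4 : nsq v ≤ 4 := by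
        rcases hv.nsq_mem with ⟨hv1, -⟩ | hv1 | ⟨hv1, -⟩ <;> omega
      rcases h.nsq_mem with ⟨hb1, rfl⟩ | hb1 | ⟨hb1, rfl, -⟩
      · have hv2 : nsq v ≤ 2 := by
          rcases hv.nsq_mem with ⟨hv1, -⟩ | hv1 | ⟨hv1, h0, -⟩
          · omega
          · omega
          · cases h0
        rw [hb1] at hcm hcs
        nlinarith
      · rw [hb1] at hcm hcs
        nlinarith
      · rw [hb1] at hcm hcs
        nlinarith
    -- Now `nsq (v - β) = nsq v - nsq β`; as `v ≠ β`, this is positive, so `v` is long, `β` is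
    -- short, and the difference has the length of a short root.
    have h2 : cart v β = 2 := by omega
    refine ⟨?_, Or.inr h2⟩
    rw [h2] at hcm
    have hd : v ⬝ᵥ β = nsq β := by linarith
    rw [hd] at hn
    rcases h.nsq_mem with ⟨hb1, rfl⟩ | hb1 | ⟨hb1, rfl, -⟩
    · rcases hv.nsq_mem with ⟨hv1, ht⟩ | hv1 | ⟨hv1, ht, -⟩
      · omega
      · exact Or.inl (by omega)
      · cases ht
    · rcases hv.nsq_mem with ⟨hv1, rfl⟩ | hv1 | ⟨hv1, rfl, -⟩
      · omega
      · omega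
      · exact Or.inl (by omega)
    · rcases hv.nsq_mem with ⟨hv1, ht⟩ | hv1 | ⟨hv1, ht, -⟩
      · cases ht
      · omega
      · omega

/-! ### Positive systems, simple roots, weights of the natural representation -/

lemma char_add {n : ℕ} (x : Fin n → ℂˣ) (v w : Fin n → ℤ) :
    char x (v + w) = char x v * char x w := by
  simp [char, zpow_add, Finset.prod_mul_distrib]

lemma char_neg {n : ℕ} (x : Fin n → ℂˣ) (v : Fin n → ℤ) : char x (-v) = (char x v)⁻¹ := by
  simp [char]

lemma char_sub {n : ℕ} (x : Fin n → ℂˣ) (v w : Fin n → ℤ) :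
    char x (v - w) = char x v * (char x w)⁻¹ := by
  rw [sub_eq_add_neg, char_add, char_neg]

lemma char_smul {n : ℕ} (x : Fin n → ℂˣ) (c : ℤ) (v : Fin n → ℤ) :
    char x (c • v) = char x v ^ c := by
  simp only [char, Pi.smul_apply, smul_eq_mul, ← Finset.prod_zpow, mul_comm c, zpow_mul]

lemma mem_posRootsK {t : Series} {n : ℕ} {x : Fin n → ℂˣ} {v : Fin n → ℤ} :
    v ∈ posRootsK t n x ↔ v ∈ posRoots t n ∧ char x v = 1 := by
  simp [posRootsK]

lemma posRootsK_one (t : Series) (n : ℕ) : posRootsK t n 1 = posRoots t n := by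
  ext v; simp [mem_posRootsK, char]

lemma isRoot_of_posRootsK {t : Series} {n : ℕ} {x : Fin n → ℂˣ} {v : Fin n → ℤ}
    (h : v ∈ posRootsK t n x) : IsRoot t v :=
  (mem_posRoots_iff.mp (mem_posRootsK.mp h).1).1

/-- If the difference were negative, `α = β + (α - β)` would split `α` inside the positive roots of
`𝔨`. -/
lemma sub_mem_of_simple {t : Series} {n : ℕ} {x : Fin n → ℂˣ} {α β : Fin n → ℤ}
    (hα : α ∈ simpleRootsK t n x) (hβ : β ∈ posRootsK t n x) (hr : IsRoot t (β - α)) :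
    β - α ∈ posRootsK t n x := by
  have hc : char x (β - α) = 1 := by
    rw [char_sub, (mem_posRootsK.mp hβ).2, (mem_posRootsK.mp hα.1).2]; simp
  rcases hr.pos_or_neg with h | h
  · exact mem_posRootsK.mpr ⟨h, hc⟩
  · refine absurd ⟨β, hβ, α - β, ?_, by abel⟩ hα.2
    rw [neg_sub] at h
    refine mem_posRootsK.mpr ⟨h, ?_⟩
    rw [← neg_sub, char_neg, hc, inv_one]

/-- The reflection in a simple root permutes the other positive roots. -/
lemma refl_mem_posRootsK {t : Series} {n : ℕ} {x : Fin n → ℂˣ} {α β : Fin n → ℤ}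
    (hα : α ∈ simpleRootsK t n x) (hβ : β ∈ posRootsK t n x) (hne : β ≠ α) :
    srefl α β ∈ posRootsK t n x := by
  have hra := isRoot_of_posRootsK hα.1
  have hrb := isRoot_of_posRootsK hβ
  have hc : char x (srefl α β) = 1 := by
    rw [srefl, char_sub, char_smul, (mem_posRootsK.mp hβ).2, (mem_posRootsK.mp hα.1).2]; simp
  rcases le_or_gt (cart β α) 0 with h | h
  · refine mem_posRootsK.mpr ⟨mem_posRoots_iff.mpr ⟨hra.reflect hrb, ?_⟩, hc⟩
    rw [srefl, ht_sub, ht_smul]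
    have h1 := (mem_posRoots_iff.mp (mem_posRootsK.mp hβ).1).2
    have h2 := (mem_posRoots_iff.mp (mem_posRootsK.mp hα.1).1).2
    nlinarith
  · obtain ⟨hr, h1 | h2⟩ := hra.sub_of_cart_pos hrb hne h
    · have := sub_mem_of_simple hα hβ hr
      rwa [srefl, h1, one_smul]
    · have h3 := sub_mem_of_simple hα hβ hr
      have h4 : β - α - α = srefl α β := by rw [srefl, h2, two_smul]; abel
      rw [← h4]
      exact sub_mem_of_simple hα h3 (h4 ▸ hra.reflect hrb)

lemma IsRoot.refl_refl {t : Series} {n : ℕ} {α : Fin n → ℤ} (h : IsRoot t α) (v : Fin n → ℤ) :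
    srefl α (srefl α v) = v := by
  have : cart (srefl α v) α = - cart v α := by
    apply mul_right_cancel₀ h.nsq_pos.ne'
    rw [h.cart_mul, srefl, sub_dotProduct, smul_dotProduct, smul_eq_mul]
    have := h.cart_mul v
    change 2 * (v ⬝ᵥ α - cart v α * nsq α) = _
    linarith
  rw [srefl, this, srefl]
  simp

lemma IsRoot.refl_dot {t : Series} {n : ℕ} {α : Fin n → ℤ} (h : IsRoot t α) (v : Fin n → ℤ) :
    srefl α v ⬝ᵥ α = - (v ⬝ᵥ α) := by
  have := h.cart_mul v
  rw [srefl, sub_dotProduct, smul_dotProduct, smul_eq_mul]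
  change v ⬝ᵥ α - cart v α * nsq α = _
  linarith

lemma IsRoot.refl_self {t : Series} {n : ℕ} {α : Fin n → ℤ} (h : IsRoot t α) :
    srefl α α = -α := by
  rw [srefl, h.dot_self, two_smul]; abel

/-- The reflection in `α` is an involution of the other positive roots and negates their pairing
with `α`, so only `α` itself contributes. In other words, `(2ρ_𝔨, α) = (α, α)`. -/
lemma sum_posRootsK_dot {t : Series} {n : ℕ} {x : Fin n → ℂˣ} {α : Fin n → ℤ}
    (hα : α ∈ simpleRootsK t n x) : ∑ β ∈ posRootsK t n x, β ⬝ᵥ α = nsq α := by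
  classical
  have hra := isRoot_of_posRootsK hα.1
  rw [← Finset.add_sum_erase _ _ hα.1]
  have : ∑ β ∈ (posRootsK t n x).erase α, β ⬝ᵥ α = 0 := by
    have hp : ∀ β ∈ (posRootsK t n x).erase α, srefl α β ∈ (posRootsK t n x).erase α := by
      intro β hβ
      rw [Finset.mem_erase] at hβ ⊢
      refine ⟨?_, refl_mem_posRootsK hα hβ.2 hβ.1⟩
      intro h
      have h2 := hra.refl_refl β
      rw [h, hra.refl_self] at h2
      have h3 := (mem_posRoots_iff.mp (mem_posRootsK.mp hβ.2).1).2
      have h4 := (mem_posRoots_iff.mp (mem_posRootsK.mp hα.1).1).2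
      rw [← h2, ht_neg] at h3
      omega
    refine Finset.sum_involution (fun β _ => srefl α β) ?_ ?_ hp ?_
    · intro β _; rw [hra.refl_dot]; ring
    · intro β _ h0 h1
      have := hra.refl_dot β
      rw [h1] at this
      omega
    · intro β _; exact hra.refl_refl β
  rw [this]; simp [nsq]

lemma pair_add_left {n : ℕ} (μ ν : Fin n → ℂ) (α : Fin n → ℤ) :
    pair (μ + ν) α = pair μ α + pair ν α := by
  simp [pair, add_mul, Finset.sum_add_distrib]

lemma pair_sub_left {n : ℕ} (μ ν : Fin n → ℂ) (α : Fin n → ℤ) :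
    pair (μ - ν) α = pair μ α - pair ν α := by
  simp [pair, sub_mul, Finset.sum_sub_distrib]

lemma pair_smul_left {n : ℕ} (c : ℂ) (μ : Fin n → ℂ) (α : Fin n → ℤ) :
    pair (c • μ) α = c * pair μ α := by
  simp [pair, Finset.mul_sum, mul_assoc]

lemma pair_add {n : ℕ} (μ : Fin n → ℂ) (α β : Fin n → ℤ) :
    pair μ (α + β) = pair μ α + pair μ β := by
  simp [pair, mul_add, Finset.sum_add_distrib]

lemma pair_neg {n : ℕ} (μ : Fin n → ℂ) (α : Fin n → ℤ) : pair μ (-α) = - pair μ α := by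
  simp [pair]

lemma pair_sub {n : ℕ} (μ : Fin n → ℂ) (α β : Fin n → ℤ) :
    pair μ (α - β) = pair μ α - pair μ β := by
  rw [sub_eq_add_neg, pair_add, pair_neg]; ring

lemma pair_zero {n : ℕ} (μ : Fin n → ℂ) : pair μ 0 = 0 := by simp [pair]

lemma pair_smul {n : ℕ} (μ : Fin n → ℂ) (c : ℤ) (α : Fin n → ℤ) :
    pair μ (c • α) = c * pair μ α := by
  simp only [pair, Finset.mul_sum, Pi.smul_apply, smul_eq_mul, Int.cast_mul]
  exact Finset.sum_congr rfl fun _ _ => by ring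

lemma pair_intCast {n : ℕ} (v α : Fin n → ℤ) : pair (fun a => (v a : ℂ)) α = ((v ⬝ᵥ α : ℤ) : ℂ) := by
  simp [pair, dotProduct]

lemma pair_halfSum {n : ℕ} (S : Finset (Fin n → ℤ)) (α : Fin n → ℤ) :
    pair (halfSum S) α = ((∑ β ∈ S, β ⬝ᵥ α : ℤ) : ℂ) / 2 := by
  simp only [pair, halfSum, dotProduct, Int.cast_sum, Int.cast_mul]
  rw [Finset.sum_comm, Finset.sum_div]
  refine Finset.sum_congr rfl fun a _ => ?_
  rw [Finset.sum_div, Finset.sum_div, Finset.sum_mul]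
  exact Finset.sum_congr rfl fun _ _ => by ring

lemma simpleRoot_isRoot_ht (t : Series) (n : ℕ) (hD : t = .D → 3 ≤ n) (s : Fin n) :
    IsRoot t (simpleRoot t n s) ∧ ht t (simpleRoot t n s) = 2 := by
  have hs := s.2
  unfold simpleRoot
  split_ifs with h
  · rw [sub_eq_add_neg, ← Pi.single_neg]
    refine ⟨IsRoot.of_nsq_two ?_, ?_⟩
    · rw [nsq_two_term (by simp [Fin.ext_iff])]; norm_num
    · rw [ht_two_term]; push_cast; ring
  · cases t
    · refine ⟨Or.inl (by simp [nsq_single]), ?_⟩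
      simp only [ht_single, htShift]; omega
    · refine ⟨Or.inr ⟨by simp only [nsq_single]; norm_num, Pi.single s 1, ?_⟩, ?_⟩
      · rw [← Pi.single_smul]; rfl
      · simp only [ht_single, htShift]; omega
    · have := hD rfl
      refine ⟨IsRoot.of_nsq_two ?_, ?_⟩
      · simp only
        rw [nsq_two_term (by simp [Fin.ext_iff]; omega)]; norm_num
      · simp only [ht_two_term, htShift]; omega

/-- Every positive root has `ht` at least `2`, so a sum of two has at least `4`, whereas a simple
root has exactly `2`. The point `x = 1` makes `𝔨 = 𝔤`, which lets the lemmas on `𝔨` serve `𝔤` too.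
-/
lemma simpleRoot_mem {t : Series} {n : ℕ} (hD : t = .D → 3 ≤ n) (s : Fin n) :
    simpleRoot t n s ∈ simpleRootsK t n 1 := by
  obtain ⟨hr, hh⟩ := simpleRoot_isRoot_ht t n hD s
  have h2 : ∀ v ∈ posRoots t n, 2 ≤ ht t v := by
    intro v hv
    obtain ⟨h1, h2⟩ := mem_posRoots_iff.mp hv
    have : ∀ w : Fin n → ℤ, nsq w = 2 → 0 < ht t w → 2 ≤ ht t w := by
      intro w hw hpos
      obtain ⟨a, b, e, e', hab, he, he', rfl⟩ := nsq_eq_two hw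
      rw [ht_two_term] at hpos ⊢
      have hab' : (a : ℕ) < b := hab
      have hbn := b.2
      rcases sq_eq_one_cases he with rfl | rfl <;> rcases sq_eq_one_cases he' with rfl | rfl <;>
        cases t <;> simp only [htShift] at hpos ⊢ <;> omega
    cases t
    · rcases h1 with h | h
      · obtain ⟨a, e, he, rfl⟩ := nsq_eq_one h
        rw [ht_single] at h2 ⊢
        have := a.2
        rcases sq_eq_one_cases he with rfl | rfl <;> simp only [htShift] at h2 ⊢ <;> omega
      · exact this v h h2
    · rcases h1 with h | ⟨h, u, rfl⟩
      · exact this v h h2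
      · rw [ht_smul] at h2 ⊢; omega
    · exact this v h1 h2
  refine ⟨by rw [posRootsK_one]; exact mem_posRoots_iff.mpr ⟨hr, by omega⟩, ?_⟩
  rintro ⟨β, hβ, γ, hγ, h⟩
  rw [posRootsK_one] at hβ hγ
  have h3 := h2 β hβ
  have h4 := h2 γ hγ
  rw [h, ht_add] at hh
  omega

lemma refl_mem_posRoots {t : Series} {n : ℕ} (hD : t = .D → 3 ≤ n) (s : Fin n) {β : Fin n → ℤ}
    (hβ : β ∈ posRoots t n) (hne : β ≠ simpleRoot t n s) :
    srefl (simpleRoot t n s) β ∈ posRoots t n := by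
  rw [← posRootsK_one] at hβ ⊢
  exact refl_mem_posRootsK (simpleRoot_mem hD s) hβ hne

lemma pair_rho_simpleRoot {t : Series} {n : ℕ} (hD : t = .D → 3 ≤ n) (s : Fin n) :
    pair (halfSum (posRoots t n)) (simpleRoot t n s) = (nsq (simpleRoot t n s) : ℂ) / 2 := by
  rw [pair_halfSum, ← posRootsK_one, sum_posRootsK_dot (simpleRoot_mem hD s)]

lemma dot_simpleRoot_of_lt {t : Series} {n : ℕ} (v : Fin n → ℤ) (s : Fin n) (h : (s : ℕ) + 1 < n) :
    v ⬝ᵥ simpleRoot t n s = v s - v ⟨s + 1, h⟩ := by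
  simp [simpleRoot, h, dotProduct_sub]

lemma dot_simpleRoot_last {t : Series} {n : ℕ} (v : Fin n → ℤ) (s : Fin n) (h : ¬ (s : ℕ) + 1 < n) :
    v ⬝ᵥ simpleRoot t n s = match t with
      | .B => v s
      | .C => v s * 2
      | .D => v ⟨(s : ℕ) - 1, by omega⟩ + v s := by
  cases t <;> simp [simpleRoot, h, dotProduct_add]

lemma exists_simpleRoot_dot_pos {t : Series} {n : ℕ} {α : Fin n → ℤ}
    (h : α ∈ posRoots t n) : ∃ s, 0 < α ⬝ᵥ simpleRoot t n s := by
  -- It suffices that `α` is positive at a coordinate `a` and drops at the next one, for then `α_a`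
  -- works. The last condition concerns the final node of `D`, whose root `ε_{n-1} + ε_n` also sees
  -- the coordinate before `a`.
  have key : ∀ a : Fin n, 0 < α a → (∀ b : Fin n, (b : ℕ) = a + 1 → α b < α a) →
      (t = .D → ∀ b : Fin n, (a : ℕ) + 1 = n → (b : ℕ) + 1 = a → 0 ≤ α b) →
      ∃ s, 0 < α ⬝ᵥ simpleRoot t n s := by
    intro a h0 h1 h2
    refine ⟨a, ?_⟩
    by_cases hl : (a : ℕ) + 1 < n
    · rw [dot_simpleRoot_of_lt _ _ hl]
      have := h1 ⟨a + 1, hl⟩ rfl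
      omega
    · rw [dot_simpleRoot_last _ _ hl]
      cases t
      · simpa using h0
      · simp only; omega
      · simp only
        by_cases ha : (a : ℕ) = 0
        · have : (⟨(a : ℕ) - 1, by omega⟩ : Fin n) = a := by ext; simp [ha]
          rw [this]; omega
        · have := h2 rfl ⟨(a : ℕ) - 1, by omega⟩ (by omega) (by simp; omega)
          omega
  unfold posRoots at h
  rw [Finset.mem_union, Finset.mem_union] at h
  rcases h with (h | h) | h
  · obtain ⟨⟨a, b⟩, hab, rfl⟩ := Finset.mem_image.mp h
    have hab : a < b := by simpa using hab
    refine key a (by simp [hab.ne]) ?_ ?_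
    · intro c hc
      have : c ≠ a := by rintro rfl; omega
      simp only [Pi.sub_apply, Pi.single_apply, this, hab.ne, if_false, if_true]; split_ifs <;> simp
    · intro _ c h1 h2
      have : (a : ℕ) < b := hab
      omega
  · obtain ⟨⟨a, b⟩, hab, rfl⟩ := Finset.mem_image.mp h
    have hab : a < b := by simpa using hab
    have hab' : (a : ℕ) < b := hab
    by_cases hb : (b : ℕ) = a + 1
    · refine key b (by simp [hab.ne']) ?_ ?_
      · intro c hc
        have h1 : c ≠ a := by rintro rfl; omega
        have h2 : c ≠ b := by rintro rfl; omega
        simp [h1, h2, hab.ne']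
      · intro _ c _ _
        simp only [Pi.add_apply, Pi.single_apply]; split_ifs <;> simp
    · refine key a (by simp [hab.ne]) ?_ ?_
      · intro c hc
        have h1 : c ≠ a := by rintro rfl; omega
        have h2 : c ≠ b := by rintro rfl; omega
        simp [h1, h2, hab.ne]
      · intro _ c _ _
        simp only [Pi.add_apply, Pi.single_apply]; split_ifs <;> simp
  · cases t
    · obtain ⟨a, -, rfl⟩ := Finset.mem_image.mp h
      refine key a (by simp) ?_ (by simp)
      intro c hc
      have h1 : c ≠ a := by rintro rfl; omega
      simp [h1]
    · obtain ⟨a, -, rfl⟩ := Finset.mem_image.mp h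
      refine key a (by simp) ?_ (by simp)
      intro c hc
      have h1 : c ≠ a := by rintro rfl; omega
      simp [h1]
    · simp at h

/-! Weights -/

lemma eps_of_lt {t : Series} {n : ℕ} {k : Fin (dimN t n)} (h : (k : ℕ) < n) :
    eps t n k = Pi.single ⟨k, h⟩ 1 := by simp [eps, h]

lemma eps_rev (t : Series) (n : ℕ) (k : Fin (dimN t n)) : eps t n k.rev = - eps t n k := by
  have hk := k.2
  have hr : (k.rev : ℕ) = dimN t n - (k + 1) := Fin.val_rev k
  have hN : 2 * n ≤ dimN t n := by cases t <;> simp [dimN]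
  unfold eps
  by_cases h1 : (k : ℕ) < n
  · have h2 : ¬ (k.rev : ℕ) < n := by omega
    rw [dif_pos h1, dif_neg h2, dif_pos (by rwa [Fin.rev_rev])]
    simp only [Fin.rev_rev]
  · rw [dif_neg h1]
    by_cases h2 : (k.rev : ℕ) < n
    · rw [dif_pos h2, dif_pos h2, neg_neg]
    · rw [dif_neg h2, dif_neg h2, dif_neg (by rwa [Fin.rev_rev]), neg_zero]

lemma nsq_eps_eq (t : Series) (n : ℕ) (k : Fin (dimN t n)) :
    nsq (eps t n k) = 1 ∨ t = .B ∧ eps t n k = 0 := by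
  have hk := k.2
  have hr : (k.rev : ℕ) = dimN t n - (k + 1) := Fin.val_rev k
  unfold eps
  by_cases h1 : (k : ℕ) < n
  · left; simp [h1, nsq_single]
  · by_cases h2 : (k.rev : ℕ) < n
    · left; rw [dif_neg h1, dif_pos h2, nsq_neg, nsq_single]; norm_num
    · right
      cases t
      · exact ⟨rfl, by rw [dif_neg h1, dif_neg h2]⟩
      · simp only [dimN, htShift] at *; omega
      · simp only [dimN, htShift] at *; omega

/-- Weights are detected by their length alone, which is why reflections permute them. -/
lemma exists_eps_iff {t : Series} {n : ℕ} {v : Fin n → ℤ} :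
    (∃ k, eps t n k = v) ↔ nsq v = 1 ∨ t = .B ∧ v = 0 := by
  constructor
  · rintro ⟨k, rfl⟩
    exact nsq_eps_eq t n k
  · have hN : 2 * n ≤ dimN t n := by cases t <;> simp [dimN]
    rintro (h | ⟨rfl, rfl⟩)
    · obtain ⟨a, e, he, rfl⟩ := nsq_eq_one h
      have ha := a.2
      have h1 : eps t n ⟨a, by omega⟩ = Pi.single a 1 := eps_of_lt (k := ⟨a, by omega⟩) a.2
      rcases sq_eq_one_cases he with rfl | rfl
      · exact ⟨_, h1⟩
      · exact ⟨_, by rw [eps_rev, h1, Pi.single_neg]⟩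
    · refine ⟨⟨n, by simp only [dimN]; omega⟩, ?_⟩
      have : ¬ ((Fin.rev (⟨n, by simp only [dimN]; omega⟩ : Fin (dimN .B n)) : Fin _) : ℕ) < n := by
        simp [dimN, Fin.val_rev]; omega
      simp only [eps, lt_irrefl, this, dite_false]

lemma ht_eps_of_lt {t : Series} {n : ℕ} {k : Fin (dimN t n)} (h : (k : ℕ) < n) :
    ht t (eps t n k) = 2 * ((n : ℤ) - k) - htShift t := by
  rw [eps_of_lt h, ht_single]; simp

lemma ht_eps_of_rev_lt {t : Series} {n : ℕ} {k : Fin (dimN t n)} (h : (k.rev : ℕ) < n) :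
    ht t (eps t n k) = -(2 * ((n : ℤ) - k.rev) - htShift t) := by
  have := ht_eps_of_lt h
  rw [eps_rev, ht_neg] at this
  linarith

lemma eps_mid {t : Series} {n : ℕ} {k : Fin (dimN t n)} (h : ¬ (k : ℕ) < n)
    (h' : ¬ (k.rev : ℕ) < n) : eps t n k = 0 := by
  rw [eps, dif_neg h, dif_neg h']

/-- The inequality cannot be strict: in type `D` the two middle weights `±ε_n` both have height `0`.
-/
lemma ht_eps_mono {t : Series} {n : ℕ} {k l : Fin (dimN t n)} (h : k ≤ l) :
    ht t (eps t n l) ≤ ht t (eps t n k) := by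
  have hk := k.2
  have hl := l.2
  have h' : (k : ℕ) ≤ l := h
  have hr : (k.rev : ℕ) = dimN t n - (k + 1) := Fin.val_rev k
  have hr' : (l.rev : ℕ) = dimN t n - (l + 1) := Fin.val_rev l
  by_cases h1 : (k : ℕ) < n
  · rw [ht_eps_of_lt h1]
    by_cases h2 : (l : ℕ) < n
    · rw [ht_eps_of_lt h2]; cases t <;> simp only [dimN, htShift] at * <;> omega
    · by_cases h3 : (l.rev : ℕ) < n
      · rw [ht_eps_of_rev_lt h3]; cases t <;> simp only [dimN, htShift] at * <;> omega
      · rw [eps_mid h2 h3, ht_zero]; cases t <;> simp only [dimN, htShift] at * <;> omega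
  · have h2 : ¬ (l : ℕ) < n := by omega
    by_cases h1' : (k.rev : ℕ) < n
    · have h3 : (l.rev : ℕ) < n := by omega
      rw [ht_eps_of_rev_lt h1', ht_eps_of_rev_lt h3]; cases t <;> simp only [dimN, htShift] at * <;> omega
    · rw [eps_mid h1 h1', ht_zero]
      by_cases h3 : (l.rev : ℕ) < n
      · rw [ht_eps_of_rev_lt h3]; cases t <;> simp only [dimN, htShift] at * <;> omega
      · rw [eps_mid h2 h3, ht_zero]

lemma lt_of_ht_eps_lt {t : Series} {n : ℕ} {k l : Fin (dimN t n)}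
    (h : ht t (eps t n l) < ht t (eps t n k)) : k < l := by
  by_contra hkl
  have := ht_eps_mono (t := t) (n := n) (not_lt.mp hkl)
  omega

lemma eps_injective (t : Series) (n : ℕ) : Function.Injective (eps t n) := by
  have key : ∀ k l : Fin (dimN t n), (k : ℕ) < n → eps t n k = eps t n l → k = l := by
    intro k l hk h
    rw [eps_of_lt hk] at h
    by_cases hl : (l : ℕ) < n
    · rw [eps_of_lt hl] at h
      have := congrFun h ⟨k, hk⟩
      rw [Pi.single_eq_same, Pi.single_apply] at this
      split_ifs at this with h3
      · ext; simpa using h3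
      · simp at this
    · by_cases hl' : (l.rev : ℕ) < n
      · rw [← Fin.rev_rev l, eps_rev, eps_of_lt hl'] at h
        have := congrFun h ⟨k, hk⟩
        rw [Pi.single_eq_same, Pi.neg_apply, Pi.single_apply] at this
        (split_ifs at this; omega)
      · rw [eps_mid hl hl'] at h
        have := congrFun h ⟨k, hk⟩
        simp at this
  intro k l h
  by_cases hk : (k : ℕ) < n
  · exact key k l hk h
  by_cases hl : (l : ℕ) < n
  · exact (key l k hl h.symm).symm
  by_cases hk' : (k.rev : ℕ) < n
  · exact Fin.rev_injective (key _ _ hk' (by rw [eps_rev, eps_rev, h]))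
  by_cases hl' : (l.rev : ℕ) < n
  · exact Fin.rev_injective (key _ _ hl' (by rw [eps_rev, eps_rev, h])).symm
  have hr : (k.rev : ℕ) = dimN t n - (k + 1) := Fin.val_rev k
  have hr' : (l.rev : ℕ) = dimN t n - (l + 1) := Fin.val_rev l
  have := k.2
  have := l.2
  ext
  cases t <;> simp only [dimN, htShift] at * <;> omega

/-! ### Conjugation by complex powers of an element -/

section Eig
variable {A : Type*} [Ring A] [Algebra ℂ A]

/-- The elements that commute with `f` up to the factor `d ^ l`. -/
def eig (f : A) (d : ℂ) (l : ℤ) : Submodule ℂ A where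
  carrier := {X | X * f = d ^ l • (f * X)}
  add_mem' := by
    intro X Y hX hY
    simp only [Set.mem_ofPred_eq] at *
    rw [add_mul, hX, hY, mul_add, smul_add]
  zero_mem' := by simp
  smul_mem' := by
    intro c X hX
    simp only [Set.mem_ofPred_eq] at *
    rw [smul_mul_assoc, hX, mul_smul_comm, smul_comm]

lemma mem_eig {f : A} {d : ℂ} {l : ℤ} {X : A} : X ∈ eig f d l ↔ X * f = d ^ l • (f * X) := Iff.rfl

/-- The graph of the operator that multiplies elements of `eig f d l` by `P ^ l`, i.e. of the
conjugation by a power of `f`. -/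
def twist (f : A) (d P : ℂ) (M : Submodule ℂ A) : Submodule ℂ (A × A) :=
  ⨆ l : ℤ, (eig f d l ⊓ M).map (LinearMap.prod LinearMap.id (P ^ l • LinearMap.id))

lemma mem_twist {f : A} {d P : ℂ} {M : Submodule ℂ A} {l : ℤ} {z : A} (h : z ∈ eig f d l)
    (hM : z ∈ M) : (z, P ^ l • z) ∈ twist f d P M :=
  Submodule.mem_iSup_of_mem l ⟨z, ⟨h, hM⟩, rfl⟩

lemma twist_le {f : A} {d P : ℂ} {M : Submodule ℂ A} {N : Submodule ℂ (A × A)}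
    (h : ∀ l, ∀ z ∈ eig f d l, z ∈ M → (z, P ^ l • z) ∈ N) : twist f d P M ≤ N := by
  refine iSup_le fun l => ?_
  rintro _ ⟨z, ⟨hz, hM⟩, rfl⟩
  exact h l z hz hM

lemma twist_induction {f : A} {d P : ℂ} {M : Submodule ℂ A} {V : Type*} [AddCommGroup V]
    [Module ℂ V] (N : Submodule ℂ V) (g : A × A →ₗ[ℂ] V)
    (h : ∀ l, ∀ z ∈ eig f d l, z ∈ M → g (z, P ^ l • z) ∈ N) {p : A × A}
    (hp : p ∈ twist f d P M) : g p ∈ N :=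
  (twist_le (N := N.comap g) h) hp

lemma twist_mono {f : A} {d P : ℂ} {M M' : Submodule ℂ A} (h : M ≤ M') :
    twist f d P M ≤ twist f d P M' :=
  twist_le fun _ _ hz hM => mem_twist hz (h hM)

lemma zpow_ne_of_ne {d : ℂ} (h0 : d ≠ 0) (hd : ∀ l : ℤ, l ≠ 0 → d ^ l ≠ 1) {k l : ℤ}
    (h : k ≠ l) : d ^ k ≠ d ^ l := by
  intro hkl
  apply hd (k - l) (sub_ne_zero.mpr h)
  rw [zpow_sub₀ h0, hkl, div_self (zpow_ne_zero _ h0)]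

/-- The usual elimination for eigenvectors: right multiplication by `f` minus `d ^ k` times left
multiplication kills the `k`-th summand, and the left regularity of `f` removes the factor that the
others acquire. -/
lemma eig_independent {f : A} {d : ℂ} (h0 : d ≠ 0) (hd : ∀ l : ℤ, l ≠ 0 → d ^ l ≠ 1)
    (hf : ∀ X, f * X = 0 → X = 0) (S : Finset ℤ) :
    ∀ Y : ℤ → A, (∀ l ∈ S, Y l ∈ eig f d l) → ∑ l ∈ S, Y l = 0 → ∀ l ∈ S, Y l = 0 := by
  induction S using Finset.induction_on with
  | empty => simp
  | insert k S hk ih =>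
    intro Y hY hsum
    have h1 : ∑ l ∈ S, (d ^ l - d ^ k) • (f * Y l) = 0 := by
      have h2 : (∑ l ∈ insert k S, Y l) * f - d ^ k • (f * ∑ l ∈ insert k S, Y l) = 0 := by
        rw [hsum]; simp
      rw [Finset.sum_mul, Finset.mul_sum, Finset.smul_sum, ← Finset.sum_sub_distrib,
        Finset.sum_insert hk, mem_eig.mp (hY k (Finset.mem_insert_self _ _)), sub_self,
        zero_add] at h2
      rw [← h2]
      refine Finset.sum_congr rfl fun l hl => ?_
      rw [mem_eig.mp (hY l (Finset.mem_insert_of_mem hl)), sub_smul]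
    have h3 := ih (fun l => (d ^ l - d ^ k) • (f * Y l)) (fun l hl => by
      refine Submodule.smul_mem _ _ ?_
      rw [mem_eig, mul_assoc, mem_eig.mp (hY l (Finset.mem_insert_of_mem hl)), mul_smul_comm]) h1
    have h4 : ∀ l ∈ S, Y l = 0 := by
      intro l hl
      have hne : l ≠ k := by rintro rfl; exact hk hl
      exact hf _ ((smul_eq_zero.mp (h3 l hl)).resolve_left
        (sub_ne_zero.mpr (zpow_ne_of_ne h0 hd hne)))
    intro l hl
    rcases Finset.mem_insert.mp hl with rfl | hl
    · rwa [Finset.sum_insert hk, Finset.sum_eq_zero h4, add_zero] at hsum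
    · exact h4 l hl

/-- `twist` is introduced as a linear relation. Independence of the eigenspaces makes it single
valued, and the fibre over zero is all that later comparisons need. -/
lemma twist_zero {f : A} {d P : ℂ} (h0 : d ≠ 0) (hd : ∀ l : ℤ, l ≠ 0 → d ^ l ≠ 1)
    (hf : ∀ X, f * X = 0 → X = 0) {M : Submodule ℂ A} {y : A} (h : (0, y) ∈ twist f d P M) :
    y = 0 := by
  obtain ⟨g, hg, hsum⟩ := (Submodule.mem_iSup_iff_exists_finsupp _ _).mp h
  have hg' : ∀ l, (g l).1 ∈ eig f d l ∧ (g l).2 = P ^ l • (g l).1 := by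
    intro l
    obtain ⟨z, ⟨hz, -⟩, he⟩ := hg l
    rw [← he]
    exact ⟨hz, rfl⟩
  have h1 : ∑ l ∈ g.support, (g l).1 = 0 := by
    have := congrArg Prod.fst hsum
    rwa [Finsupp.sum, Prod.fst_sum] at this
  have h2 : ∑ l ∈ g.support, (g l).2 = y := by
    have := congrArg Prod.snd hsum
    rwa [Finsupp.sum, Prod.snd_sum] at this
  have h3 := eig_independent h0 hd hf g.support (fun l => (g l).1) (fun l _ => (hg' l).1) h1
  rw [← h2]
  refine Finset.sum_eq_zero fun l hl => ?_
  rw [(hg' l).2, h3 l hl, smul_zero]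

end Eig

/-! ### Rank one calculus: skew derivations against complex powers of `f`. -/

/-- A rank one situation: an element `f` with two skew derivations `a`, `b` and a grading. -/
structure RankOne (A : Type*) [Ring A] [Algebra ℂ A] where
  f : A
  d : ℂ
  a : Module.End ℂ A
  b : Module.End ℂ A
  wt : ℤ → Submodule ℂ A
  d_ne : d ≠ 0
  d_pow : ∀ l : ℤ, l ≠ 0 → d ^ l ≠ 1
  reg : ∀ X, f * X = 0 → X = 0
  a_f_mul : ∀ ω, ∀ X ∈ wt ω, a (f * X) = f * a X + d ^ (-ω) • X
  b_f_mul : ∀ ω, ∀ X ∈ wt ω, b (f * X) = f * b X + d ^ ω • X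
  a_mul_f : ∀ X, a (X * f) = d ^ (-2 : ℤ) • (a X * f) + X
  b_mul_f : ∀ X, b (X * f) = d ^ (2 : ℤ) • (b X * f) + X
  f_mem : ∀ ω, ∀ X ∈ wt ω, f * X ∈ wt (ω + 2)
  a_mem : ∀ ω, ∀ X ∈ wt ω, a X ∈ wt (ω - 2)

namespace RankOne
variable {A : Type*} [Ring A] [Algebra ℂ A] (R : RankOne A)

lemma d_sq_ne : R.d ^ 2 - 1 ≠ 0 := by
  have := R.d_pow 2 (by norm_num)
  exact sub_ne_zero.mpr (by exact_mod_cast this)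

lemma f_pow_mem {ω : ℤ} {X : A} (hX : X ∈ R.wt ω) (m : ℕ) : R.f ^ m * X ∈ R.wt (ω + 2 * m) := by
  induction m with
  | zero => simpa using hX
  | succ m ih =>
    have := R.f_mem _ _ ih
    rw [pow_succ', mul_assoc]
    convert this using 2
    push_cast; ring

/-- The extra factor `f` on the left avoids the exponent `m - 1`, so the formula also covers `m =
0`. -/
lemma f_a_f_pow {ω : ℤ} {X : A} (hX : X ∈ R.wt ω) (m : ℕ) :
    R.f * R.a (R.f ^ m * X) = R.f ^ (m + 1) * R.a X +
      (R.d ^ (-ω) * ((1 - R.d ^ (-2 * m : ℤ)) / (1 - R.d ^ (-2 : ℤ)))) • (R.f ^ m * X) := by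
  have h0 := R.d_ne
  have h1 := R.d_sq_ne
  have h2 : 1 - R.d ^ (-2 : ℤ) ≠ 0 := by
    rw [sub_ne_zero]; exact (R.d_pow (-2) (by norm_num)).symm
  induction m with
  | zero => simp
  | succ m ih =>
    rw [pow_succ' R.f m, mul_assoc, R.a_f_mul _ _ (R.f_pow_mem hX m), mul_add, ih, mul_add,
      mul_smul_comm, mul_smul_comm, pow_succ' R.f (m + 1), mul_assoc R.f (R.f ^ (m + 1)), add_assoc,
      ← add_smul, pow_succ' R.f m, mul_assoc R.f, ← mul_assoc R.f (R.f ^ m)]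
    congr 2
    have e1 : R.d ^ (-(ω + 2 * (m : ℤ))) = R.d ^ (-ω) * R.d ^ (-2 * m : ℤ) := by
      rw [← zpow_add₀ h0]; ring_nf
    have e2 : R.d ^ (-2 * ((m + 1 : ℕ) : ℤ)) = R.d ^ (-2 : ℤ) * R.d ^ (-2 * m : ℤ) := by
      rw [← zpow_add₀ h0]; push_cast; ring_nf
    rw [e1, e2]
    field_simp
    ring

lemma f_b_f_pow {ω : ℤ} {X : A} (hX : X ∈ R.wt ω) (m : ℕ) :
    R.f * R.b (R.f ^ m * X) = R.f ^ (m + 1) * R.b X +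
      (R.d ^ ω * ((R.d ^ (2 * m : ℤ) - 1) / (R.d ^ 2 - 1))) • (R.f ^ m * X) := by
  have h0 := R.d_ne
  have h1 := R.d_sq_ne
  induction m with
  | zero => simp
  | succ m ih =>
    rw [pow_succ' R.f m, mul_assoc, R.b_f_mul _ _ (R.f_pow_mem hX m), mul_add, ih, mul_add,
      mul_smul_comm, mul_smul_comm, pow_succ' R.f (m + 1), mul_assoc R.f (R.f ^ (m + 1)), add_assoc,
      ← add_smul, pow_succ' R.f m, mul_assoc R.f, ← mul_assoc R.f (R.f ^ m)]
    congr 2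
    have e1 : R.d ^ (ω + 2 * (m : ℤ)) = R.d ^ ω * R.d ^ (2 * m : ℤ) := by
      rw [← zpow_add₀ h0]
    have e2 : R.d ^ (2 * ((m + 1 : ℕ) : ℤ)) = R.d ^ 2 * R.d ^ (2 * m : ℤ) := by
      rw [← zpow_natCast R.d 2, ← zpow_add₀ h0]; push_cast; ring_nf
    rw [e1, e2]
    field_simp
    ring

/-- Apply `a` to `z f = d ^ l f z` and expand the sides by the two product rules. -/
lemma a_mul_f_of_eig {l ω : ℤ} {z : A} (hz : z ∈ eig R.f R.d l) (hw : z ∈ R.wt ω) :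
    R.a z * R.f = R.d ^ (l + 2) • (R.f * R.a z) + (R.d ^ 2 * (R.d ^ (l - ω) - 1)) • z := by
  have h0 := R.d_ne
  have h1 := R.a_mul_f z
  rw [mem_eig.mp hz, map_smul, R.a_f_mul _ _ hw] at h1
  have h2 : R.d ^ 2 * R.d ^ (-2 : ℤ) = 1 := by
    rw [← zpow_natCast R.d 2, ← zpow_add₀ h0]; simp
  have e1 : R.d ^ (l + 2) = R.d ^ 2 * R.d ^ l := by
    rw [← zpow_natCast R.d 2, ← zpow_add₀ h0]; congr 1; push_cast; ring
  have e2 : R.d ^ (l - ω) = R.d ^ l * R.d ^ (-ω) := by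
    rw [← zpow_add₀ h0]; ring_nf
  have h3 : R.a z * R.f = R.d ^ 2 • (R.d ^ (-2 : ℤ) • (R.a z * R.f)) := by
    rw [smul_smul, h2, one_smul]
  rw [h3, ← sub_eq_iff_eq_add.mpr h1, e1, e2]
  module

lemma b_mul_f_of_eig {l ω : ℤ} {z : A} (hz : z ∈ eig R.f R.d l) (hw : z ∈ R.wt ω) :
    R.b z * R.f = R.d ^ (l - 2) • (R.f * R.b z) +
      (R.d ^ (-2 : ℤ) * (R.d ^ (l + ω) - 1)) • z := by
  have h0 := R.d_ne
  have h1 := R.b_mul_f z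
  rw [mem_eig.mp hz, map_smul, R.b_f_mul _ _ hw] at h1
  have h2 : R.d ^ (-2 : ℤ) * R.d ^ (2 : ℤ) = 1 := by
    rw [← zpow_add₀ h0]; simp
  have e1 : R.d ^ (l - 2) = R.d ^ (-2 : ℤ) * R.d ^ l := by
    rw [← zpow_add₀ h0]; ring_nf
  have e2 : R.d ^ (l + ω) = R.d ^ l * R.d ^ ω := by
    rw [← zpow_add₀ h0]
  have h3 : R.b z * R.f = R.d ^ (-2 : ℤ) • (R.d ^ (2 : ℤ) • (R.b z * R.f)) := by
    rw [smul_smul, h2, one_smul]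
  rw [h3, ← sub_eq_iff_eq_add.mpr h1, e1, e2]
  module

/-- Thus `f a` sends an eigenvector of exponent `l` to a multiple of itself plus an eigenvector of
exponent `l + 2`. The behaviour of `f a` under conjugation by a complex power can be read off from
this, and likewise for `f b`, which lowers the exponent by `2`. -/
lemma f_a_eig {l ω : ℤ} {z : A} (hz : z ∈ eig R.f R.d l) (hw : z ∈ R.wt ω) :
    R.f * R.a z - ((R.d ^ (-ω) - R.d ^ (-l)) / (R.d ^ (-2 : ℤ) - 1)) • z ∈
      eig R.f R.d (l + 2) := by
  have h0 := R.d_ne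
  have h3 := R.d_sq_ne
  have h2 : R.d ^ (-2 : ℤ) - 1 ≠ 0 := sub_ne_zero.mpr (R.d_pow (-2) (by norm_num))
  have e1 : R.d ^ (l + 2) = R.d ^ 2 * R.d ^ l := by
    rw [← zpow_natCast R.d 2, ← zpow_add₀ h0]; congr 1; push_cast; ring
  have e2 : R.d ^ (l - ω) = R.d ^ l * R.d ^ (-ω) := by
    rw [← zpow_add₀ h0]; ring_nf
  have hs : R.d ^ 2 * (R.d ^ (l - ω) - 1) -
      (R.d ^ (-ω) - R.d ^ (-l)) / (R.d ^ (-2 : ℤ) - 1) * R.d ^ l =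
      - (R.d ^ (l + 2) * ((R.d ^ (-ω) - R.d ^ (-l)) / (R.d ^ (-2 : ℤ) - 1))) := by
    rw [e1, e2]
    have hx := zpow_ne_zero l h0
    have h4 : R.d ^ (-2 : ℤ) = (R.d ^ 2)⁻¹ := by rw [zpow_neg]; rfl
    rw [h4] at h2 ⊢
    rw [zpow_neg R.d l]
    generalize R.d ^ l = x at *
    generalize R.d ^ (-ω) = y at *
    have h5 : (R.d ^ 2)⁻¹ - 1 = -(R.d ^ 2 - 1) / R.d ^ 2 := by field_simp; ring
    rw [h5]
    field_simp
    ring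
  rw [mem_eig, sub_mul, mul_assoc, R.a_mul_f_of_eig hz hw, smul_mul_assoc, mem_eig.mp hz,
    mul_add, mul_sub R.f, mul_smul_comm, mul_smul_comm, mul_smul_comm]
  linear_combination (norm := module) hs • (R.f * z)

lemma f_b_eig {l ω : ℤ} {z : A} (hz : z ∈ eig R.f R.d l) (hw : z ∈ R.wt ω) :
    R.f * R.b z - ((R.d ^ ω - R.d ^ (-l)) / (R.d ^ 2 - 1)) • z ∈ eig R.f R.d (l - 2) := by
  have h0 := R.d_ne
  have h2 := R.d_sq_ne
  have e1 : R.d ^ (l - 2) = R.d ^ (-2 : ℤ) * R.d ^ l := by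
    rw [← zpow_add₀ h0]; ring_nf
  have e2 : R.d ^ (l + ω) = R.d ^ l * R.d ^ ω := by
    rw [← zpow_add₀ h0]
  have hs : R.d ^ (-2 : ℤ) * (R.d ^ (l + ω) - 1) -
      (R.d ^ ω - R.d ^ (-l)) / (R.d ^ 2 - 1) * R.d ^ l =
      - (R.d ^ (l - 2) * ((R.d ^ ω - R.d ^ (-l)) / (R.d ^ 2 - 1))) := by
    rw [e1, e2]
    have hx := zpow_ne_zero l h0
    have h4 : R.d ^ (-2 : ℤ) = (R.d ^ 2)⁻¹ := by rw [zpow_neg]; rfl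
    rw [h4, zpow_neg R.d l]
    generalize R.d ^ l = x at *
    generalize R.d ^ ω = y at *
    field_simp
    ring
  rw [mem_eig, sub_mul, mul_assoc, R.b_mul_f_of_eig hz hw, smul_mul_assoc, mem_eig.mp hz,
    mul_add, mul_sub R.f, mul_smul_comm, mul_smul_comm, mul_smul_comm]
  linear_combination (norm := module) hs • (R.f * z)

/-- The scalar by which `f (k a - b)` acts on `f ^ e θ` for a singular vector `θ`. -/
def sig (P : ℂ) (c e : ℕ) : ℂ :=
  (R.d ^ (2 * e) - 1) * (P ^ 2 / (R.d ^ c * R.d ^ (2 * e)) - R.d ^ c) / (R.d ^ 2 - 1)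

lemma sig_ne {P : ℂ} {c e : ℕ} (he : e ≠ 0) (hP : P ^ 2 ≠ R.d ^ (2 * (c + e))) :
    R.sig P c e ≠ 0 := by
  have h0 := R.d_ne
  have h1 : R.d ^ (2 * e) - 1 ≠ 0 := by
    have := R.d_pow (2 * e) (by omega)
    exact sub_ne_zero.mpr (by exact_mod_cast this)
  refine div_ne_zero (mul_ne_zero h1 ?_) R.d_sq_ne
  rw [sub_ne_zero, Ne, div_eq_iff (by positivity)]
  intro h
  apply hP
  rw [h]; ring

/-- Division of a vector by a power of `f`. -/
lemma exists_div {P : ℂ} {c : ℕ} (N : ℕ → Submodule ℂ A)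
    (hN : ∀ k, N k ≤ R.wt (c + 2 * k))
    (ha : ∀ k, ∀ X ∈ N (k + 1), R.a X ∈ N k) (hb : ∀ k, ∀ X ∈ N (k + 1), R.b X ∈ N k) :
    ∀ e, (∀ k, 1 ≤ k → k ≤ e → P ^ 2 ≠ R.d ^ (2 * (c + k))) → ∀ y ∈ N e,
      (P ^ 2 * R.d ^ (-2 : ℤ)) • (R.f * R.a y) - R.f * R.b y = R.sig P c e • y →
      ∃ θ ∈ N 0, R.f ^ e * θ = y ∧ (P ^ 2 * R.d ^ (-2 : ℤ)) • R.a θ = R.b θ := by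
  intro e
  induction e with
  | zero =>
    intro _ y hy h
    -- For `e = 0` the scalar `sig` vanishes and `f` can be cancelled.
    refine ⟨y, hy, by simp, ?_⟩
    have h1 : R.f * ((P ^ 2 * R.d ^ (-2 : ℤ)) • R.a y - R.b y) = 0 := by
      rw [mul_sub, mul_smul_comm, h]; simp [sig]
    exact sub_eq_zero.mp (R.reg _ h1)
  | succ e ih =>
    intro hP y hy h
    have h0 := R.d_ne
    have hs := R.sig_ne (Nat.succ_ne_zero e) (hP (e + 1) (by omega) le_rfl)
    set k := P ^ 2 * R.d ^ (-2 : ℤ) with hk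
    -- As `sig` is nonzero, the hypothesis itself exhibits `y` as `f` times this vector.
    set y' := (R.sig P c (e + 1))⁻¹ • (k • R.a y - R.b y) with hy'
    have hy'N : y' ∈ N e :=
      Submodule.smul_mem _ _ (Submodule.sub_mem _ (Submodule.smul_mem _ _ (ha e y hy)) (hb e y hy))
    have h1 : R.f * y' = y := by
      rw [hy', mul_smul_comm, mul_sub, mul_smul_comm, h, smul_smul, inv_mul_cancel₀ hs, one_smul]
    have h2 : k • R.a y - R.b y = R.sig P c (e + 1) • y' := by
      rw [hy', smul_smul, mul_inv_cancel₀ hs, one_smul]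
    -- Substituting `y = f y'` and applying the product rules to `h2` gives the same equation one
    -- exponent lower.
    have h3 : k • (R.f * R.a y') - R.f * R.b y' = R.sig P c e • y' := by
      rw [← h1, R.a_f_mul _ _ (hN e hy'N), R.b_f_mul _ _ (hN e hy'N)] at h2
      have h4 : R.sig P c e = R.sig P c (e + 1) - k * R.d ^ (-(c + 2 * e : ℤ)) +
          R.d ^ (c + 2 * e : ℤ) := by
        have h5 := R.d_sq_ne
        have e1 : R.d ^ (c + 2 * e : ℤ) = R.d ^ c * R.d ^ (2 * e) := by
          rw [zpow_add₀ h0]; norm_cast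
        have e2 : R.d ^ (-2 : ℤ) = (R.d ^ 2)⁻¹ := by rw [zpow_neg]; rfl
        rw [hk, e2, zpow_neg, e1, sig, sig, mul_add, pow_add]
        field_simp
        ring
      rw [h4]
      linear_combination (norm := module) h2
    obtain ⟨θ, hθ, h5, h6⟩ := ih (fun k h1 h2 => hP k h1 (by omega)) y' hy'N h3
    exact ⟨θ, hθ, by rw [pow_succ', mul_assoc, h5, h1], h6⟩

/-- A complex power of `f` transforms singular vectors into singular vectors. -/
lemma twist_singular {P : ℂ} (hP : P ≠ 0) {c e : ℕ} {x θ y : A} (hθ : θ ∈ R.wt (-c))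
    (hsing : (P ^ (-2 : ℤ) * R.d ^ (-2 : ℤ)) • R.a θ = R.b θ) (hx : x = R.f ^ (c + e) * θ)
    {M : Submodule ℂ A} (hM : M ≤ R.wt (c + 2 * e)) (hxy : (x, y) ∈ twist R.f R.d P M) :
    (P ^ 2 * R.d ^ (-2 : ℤ)) • (R.f * R.a y) - R.f * R.b y = R.sig P c e • y := by
  have h0 := R.d_ne
  have h1 := R.d_sq_ne
  have h2 : R.d ^ (-2 : ℤ) - 1 ≠ 0 := sub_ne_zero.mpr (R.d_pow (-2) (by norm_num))
  set k := P ^ 2 * R.d ^ (-2 : ℤ) with hk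
  set k' := P ^ (-2 : ℤ) * R.d ^ (-2 : ℤ) with hk'
  set δ := (1 - P ^ 2) * (R.d ^ (c + 2 * e : ℤ) - R.d ^ (-(c + 2 * e) : ℤ)) / (R.d ^ 2 - 1) with hδ
  let Lf : Module.End ℂ A := LinearMap.mulLeft ℂ R.f
  -- `g` acts on `x` by the scalar `σ`, because `θ` is singular for the parameter `P⁻¹`. Conjugation
  -- by the complex power turns `g` into `h`, where `δ` collects the diagonal terms of `f_a_eig` and
  -- `f_b_eig`. Hence `h y = σ y`, which is the claim after rearrangement.
  let g : Module.End ℂ A := k' • (Lf * R.a) - Lf * R.b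
  let h : Module.End ℂ A := P ^ (-2 : ℤ) • (k • (Lf * R.a) - Lf * R.b + δ • LinearMap.id)
  have key : (g x, h y) ∈ twist R.f R.d P ⊤ := by
    refine twist_induction _ (LinearMap.prodMap g h) ?_ hxy
    intro l z hz hzM
    have hzw := hM hzM
    have ha := mem_twist (P := P) (R.f_a_eig hz hzw) (M := ⊤) trivial
    have hb := mem_twist (P := P) (R.f_b_eig hz hzw) (M := ⊤) trivial
    have hz' := mem_twist (P := P) hz (M := ⊤) trivial
    set t := (R.d ^ (-(c + 2 * e) : ℤ) - R.d ^ (-l)) / (R.d ^ (-2 : ℤ) - 1) with ht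
    set t' := (R.d ^ (c + 2 * e : ℤ) - R.d ^ (-l)) / (R.d ^ 2 - 1) with ht'
    have := Submodule.add_mem _ (Submodule.sub_mem _ (Submodule.smul_mem _ k' ha) hb)
      (Submodule.smul_mem _ (k' * t - t') hz')
    convert this using 1
    have e1 : P ^ (l + 2) = P ^ l * P ^ 2 := by rw [zpow_add₀ hP]; rfl
    have e2 : P ^ (l - 2) = P ^ l * P ^ (-2 : ℤ) := by rw [sub_eq_add_neg, zpow_add₀ hP]
    have e3 : P ^ (-2 : ℤ) = (P ^ 2)⁻¹ := by rw [zpow_neg]; rfl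
    have e4 : R.d ^ (-2 : ℤ) = (R.d ^ 2)⁻¹ := by rw [zpow_neg]; rfl
    have hrel : (P ^ (-2 : ℤ) * δ : ℂ) = (k' * t - t') - P ^ (-2 : ℤ) * (k * t - t') := by
      rw [hδ, hk, hk', ht, ht', e3, e4]
      rw [e4] at h2
      generalize R.d ^ (-l) = u
      generalize R.d ^ (-(c + 2 * e) : ℤ) = v
      generalize R.d ^ (c + 2 * e : ℤ) = w
      have h5 : (R.d ^ 2)⁻¹ - 1 = -(R.d ^ 2 - 1) / R.d ^ 2 := by field_simp; ring
      rw [h5]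
      field_simp
      ring
    have hkk : k' * P ^ 2 = P ^ (-2 : ℤ) * k := by
      rw [hk, hk', e3]; field_simp
    refine Prod.ext ?_ ?_
    · simp only [LinearMap.prodMap_apply, Prod.fst_add, Prod.fst_sub, Prod.smul_fst, g, Lf,
        LinearMap.sub_apply, LinearMap.smul_apply, Module.End.mul_apply, LinearMap.mulLeft_apply]
      module
    · simp only [LinearMap.prodMap_apply, Prod.snd_add, Prod.snd_sub, Prod.smul_snd, h, Lf,
        LinearMap.sub_apply, LinearMap.smul_apply, Module.End.mul_apply, LinearMap.mulLeft_apply,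
        LinearMap.add_apply, LinearMap.id_apply, map_smul, e1, e2]
      linear_combination (norm := module) (P ^ l * hrel) • z -
        (P ^ l * hkk) • (R.f * R.a z) + (P ^ l * t * hkk) • z
  set σ := k' * (R.d ^ (-(-c : ℤ)) * ((1 - R.d ^ (-2 * (c + e : ℕ) : ℤ)) / (1 - R.d ^ (-2 : ℤ)))) -
    (R.d ^ (-c : ℤ) * ((R.d ^ (2 * (c + e : ℕ) : ℤ) - 1) / (R.d ^ 2 - 1))) with hσ
  have hg : g x = σ • x := by
    simp only [g, Lf, LinearMap.sub_apply, LinearMap.smul_apply, Module.End.mul_apply,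
      LinearMap.mulLeft_apply]
    rw [hx, R.f_a_f_pow hθ, R.f_b_f_pow hθ, ← hsing, mul_smul_comm, hσ]
    generalize (1 - R.d ^ (-2 * (c + e : ℕ) : ℤ)) / (1 - R.d ^ (-2 : ℤ)) = u
    generalize (R.d ^ (2 * (c + e : ℕ) : ℤ) - 1) / (R.d ^ 2 - 1) = u'
    module
  have hxy' := twist_mono (le_top : M ≤ ⊤) hxy
  have h3 := Submodule.sub_mem _ key (Submodule.smul_mem _ σ hxy')
  have h4 : (g x, h y) - σ • (x, y) = (0, h y - σ • y) := by
    rw [hg]; ext <;> simp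
  rw [h4] at h3
  -- Subtracting `σ (x, y)` leaves a pair with first entry zero, so single-valuedness applies.
  have h5 := sub_eq_zero.mp (twist_zero h0 R.d_pow R.reg h3)
  simp only [h, Lf, LinearMap.sub_apply, LinearMap.smul_apply, Module.End.mul_apply,
    LinearMap.mulLeft_apply, LinearMap.add_apply, LinearMap.id_apply] at h5
  have hPP : P ^ 2 * P ^ (-2 : ℤ) = 1 := by
    rw [← zpow_natCast P 2, ← zpow_add₀ hP]; simp
  have hsig : R.sig P c e = P ^ 2 * σ - δ := by
    have e3 : P ^ (-2 : ℤ) = (P ^ 2)⁻¹ := by rw [zpow_neg]; rfl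
    have e4 : R.d ^ (-2 : ℤ) = (R.d ^ 2)⁻¹ := by rw [zpow_neg]; rfl
    have e5 : R.d ^ (c + 2 * e : ℤ) = R.d ^ c * R.d ^ (2 * e) := by
      rw [zpow_add₀ h0]; norm_cast
    have e6 : R.d ^ (2 * (c + e : ℕ) : ℤ) = (R.d ^ c) ^ 2 * R.d ^ (2 * e) := by
      rw [← pow_mul, mul_comm c 2, ← pow_add, ← mul_add]; norm_cast
    have e7 : R.d ^ (-2 * (c + e : ℕ) : ℤ) = ((R.d ^ c) ^ 2 * R.d ^ (2 * e))⁻¹ := by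
      rw [neg_mul, zpow_neg, e6]
    have e8 : R.d ^ (-c : ℤ) = (R.d ^ c)⁻¹ := by rw [zpow_neg, zpow_natCast]
    have e9 : R.d ^ (-(c + 2 * e) : ℤ) = (R.d ^ c * R.d ^ (2 * e))⁻¹ := by
      rw [zpow_neg, e5]
    rw [hσ, hδ, hk', sig, e7, e6, neg_neg, e8, e9, e5, zpow_natCast, e3, e4]
    rw [e4] at h2
    have h6 : 1 - (R.d ^ 2)⁻¹ = (R.d ^ 2 - 1) / R.d ^ 2 := by field_simp
    rw [h6]
    have h7 : R.d ^ c ≠ 0 := pow_ne_zero _ h0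
    have h8 : R.d ^ (2 * e) ≠ 0 := pow_ne_zero _ h0
    generalize R.d ^ c = u at *
    generalize R.d ^ (2 * e) = v at *
    field_simp
    ring
  rw [hsig]
  have h6 : (P ^ 2) • (P ^ (-2 : ℤ) • (k • (R.f * R.a y) - R.f * R.b y + δ • y)) =
    (P ^ 2) • (σ • y) := by rw [h5]
  rw [smul_smul, hPP, one_smul] at h6
  linear_combination (norm := module) h6

end RankOne

/-! ### Comparing derivatives before and after the twist. -/

namespace RankOne
variable {A : Type*} [Ring A] [Algebra ℂ A] (R : RankOne A)

/-- The number `1 + d⁻² + ⋯ + d⁻²ᵏ`. -/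
def num (k : ℕ) : ℂ := (1 - (R.d ^ (-2 : ℤ)) ^ (k + 1)) / (1 - R.d ^ (-2 : ℤ))

lemma one_sub_ne : 1 - R.d ^ (-2 : ℤ) ≠ 0 :=
  sub_ne_zero.mpr (R.d_pow (-2) (by norm_num)).symm

lemma num_ne (k : ℕ) : R.num k ≠ 0 := by
  refine div_ne_zero (sub_ne_zero.mpr ?_) R.one_sub_ne
  rw [← zpow_natCast, ← zpow_mul]
  exact (R.d_pow _ (by push_cast; omega)).symm

lemma num_zero : R.num 0 = 1 := by
  rw [num, zero_add, pow_one, div_self R.one_sub_ne]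

lemma num_succ (k : ℕ) : R.num (k + 1) = R.num k + (R.d ^ (-2 : ℤ)) ^ (k + 1) := by
  have := R.one_sub_ne
  rw [num, num]
  generalize R.d ^ (-2 : ℤ) = u at *
  field_simp
  ring

lemma num_succ' (k : ℕ) : R.num (k + 1) = 1 + R.d ^ (-2 : ℤ) * R.num k := by
  have := R.one_sub_ne
  rw [num, num]
  generalize R.d ^ (-2 : ℤ) = u at *
  field_simp
  ring

lemma a_pow_mem {ω : ℤ} {X : A} (hX : X ∈ R.wt ω) (k : ℕ) : (R.a ^ k) X ∈ R.wt (ω - 2 * k) := by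
  induction k with
  | zero => simpa using hX
  | succ k ih =>
    rw [pow_succ', Module.End.mul_apply]
    convert R.a_mem _ _ ih using 2
    push_cast; ring

lemma a_pow_mul_f (z : A) (k : ℕ) : (R.a ^ (k + 1)) (z * R.f) =
    (R.d ^ (-2 : ℤ)) ^ (k + 1) • ((R.a ^ (k + 1)) z * R.f) + R.num k • (R.a ^ k) z := by
  induction k with
  | zero => simp [R.a_mul_f, R.num_zero]
  | succ k ih =>
    rw [pow_succ' R.a (k + 1), Module.End.mul_apply, ih, map_add, map_smul, map_smul, R.a_mul_f,
      num_succ, Module.End.mul_apply, ← Module.End.mul_apply R.a (R.a ^ k),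
      ← pow_succ', smul_add, smul_smul, ← pow_succ, add_smul]
    abel

lemma a_pow_f_mul {ω : ℤ} {z : A} (hz : z ∈ R.wt ω) (k : ℕ) : (R.a ^ (k + 1)) (R.f * z) =
    R.f * (R.a ^ (k + 1)) z + (R.d ^ (-ω + 2 * k) * R.num k) • (R.a ^ k) z := by
  induction k with
  | zero => simp [R.a_f_mul _ _ hz, R.num_zero]
  | succ k ih =>
    have h0 := R.d_ne
    rw [pow_succ' R.a (k + 1), Module.End.mul_apply, ih, map_add, map_smul,
      R.a_f_mul _ _ (R.a_pow_mem hz (k + 1)), num_succ', Module.End.mul_apply, ← Module.End.mul_apply R.a (R.a ^ k),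
      ← pow_succ']
    have e1 : R.d ^ (-ω + 2 * ((k + 1 : ℕ) : ℤ)) = R.d ^ (-(ω - 2 * ((k + 1 : ℕ) : ℤ))) := by
      congr 1; ring
    have e2 : R.d ^ (-ω + 2 * (k : ℤ)) = R.d ^ (-ω + 2 * ((k + 1 : ℕ) : ℤ)) * R.d ^ (-2 : ℤ) := by
      rw [← zpow_add₀ h0]; congr 1; push_cast; ring
    rw [← e1, e2]
    module

variable {W : Type*} [AddCommGroup W] [Module ℂ W] {Φ : A →ₗ[ℂ] W} {g : Module.End ℂ W}
  (hΦ : ∀ X, Φ (R.f * X) = 0) (hg : ∀ X, Φ (X * R.f) = g (Φ X))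

include hΦ in
lemma map_a_pow_f_mul {ω : ℤ} {z : A} (hz : z ∈ R.wt ω) (k : ℕ) :
    Φ ((R.a ^ (k + 1)) (R.f * z)) = (R.d ^ (-ω + 2 * k) * R.num k) • Φ ((R.a ^ k) z) := by
  rw [R.a_pow_f_mul hz, map_add, hΦ, zero_add, map_smul]

-- Each application of `a` strips one factor `f`: the term in which `f` stays on the left is killed
-- by `Φ`, and the scalar of the other is a nonzero quantum number.
include hΦ in
lemma map_a_pow_f_pow {ω : ℤ} {z : A} (hz : z ∈ R.wt ω) (k e : ℕ) :
    ∃ κ : ℂ, κ ≠ 0 ∧ Φ ((R.a ^ (k + e)) (R.f ^ e * z)) = κ • Φ ((R.a ^ k) z) := by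
  induction e with
  | zero => exact ⟨1, one_ne_zero, by simp⟩
  | succ e ih =>
    obtain ⟨κ, hκ, h⟩ := ih
    refine ⟨R.d ^ (-(ω + 2 * e) + 2 * (k + e : ℕ) : ℤ) * R.num (k + e) * κ,
      mul_ne_zero (mul_ne_zero (zpow_ne_zero _ R.d_ne) (R.num_ne (k + e))) hκ, ?_⟩
    rw [pow_succ', mul_assoc, ← add_assoc, R.map_a_pow_f_mul hΦ (R.f_pow_mem hz e), h, smul_smul]

include hΦ in
lemma map_a_pow_f_pow_of_lt {k e : ℕ} (h : k < e) :
    ∀ {ω : ℤ} {z : A}, z ∈ R.wt ω → Φ ((R.a ^ k) (R.f ^ e * z)) = 0 := by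
  induction k generalizing e with
  | zero =>
    intro ω z _
    obtain ⟨e, rfl⟩ := Nat.exists_eq_succ_of_ne_zero h.ne'
    rw [pow_succ', mul_assoc]
    simp [hΦ]
  | succ k ih =>
    intro ω z hz
    obtain ⟨e, rfl⟩ := Nat.exists_eq_succ_of_ne_zero (by omega : e ≠ 0)
    rw [pow_succ' R.f, mul_assoc, R.map_a_pow_f_mul hΦ (R.f_pow_mem hz e), ih (by omega) hz, smul_zero]

-- This is `Φ ∘ a ^ (k + 1)` applied to `z f = d ^ l f z`. It relates consecutive derivatives, with
-- a coefficient on the left that vanishes for exactly one exponent `l`.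
include hΦ hg in
lemma map_a_pow_rel {l ω : ℤ} {z : A} (hz : z ∈ eig R.f R.d l) (hw : z ∈ R.wt ω) (k : ℕ) :
    ((1 - R.d ^ (l - ω + 2 * k)) * R.num k) • Φ ((R.a ^ k) z) =
      -((R.d ^ (-2 : ℤ)) ^ (k + 1) • g (Φ ((R.a ^ (k + 1)) z))) := by
  have h := congrArg (fun X => Φ ((R.a ^ (k + 1)) X)) (mem_eig.mp hz)
  simp only [map_smul, R.map_a_pow_f_mul hΦ hw, R.a_pow_mul_f, map_add, hg] at h
  have e : R.d ^ (l - ω + 2 * k) = R.d ^ l * R.d ^ (-ω + 2 * k) := by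
    rw [← zpow_add₀ R.d_ne]; ring_nf
  rw [e]
  linear_combination (norm := module) h

section Ladder
variable {P : ℂ} {c : ℤ} {M : Submodule ℂ A} {x y : A} {m : ℕ}

-- When the next derivative contributes nothing, only the eigenvectors of exponent `-c` survive at
-- this level.
include hΦ hg in
lemma map_top {l : ℤ} {z : A} (hz : z ∈ eig R.f R.d l) (hw : z ∈ R.wt (2 * m - c))
    (hv : Φ ((R.a ^ (m + 1)) z) = 0) (hl : l ≠ -c) : Φ ((R.a ^ m) z) = 0 := by
  have h := R.map_a_pow_rel hΦ hg hz hw m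
  rw [hv, map_zero, smul_zero, neg_zero] at h
  refine (smul_eq_zero.mp h).resolve_left (mul_ne_zero (sub_ne_zero.mpr ?_) (R.num_ne m))
  exact (R.d_pow _ (by omega)).symm

-- At the top level only the exponent `-c` contributes, and on it the twist is the scalar `P ^
-- (-c)`.
include hΦ hg in
lemma ladder_zero (hM : M ≤ R.wt (2 * m - c)) (hv : ∀ z ∈ M, Φ ((R.a ^ (m + 1)) z) = 0)
    (h : (x, y) ∈ twist R.f R.d P M) :
    Φ ((R.a ^ m) y) = P ^ (-c) • Φ ((R.a ^ m) x) := by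
  have key := twist_induction ⊥ (Φ ∘ₗ (R.a ^ m) ∘ₗ LinearMap.snd ℂ A A -
    P ^ (-c) • Φ ∘ₗ (R.a ^ m) ∘ₗ LinearMap.fst ℂ A A) (fun l z hz hzM => ?_) h
  · simpa [sub_eq_zero] using key
  · by_cases hl : l = -c
    · simp [hl]
    · simp [R.map_top hΦ hg hz (hM hzM) (hv z hzM) hl]

/-- The coefficient of one step down the ladder. -/
def stepCoef (k : ℕ) : ℂ := -((R.d ^ (-2 : ℤ)) ^ (k + 1) / ((1 - R.d ^ (-2 : ℤ)) * R.num k))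

lemma stepCoef_ne (k : ℕ) : R.stepCoef k ≠ 0 :=
  neg_ne_zero.mpr (div_ne_zero (pow_ne_zero _ (zpow_ne_zero _ R.d_ne))
    (mul_ne_zero R.one_sub_ne (R.num_ne k)))

include hΦ hg in
lemma map_step {l ω : ℤ} {z : A} (hz : z ∈ eig R.f R.d l) (hw : z ∈ R.wt ω) (k : ℕ) :
    (1 - R.d ^ (l - ω + 2 * k)) • Φ ((R.a ^ k) z) =
      ((1 - R.d ^ (-2 : ℤ)) * R.stepCoef k) • g (Φ ((R.a ^ (k + 1)) z)) := by
  have h := R.map_a_pow_rel hΦ hg hz hw k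
  have h1 := R.num_ne k
  have h2 := R.one_sub_ne
  have h3 : (1 - R.d ^ (-2 : ℤ)) * R.stepCoef k = -((R.num k)⁻¹ * (R.d ^ (-2 : ℤ)) ^ (k + 1)) := by
    rw [stepCoef]
    generalize R.d ^ (-2 : ℤ) = u at *
    field_simp
  rw [h3, neg_smul, mul_smul, ← smul_neg, ← h, smul_smul]
  congr 1
  field_simp

-- One level below the top, the exponents `-c` and `-c + 2` contribute. The vanishing of `Φ (a ^ m
-- x)` removes the unknown contribution of the second.
include hΦ hg in
lemma ladder_one (hM : M ≤ R.wt (2 * (m + 1 : ℕ) - c))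
    (hv : ∀ z ∈ M, Φ ((R.a ^ (m + 2)) z) = 0) (h : (x, y) ∈ twist R.f R.d P M) (hP : P ≠ 0)
    (hx : Φ ((R.a ^ m) x) = 0) :
    Φ ((R.a ^ m) y) = (P ^ (-c) * ((1 - P ^ 2) * R.stepCoef m)) • g (Φ ((R.a ^ (m + 1)) x)) := by
  have key := twist_induction ⊥ (Φ ∘ₗ (R.a ^ m) ∘ₗ LinearMap.snd ℂ A A -
    P ^ (-c) • (P ^ 2 • Φ ∘ₗ (R.a ^ m) ∘ₗ LinearMap.fst ℂ A A + ((1 - P ^ 2) * R.stepCoef m) •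
      g ∘ₗ Φ ∘ₗ (R.a ^ (m + 1)) ∘ₗ LinearMap.fst ℂ A A)) (fun l z hz hzM => ?_) h
  · simpa [sub_eq_zero, hx, smul_smul] using key
  · have hs := R.map_step hΦ hg hz (hM hzM) m
    simp only [LinearMap.sub_apply, LinearMap.comp_apply, LinearMap.smul_apply,
      LinearMap.add_apply, LinearMap.snd_apply, LinearMap.fst_apply, map_smul, Submodule.mem_bot]
    by_cases hl : l = -c
    · have e : l - (2 * (m + 1 : ℕ) - c) + 2 * m = -2 := by push_cast; omega
      rw [e, mul_smul] at hs
      have hs' := smul_right_injective _ R.one_sub_ne hs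
      rw [hl]
      rw [hs']
      module
    · have ht := R.map_top hΦ hg hz (hM hzM) (hv z hzM) hl
      rw [ht, map_zero, smul_zero] at hs
      rw [ht, map_zero, smul_zero, add_zero]
      by_cases hl2 : l = -c + 2
      · rw [hl2, zpow_add₀ hP]; simp [smul_smul]
      · have : Φ ((R.a ^ m) z) = 0 := by
          refine (smul_eq_zero.mp hs).resolve_left (sub_ne_zero.mpr ?_)
          exact (R.d_pow _ (by push_cast; omega)).symm
        simp [this]

-- Two levels below the top there are three exponents, `-c`, `-c + 2` and `-c + 4`; the two
-- vanishing hypotheses on `x` eliminate the last two. This depth occurs only for weight strings of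
-- length three.
include hΦ hg in
lemma ladder_two (hM : M ≤ R.wt (2 * (m + 2 : ℕ) - c))
    (hv : ∀ z ∈ M, Φ ((R.a ^ (m + 3)) z) = 0) (h : (x, y) ∈ twist R.f R.d P M) (hP : P ≠ 0)
    (hx : Φ ((R.a ^ m) x) = 0) (hx' : Φ ((R.a ^ (m + 1)) x) = 0) :
    Φ ((R.a ^ m) y) = (P ^ (-c) * (R.stepCoef m * R.stepCoef (m + 1) * ((1 - P ^ 2) *
      (1 - P ^ 2 * R.d ^ (-2 : ℤ)) / (1 + R.d ^ (-2 : ℤ))))) •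
        g (g (Φ ((R.a ^ (m + 2)) x))) := by
  have hD : 1 + R.d ^ (-2 : ℤ) ≠ 0 := by
    intro h0
    have h4 := R.d_pow (-4) (by norm_num)
    apply h4
    have : R.d ^ (-4 : ℤ) = R.d ^ (-2 : ℤ) * R.d ^ (-2 : ℤ) := by
      rw [← zpow_add₀ R.d_ne]; rfl
    rw [this]
    linear_combination (R.d ^ (-2 : ℤ) - 1) * h0
  set w := R.stepCoef m * R.stepCoef (m + 1) * ((1 - P ^ 2) *
      (1 - P ^ 2 * R.d ^ (-2 : ℤ)) / (1 + R.d ^ (-2 : ℤ))) with hw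
  have key := twist_induction ⊥ (Φ ∘ₗ (R.a ^ m) ∘ₗ LinearMap.snd ℂ A A -
    P ^ (-c) • (P ^ 4 • Φ ∘ₗ (R.a ^ m) ∘ₗ LinearMap.fst ℂ A A +
      ((P ^ 2 - P ^ 4) * R.stepCoef m) • g ∘ₗ Φ ∘ₗ (R.a ^ (m + 1)) ∘ₗ LinearMap.fst ℂ A A +
      -- The three coefficients interpolate `P ^ l` on the three exponents; `w` is fixed by the
      -- exponent `-c`, and the equation is checked on eigenvectors.
      w • g ∘ₗ g ∘ₗ Φ ∘ₗ (R.a ^ (m + 2)) ∘ₗ LinearMap.fst ℂ A A)) (fun l z hz hzM => ?_) h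
  · simpa [sub_eq_zero, hx, hx', smul_smul] using key
  · have hs := R.map_step hΦ hg hz (hM hzM) m
    have hs2 := R.map_step hΦ hg hz (hM hzM) (m + 1)
    simp only [LinearMap.sub_apply, LinearMap.comp_apply, LinearMap.smul_apply,
      LinearMap.add_apply, LinearMap.snd_apply, LinearMap.fst_apply, map_smul, Submodule.mem_bot]
    by_cases hl : l = -c
    · have e : l - (2 * (m + 2 : ℕ) - c) + 2 * m = -4 := by push_cast; omega
      have e' : l - (2 * (m + 2 : ℕ) - c) + 2 * (m + 1 : ℕ) = -2 := by push_cast; omega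
      rw [e', mul_smul] at hs2
      have hs2' := smul_right_injective _ R.one_sub_ne hs2
      have e4 : 1 - R.d ^ (-4 : ℤ) = (1 - R.d ^ (-2 : ℤ)) * (1 + R.d ^ (-2 : ℤ)) := by
        have : R.d ^ (-4 : ℤ) = R.d ^ (-2 : ℤ) * R.d ^ (-2 : ℤ) := by
          rw [← zpow_add₀ R.d_ne]; rfl
        rw [this]; ring
      rw [e, e4, mul_smul, mul_smul] at hs
      have hs' := smul_right_injective _ R.one_sub_ne hs
      have hs'' : Φ ((R.a ^ m) z) = (R.stepCoef m * R.stepCoef (m + 1) / (1 + R.d ^ (-2 : ℤ))) •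
          g (g (Φ ((R.a ^ (m + 2)) z))) := by
        apply smul_right_injective _ hD
        simp only
        rw [hs', hs2', map_smul, smul_smul, smul_smul]
        rw [mul_div_cancel₀ _ hD]
      rw [hl, hs'', hs2', map_smul]
      have hw' : R.stepCoef m * R.stepCoef (m + 1) / (1 + R.d ^ (-2 : ℤ)) =
          P ^ 4 * (R.stepCoef m * R.stepCoef (m + 1) / (1 + R.d ^ (-2 : ℤ))) +
          ((P ^ 2 - P ^ 4) * R.stepCoef m) * R.stepCoef (m + 1) + w := by
        rw [hw]
        generalize R.d ^ (-2 : ℤ) = u at *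
        field_simp
        ring
      linear_combination (norm := module) (P ^ (-c) * hw') • g (g (Φ ((R.a ^ (m + 2)) z)))
    · have ht := R.map_top hΦ hg hz (hM hzM) (hv z hzM) hl
      rw [show m + 1 + 1 = m + 2 from rfl, ht, map_zero, smul_zero] at hs2
      rw [ht, map_zero, map_zero, smul_zero, add_zero]
      by_cases hl2 : l = -c + 2
      · have e : l - (2 * (m + 2 : ℕ) - c) + 2 * m = -2 := by push_cast; omega
        rw [e, mul_smul] at hs
        have hs' := smul_right_injective _ R.one_sub_ne hs
        rw [hl2, zpow_add₀ hP, hs']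
        have : P ^ (2 : ℤ) = P ^ 2 := rfl
        rw [this]
        module
      · have h1 : Φ ((R.a ^ (m + 1)) z) = 0 := by
          refine (smul_eq_zero.mp hs2).resolve_left (sub_ne_zero.mpr ?_)
          exact (R.d_pow _ (by push_cast; omega)).symm
        rw [h1, map_zero, smul_zero] at hs
        rw [h1, map_zero, smul_zero, add_zero]
        by_cases hl4 : l = -c + 4
        · rw [hl4, zpow_add₀ hP]
          have : P ^ (4 : ℤ) = P ^ 4 := rfl
          simp [smul_smul, this]
        · have : Φ ((R.a ^ m) z) = 0 := by
            refine (smul_eq_zero.mp hs).resolve_left (sub_ne_zero.mpr ?_)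
            exact (R.d_pow _ (by push_cast; omega)).symm
          simp [this]

include hΦ hg in
/-- Nonvanishing passes from a singular vector to its transform by a power of `f`. -/
lemma twist_map_eq_zero {c e r s : ℕ} {θ θ' : A} (hr : r + s = c) (hr2 : r ≤ 2)
    (hθ' : θ' ∈ R.wt (-c)) (hθ : θ ∈ R.wt c) (hM : M ≤ R.wt (c + 2 * e))
    (hv : ∀ z ∈ M, Φ ((R.a ^ (c + e + 1)) z) = 0)
    (h : (R.f ^ (c + e) * θ', R.f ^ e * θ) ∈ twist R.f R.d P M) (hP : P ≠ 0) (hP1 : P ^ 2 ≠ 1)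
    (hP2 : P ^ 2 ≠ R.d ^ 2) (h0 : Φ ((R.a ^ s) θ) = 0) : (g ^ r) (Φ θ') = 0 := by
  -- The values to be compared are `Φ (a ^ s θ)` and `Φ θ'`, both rewritten as derivatives of the
  -- twisted pair up to nonzero factors.
  obtain ⟨κ, hκ, h1⟩ := R.map_a_pow_f_pow hΦ hθ s e
  rw [h0, smul_zero] at h1
  obtain ⟨κ', hκ', h2⟩ := R.map_a_pow_f_pow hΦ hθ' 0 (c + e)
  rw [pow_zero, Module.End.one_apply, zero_add] at h2
  have hlt : ∀ k < c + e, Φ ((R.a ^ k) (R.f ^ (c + e) * θ')) = 0 := fun k hk =>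
    R.map_a_pow_f_pow_of_lt hΦ hk hθ'
  have hM' : M ≤ R.wt (2 * (c + e : ℕ) - c) := by
    convert hM using 2; push_cast; ring
  have hPc : P ^ (-c : ℤ) ≠ 0 := zpow_ne_zero _ hP
  have hQ1 : 1 - P ^ 2 ≠ 0 := sub_ne_zero.mpr hP1.symm
  -- The derivative of order `s + e` lies `r` levels below the top order `c + e`, so `r` selects the
  -- ladder lemma.
  interval_cases r
  · have h3 := R.ladder_zero hΦ hg hM' hv h
    rw [show c + e = s + e by omega, h1, show s + e = c + e by omega, h2] at h3
    exact (smul_eq_zero.mp ((smul_eq_zero.mp h3.symm).resolve_left hPc)).resolve_left hκ'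
  · rw [show c + e = s + e + 1 by omega] at *
    have h3 := R.ladder_one hΦ hg hM' hv h hP (hlt _ (by omega))
    rw [h1, h2] at h3
    rw [map_smul] at h3
    rw [pow_one]
    exact (smul_eq_zero.mp ((smul_eq_zero.mp h3.symm).resolve_left
      (mul_ne_zero hPc (mul_ne_zero hQ1 (R.stepCoef_ne _))))).resolve_left hκ'
  · rw [show c + e = s + e + 2 by omega] at *
    have h3 := R.ladder_two hΦ hg hM' hv h hP (hlt _ (by omega)) (hlt _ (by omega))
    rw [h1, h2] at h3
    have hQ2 : 1 - P ^ 2 * R.d ^ (-2 : ℤ) ≠ 0 := by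
      intro h4
      apply hP2
      have h5 : R.d ^ (-2 : ℤ) = (R.d ^ 2)⁻¹ := by rw [zpow_neg]; rfl
      have h6 : R.d ^ 2 ≠ 0 := pow_ne_zero 2 R.d_ne
      rw [h5, sub_eq_zero, eq_comm, mul_inv_eq_one₀ h6] at h4
      exact h4
    have hD : 1 + R.d ^ (-2 : ℤ) ≠ 0 := by
      intro h0
      apply R.d_pow (-4) (by norm_num)
      have : R.d ^ (-4 : ℤ) = R.d ^ (-2 : ℤ) * R.d ^ (-2 : ℤ) := by
        rw [← zpow_add₀ R.d_ne]; rfl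
      rw [this]
      linear_combination (R.d ^ (-2 : ℤ) - 1) * h0
    have h4 := smul_eq_zero.mp h3.symm
    rw [map_smul, map_smul] at h4
    have h5 := h4.resolve_left (mul_ne_zero hPc (mul_ne_zero
      (mul_ne_zero (R.stepCoef_ne _) (R.stepCoef_ne _)) (div_ne_zero (mul_ne_zero hQ1 hQ2) hD)))
    rw [pow_two, Module.End.mul_apply]
    exact (smul_eq_zero.mp h5).resolve_left hκ'

end Ladder
end RankOne

/-! ### The negative part of the quantum group -/

/-- The quantum parameter is neither zero nor a root of unity. -/
class Generic (q : ℂ) : Prop where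
  ne : q ≠ 0
  pow : ∀ m : ℕ, 0 < m → q ^ m ≠ 1

/-- The rank is at least three for the series `D`. -/
class Datum (t : Series) (n : ℕ) : Prop where
  hD : t = .D → 3 ≤ n

lemma Generic.zpow {q : ℂ} [hq : Generic q] (l : ℤ) (hl : l ≠ 0) : q ^ l ≠ 1 := by
  rcases Int.natAbs_eq l with h | h
  · rw [h, zpow_natCast]; exact hq.pow _ (by omega)
  · rw [h, zpow_neg, zpow_natCast, inv_ne_one]; exact hq.pow _ (by omega)

/-- The left side of the quantum Serre relation. -/
def serreP {A : Type*} [Ring A] [Algebra ℂ A] (p : ℂ) (m : ℕ) (X Y : A) : A :=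
  ∑ s ∈ Finset.range (m + 1), ((-1) ^ s * qbinom p m s) • (X ^ (m - s) * Y * X ^ s)

lemma map_serreP {A B : Type*} [Ring A] [Algebra ℂ A] [Ring B] [Algebra ℂ B] (φ : A →ₐ[ℂ] B)
    (p : ℂ) (m : ℕ) (X Y : A) : φ (serreP p m X Y) = serreP p m (φ X) (φ Y) := by
  simp [serreP, map_sum]

lemma serreP_smul {A : Type*} [Ring A] [Algebra ℂ A] (p : ℂ) (m : ℕ) (X Y : A) (c e : ℂ) :
    serreP p m (c • X) (e • Y) = (c ^ m * e) • serreP p m X Y := by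
  rw [serreP, serreP, Finset.smul_sum]
  refine Finset.sum_congr rfl fun s hs => ?_
  have hs' : s ≤ m := Nat.lt_succ_iff.mp (Finset.mem_range.mp hs)
  rw [smul_pow, smul_pow, smul_mul_smul_comm, smul_mul_smul_comm, smul_comm, mul_right_comm,
    ← pow_add, Nat.sub_add_cancel hs']

lemma qnum_natCast (p : ℂ) (m : ℕ) : qnum p ((m : ℂ) + 1) = (p ^ (m + 1) - (p ^ (m + 1))⁻¹) / (p - p⁻¹) := by
  rw [qnum, Complex.cpow_neg, show ((m : ℂ) + 1) = ((m + 1 : ℕ) : ℂ) by push_cast; rfl,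
    Complex.cpow_natCast]

lemma qfact_succ (p : ℂ) (m : ℕ) : qfact p (m + 1) = qfact p m * qnum p ((m : ℂ) + 1) :=
  Finset.prod_range_succ _ _

section qnum
variable {p : ℂ} [hp : Generic p]

lemma Generic.sub_inv_ne (m : ℕ) : p ^ (m + 1) - (p ^ (m + 1))⁻¹ ≠ 0 := by
  intro h
  have h0 : p ^ (m + 1) ≠ 0 := pow_ne_zero _ hp.ne
  apply hp.pow (2 * (m + 1)) (by omega)
  rw [mul_comm, pow_mul, pow_two]
  nth_rw 1 [sub_eq_zero.mp h]
  exact inv_mul_cancel₀ h0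

lemma Generic.sub_inv_ne' : p - p⁻¹ ≠ 0 := by simpa using Generic.sub_inv_ne (p := p) 0

lemma Generic.qnum_ne (m : ℕ) : qnum p ((m : ℂ) + 1) ≠ 0 := by
  rw [qnum_natCast]
  exact div_ne_zero (Generic.sub_inv_ne m) Generic.sub_inv_ne'

lemma Generic.qfact_ne (m : ℕ) : qfact p m ≠ 0 :=
  Finset.prod_ne_zero_iff.mpr fun _ _ => Generic.qnum_ne _

lemma qfact_one : qfact p 1 = 1 := by
  have := Generic.sub_inv_ne' (p := p)
  rw [qfact, Finset.prod_range_one, qnum_natCast]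
  simp [this]

lemma qbinom_zero (m : ℕ) : qbinom p m 0 = 1 := by
  rw [qbinom, Nat.sub_zero, show qfact p 0 = 1 from rfl, one_mul]
  exact div_self (Generic.qfact_ne (p := p) m)

lemma qbinom_self (m : ℕ) : qbinom p m m = 1 := by
  simp [qbinom]
  rw [show qfact p 0 = 1 from rfl, mul_one]
  exact div_self (Generic.qfact_ne (p := p) m)

lemma qbinom_two_one : qbinom p 2 1 = p + p⁻¹ := by
  have h := Generic.sub_inv_ne' (p := p)
  have h0 := hp.ne
  rw [qbinom, qfact_succ p 1, qfact_one, qnum_natCast]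
  have h2 : p ^ 2 - 1 ≠ 0 := sub_ne_zero.mpr (hp.pow 2 (by norm_num))
  have h3 : p - p⁻¹ = (p ^ 2 - 1) / p := by field_simp
  rw [h3]
  field_simp
  ring

lemma qbinom_three_one : qbinom p 3 1 = p ^ 2 + 1 + (p ^ 2)⁻¹ := by
  have h0 := hp.ne
  rw [qbinom, qfact_succ p 2, qfact_one, one_mul, mul_div_cancel_left₀ _ (Generic.qfact_ne 2),
    qnum_natCast]
  have h2 : p ^ 2 - 1 ≠ 0 := sub_ne_zero.mpr (hp.pow 2 (by norm_num))
  have h3 : p - p⁻¹ = (p ^ 2 - 1) / p := by field_simp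
  rw [h3]
  field_simp
  ring

lemma qbinom_three_two : qbinom p 3 2 = p ^ 2 + 1 + (p ^ 2)⁻¹ := by
  rw [← qbinom_three_one, qbinom, qbinom, mul_comm]

variable {A : Type*} [Ring A] [Algebra ℂ A]

lemma serreP_one (X Y : A) : serreP p 1 X Y = X * Y - Y * X := by
  simp [serreP, Finset.sum_range_succ, qbinom_zero, qbinom_self, sub_eq_add_neg]

lemma serreP_two (X Y : A) :
    serreP p 2 X Y = X * X * Y - (p + p⁻¹) • (X * Y * X) + Y * X * X := by
  simp [serreP, Finset.sum_range_succ, qbinom_zero, qbinom_self, sub_eq_add_neg, pow_two,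
    qbinom_two_one, mul_assoc]
  module

lemma serreP_three (X Y : A) : serreP p 3 X Y = X * X * X * Y -
    (p ^ 2 + 1 + (p ^ 2)⁻¹) • (X * X * Y * X) + (p ^ 2 + 1 + (p ^ 2)⁻¹) • (X * Y * X * X) -
      Y * X * X * X := by
  simp only [serreP, Finset.sum_range_succ, qbinom_zero, qbinom_self, qbinom_three_one,
    qbinom_three_two, Finset.sum_range_zero]
  simp only [pow_succ, pow_zero, one_mul, mul_one, zero_add, Nat.sub_zero, Nat.reduceSub,
    mul_assoc]
  module

end qnum

lemma qi_eq (t : Series) (n : ℕ) (q : ℂ) (s : Fin n) : qi t n q s = q ^ ((nsq (simpleRoot t n s) : ℂ) / 2) := rfl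

lemma qi_sq (t : Series) (n : ℕ) (q : ℂ) (s : Fin n) : qi t n q s ^ 2 = q ^ (nsq (simpleRoot t n s)) := by
  rw [qi_eq, ← Complex.cpow_nat_mul, ← Complex.cpow_intCast]
  congr 1; push_cast; ring

section Roots
variable (t : Series) (n : ℕ) [hT : Datum t n] (q : ℂ) [hq : Generic q]

lemma simpleRoot_isRoot (s : Fin n) : IsRoot t (simpleRoot t n s) :=
  (simpleRoot_isRoot_ht t n hT.hD s).1

lemma ht_simpleRoot (s : Fin n) : ht t (simpleRoot t n s) = 2 :=
  (simpleRoot_isRoot_ht t n hT.hD s).2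

lemma qi_ne (s : Fin n) : qi t n q s ≠ 0 := by
  rw [qi_eq, Ne, Complex.cpow_eq_zero_iff]
  exact fun h => hq.ne h.1

instance qi_generic (s : Fin n) : Generic (qi t n q s) where
  ne := qi_ne t n q s
  pow m hm h := by
    have h1 : (qi t n q s ^ 2) ^ m = 1 := by rw [← pow_mul, mul_comm, pow_mul, h, one_pow]
    rw [qi_sq, ← zpow_natCast, ← zpow_mul] at h1
    have := (simpleRoot_isRoot t n s).nsq_pos
    exact Generic.zpow _ (by positivity) h1

lemma qi_zpow_cart (s : Fin n) (v : Fin n → ℤ) :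
    qi t n q s ^ cart v (simpleRoot t n s) = q ^ (v ⬝ᵥ simpleRoot t n s) := by
  have h := (simpleRoot_isRoot t n s).cart_mul v
  rw [qi_eq, ← Complex.cpow_int_mul, ← Complex.cpow_intCast]
  congr 1
  have h' : (cart v (simpleRoot t n s) : ℂ) * (nsq (simpleRoot t n s) : ℂ) =
    2 * ((v ⬝ᵥ simpleRoot t n s : ℤ) : ℂ) := by exact_mod_cast h
  linear_combination h' / 2

/-- Two simple roots are separated at the smaller index `a`: the first has value `1` there, the
other usually a nonpositive one. -/
lemma simpleRoot_injective : Function.Injective (simpleRoot t n) := by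
  intro i j h
  have hi := i.2
  have hj := j.2
  have key : ∀ a b : Fin n, (a : ℕ) < b → simpleRoot t n a ≠ simpleRoot t n b := by
    intro a b hab h
    have hb := b.2
    have hab' : a ≠ b := by rintro rfl; exact lt_irrefl _ hab
    have := congrArg (fun v => v ⬝ᵥ simpleRoot t n a) h
    have h3 : (⟨(a : ℕ) + 1, by omega⟩ : Fin n) ≠ a := by simp [Fin.ext_iff]
    have h4 := congrFun h a
    -- Only the last root of type `D` is positive at an earlier coordinate; that pair is separated
    -- at the coordinate `b` instead.
    have h5 : ∀ v : Fin n → ℤ, v = simpleRoot t n b →  v a ≤ 0 ∨ (t = .D ∧ (b : ℕ) + 1 = n ∧ (a : ℕ) + 1 = b) := by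
      rintro v rfl
      unfold simpleRoot
      split_ifs with hb1
      · have : (⟨(b : ℕ) + 1, hb1⟩ : Fin n) ≠ a := by simp [Fin.ext_iff]; omega
        simp [Pi.single_apply, hab', this.symm]
      · cases t
        · simp [Pi.single_apply, hab']
        · simp [Pi.single_apply, hab']
        · by_cases h6 : (a : ℕ) + 1 = b
          · right; exact ⟨rfl, by omega, h6⟩
          · left
            have : a ≠ (⟨(b : ℕ) - 1, by omega⟩ : Fin n) := by simp [Fin.ext_iff]; omega
            simp [Pi.single_apply, hab', this]
    have ha1 : (a : ℕ) + 1 < n := by omega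
    have h6 : simpleRoot t n a a = 1 := by
      simp [simpleRoot, ha1, Pi.single_apply, h3.symm]
    rcases h5 _ h with h7 | ⟨rfl, h8, h9⟩
    · omega
    · have h10 := congrFun h b
      have h11 : b = (⟨(a : ℕ) + 1, ha1⟩ : Fin n) := Fin.ext h9.symm
      have h12 : ¬ (b : ℕ) + 1 < n := by omega
      have h13 : b ≠ (⟨(b : ℕ) - 1, by omega⟩ : Fin n) := by simp [Fin.ext_iff]; omega
      simp [simpleRoot, ha1, h12, Pi.single_apply, hab'.symm, ← h11, h13] at h10
  rcases lt_trichotomy (i : ℕ) j with h' | h' | h'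
  · exact absurd h (key i j h')
  · exact Fin.ext h'
  · exact absurd h.symm (key j i h')

/-- The nonpositive Cartan integer of two distinct simple roots. -/
lemma cart_simpleRoot (i j : Fin n) (h : i ≠ j) :
    ∃ A : ℕ, A ≤ 2 ∧ cart (simpleRoot t n j) (simpleRoot t n i) = -A ∧
      serreExp t n i j = A + 1 := by
  have hi := simpleRoot_isRoot t n i
  have hj := simpleRoot_isRoot t n j
  have hne : simpleRoot t n j ≠ simpleRoot t n i := fun h' => h (simpleRoot_injective t n h').symm
  -- A positive pairing would make the difference a root, but its height is zero.
  have h0 : cart (simpleRoot t n j) (simpleRoot t n i) ≤ 0 := by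
    by_contra hc
    have := (hi.sub_of_cart_pos hj hne (not_le.mp hc)).1.ht_ne_zero
    rw [ht_sub, ht_simpleRoot, ht_simpleRoot] at this
    exact this (sub_self _)
  have h2 : -2 ≤ cart (simpleRoot t n j) (simpleRoot t n i) := by
    rcases h0.lt_or_eq with h0 | h0
    · have hne' : simpleRoot t n j ≠ - simpleRoot t n i := by
        intro h'
        have := congrArg (ht t) h'
        rw [ht_neg, ht_simpleRoot, ht_simpleRoot] at this
        omega
      have hm := hi.cart_mul (simpleRoot t n j)
      have hn : cart (-simpleRoot t n j) (simpleRoot t n i) = - cart (simpleRoot t n j) (simpleRoot t n i) := by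
        apply mul_right_cancel₀ hi.nsq_pos.ne'
        rw [hi.cart_mul, neg_mul, hm, neg_dotProduct]; ring
      -- The upper bound on positive Cartan integers is applied to the negative of the other root.
      have := (hi.sub_of_cart_pos hj.neg (fun h' => hne' (by rw [← h', neg_neg])) (by omega)).2
      omega
    · omega
  refine ⟨(-cart (simpleRoot t n j) (simpleRoot t n i)).toNat, by omega, by omega, ?_⟩
  have : serreExp t n i j = (1 - cart (simpleRoot t n j) (simpleRoot t n i)).toNat := by
    rw [serreExp, cart, dotProduct_comm]; rfl
  rw [this]
  omega

end Roots

/-- The quantum Serre relations of the lowering generators. -/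
inductive UmRel (t : Series) (n : ℕ) (q : ℂ) :
    FreeAlgebra ℂ (Fin n) → FreeAlgebra ℂ (Fin n) → Prop
  | serre (i j) (h : i ≠ j) : UmRel t n q
      (serreP (qi t n q i) (serreExp t n i j) (FreeAlgebra.ι ℂ i) (FreeAlgebra.ι ℂ j)) 0

/-- The negative part of the quantum group. -/
abbrev Um (t : Series) (n : ℕ) (q : ℂ) : Type := RingQuot (UmRel t n q)

/-- The generators of the negative part. -/
def Fg (t : Series) (n : ℕ) (q : ℂ) (i : Fin n) : Um t n q :=
  RingQuot.mkAlgHom ℂ (UmRel t n q) (FreeAlgebra.ι ℂ i)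

lemma serre_Fg (t : Series) (n : ℕ) (q : ℂ) {i j : Fin n} (h : i ≠ j) :
    serreP (qi t n q i) (serreExp t n i j) (Fg t n q i) (Fg t n q j) = 0 := by
  have := RingQuot.mkAlgHom_rel ℂ (UmRel.serre (t := t) (q := q) i j h)
  rwa [map_serreP, map_zero] at this

/-- The universal property of the negative part. -/
def umLift {t : Series} {n : ℕ} {q : ℂ} {A : Type*} [Ring A] [Algebra ℂ A] (x : Fin n → A)
    (hx : ∀ i j, i ≠ j → serreP (qi t n q i) (serreExp t n i j) (x i) (x j) = 0) :
    Um t n q →ₐ[ℂ] A :=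
  RingQuot.liftAlgHom ℂ ⟨FreeAlgebra.lift ℂ x, fun a b hab => by
    obtain ⟨i, j, h⟩ := hab
    rw [map_serreP, map_zero, FreeAlgebra.lift_ι_apply, FreeAlgebra.lift_ι_apply, hx i j h]⟩

lemma umLift_Fg {t : Series} {n : ℕ} {q : ℂ} {A : Type*} [Ring A] [Algebra ℂ A] (x : Fin n → A)
    (hx : ∀ i j, i ≠ j → serreP (qi t n q i) (serreExp t n i j) (x i) (x j) = 0) (i : Fin n) :
    umLift x hx (Fg t n q i) = x i := by
  simp [umLift, Fg]

variable {t : Series} {n : ℕ} {q : ℂ}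

/-- A monomial in the generators. -/
def word (t : Series) (q : ℂ) {n : ℕ} (l : List (Fin n)) : Um t n q := (l.map (Fg t n q)).prod

/-- Minus the weight of a monomial. -/
def wsum (t : Series) {n : ℕ} (l : List (Fin n)) : Fin n → ℤ := (l.map (simpleRoot t n)).sum

lemma word_cons (s : Fin n) (l : List (Fin n)) :
    word t q (s :: l) = Fg t n q s * word t q l := by simp [word]

lemma word_append (l l' : List (Fin n)) :
    word t q (l ++ l') = word t q l * word t q l' := by simp [word]

lemma wsum_cons (s : Fin n) (l : List (Fin n)) :
    wsum t (s :: l) = simpleRoot t n s + wsum t l := by simp [wsum]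

lemma wsum_append (l l' : List (Fin n)) : wsum t (l ++ l') = wsum t l + wsum t l' := by
  simp [wsum]

/-- The component of weight `-γ`. -/
def hom (t : Series) (q : ℂ) {n : ℕ} (γ : Fin n → ℤ) : Submodule ℂ (Um t n q) :=
  Submodule.span ℂ (word t q '' {l | wsum t l = γ})

lemma word_mem_hom (l : List (Fin n)) : word t q l ∈ hom t q (wsum t l) :=
  Submodule.subset_span ⟨l, rfl, rfl⟩

lemma Fg_mem_hom (s : Fin n) : Fg t n q s ∈ hom t q (simpleRoot t n s) := by
  simpa [word, wsum] using word_mem_hom (t := t) (q := q) [s]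

lemma one_mem_hom : (1 : Um t n q) ∈ hom t q 0 := by
  simpa [word, wsum] using word_mem_hom (t := t) (q := q) ([] : List (Fin n))

lemma hom_le {γ : Fin n → ℤ} {N : Submodule ℂ (Um t n q)}
    (h : ∀ l, wsum t l = γ → word t q l ∈ N) : hom t q γ ≤ N := by
  refine Submodule.span_le.mpr ?_
  rintro _ ⟨l, hl, rfl⟩
  exact h l hl

lemma mul_mem_hom {γ δ : Fin n → ℤ} {X Y : Um t n q} (hX : X ∈ hom t q γ) (hY : Y ∈ hom t q δ) :
    X * Y ∈ hom t q (γ + δ) := by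
  have h1 : hom t q γ * hom t q δ ≤ hom t q (γ + δ) := by
    rw [hom, hom, Submodule.span_mul_span, Submodule.span_le]
    rintro _ ⟨_, ⟨l, hl, rfl⟩, _, ⟨l', hl', rfl⟩, rfl⟩
    have := word_mem_hom (t := t) (q := q) (l ++ l')
    rw [wsum_append, word_append, hl, hl'] at this
    exact this
  exact h1 (Submodule.mul_mem_mul hX hY)

/-- Only the fact that the homogeneous components span is needed, not their independence. -/
lemma iSup_hom_eq_top : ⨆ γ, hom t q (n := n) γ = ⊤ := by
  let S : Subalgebra ℂ (Um t n q) := Subalgebra.mk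
    { carrier := (⨆ γ, hom t q (n := n) γ : Submodule ℂ (Um t n q))
      mul_mem' := by
        intro a b ha hb
        have h : (⨆ γ, hom t q (n := n) γ) * (⨆ γ, hom t q (n := n) γ) ≤ ⨆ γ, hom t q (n := n) γ := by
          rw [Submodule.iSup_mul, iSup_le_iff]
          intro γ
          rw [Submodule.mul_iSup, iSup_le_iff]
          intro δ
          rw [Submodule.mul_le]
          exact fun X hX Y hY => Submodule.mem_iSup_of_mem _ (mul_mem_hom hX hY)
        exact h (Submodule.mul_mem_mul ha hb)
      one_mem' := Submodule.mem_iSup_of_mem _ one_mem_hom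
      add_mem' := fun ha hb => Submodule.add_mem _ ha hb
      zero_mem' := Submodule.zero_mem _ }
    (fun r => by
      change algebraMap ℂ (Um t n q) r ∈ (⨆ γ, hom t q (n := n) γ : Submodule ℂ (Um t n q))
      rw [Algebra.algebraMap_eq_smul_one]
      exact Submodule.smul_mem _ _ (Submodule.mem_iSup_of_mem _ one_mem_hom))
  rw [eq_top_iff]
  intro X _
  obtain ⟨Y, rfl⟩ := RingQuot.mkAlgHom_surjective ℂ (UmRel t n q) X
  change _ ∈ S
  induction Y using FreeAlgebra.induction with
  | grade0 r => rw [AlgHom.commutes]; exact S.algebraMap_mem r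
  | grade1 x => exact Submodule.mem_iSup_of_mem _ (Fg_mem_hom (t := t) (q := q) x)
  | mul a b ha hb => rw [map_mul]; exact S.mul_mem (ha trivial) (hb trivial)
  | add a b ha hb => rw [map_add]; exact S.add_mem (ha trivial) (hb trivial)

lemma um_induction {N : Submodule ℂ (Um t n q)} (h : ∀ l, word t q l ∈ N) (X : Um t n q) :
    X ∈ N := by
  have : (⊤ : Submodule ℂ (Um t n q)) ≤ N := by
    rw [← iSup_hom_eq_top]
    exact iSup_le fun γ => hom_le fun l _ => h l
  exact this trivial

lemma ht_wsum [hT : Datum t n] (l : List (Fin n)) : ht t (wsum t l) = 2 * l.length := by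
  induction l with
  | nil => simp [wsum, ht_zero]
  | cons s l ih =>
    rw [wsum_cons, ht_add, ih, ht_simpleRoot, List.length_cons]; push_cast; ring

/-! ### Skew derivations -/

/-- The upper triangular matrices that describe a skew derivation on the generators. -/
def dmat (t : Series) (n : ℕ) (q z : ℂ) (s u : Fin n) : Matrix (Fin 2) (Fin 2) (Um t n q) :=
  !![Fg t n q u, if u = s then 1 else 0;
     0, z ^ (simpleRoot t n s ⬝ᵥ simpleRoot t n u : ℤ) • Fg t n q u]

lemma mat2_ext {A : Type*} {M N : Matrix (Fin 2) (Fin 2) A} (h00 : M 0 0 = N 0 0)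
    (h01 : M 0 1 = N 0 1) (h10 : M 1 0 = N 1 0) (h11 : M 1 1 = N 1 1) : M = N := by
  ext i j
  fin_cases i <;> fin_cases j <;> assumption

section Triangular
variable {A : Type*} [Ring A] [Algebra ℂ A] {p : ℂ} [hp : Generic p]

lemma serreP_diagonal {x y : A} (m : ℕ) (c e : ℂ) (h : serreP p m x y = 0) :
    serreP p m !![x, 0; 0, c • x] !![y, 0; 0, e • y] = 0 := by
  have hpow : ∀ k, !![x, 0; 0, c • x] ^ k = !![x ^ k, 0; 0, c ^ k • x ^ k] := by
    intro k
    induction k with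
    | zero => apply mat2_ext <;> simp
    | succ k ih => rw [pow_succ, ih]; apply mat2_ext <;> simp [pow_succ, smul_smul]
  have key : serreP p m !![x, 0; 0, c • x] !![y, 0; 0, e • y] =
      !![serreP p m x y, 0; 0, serreP p m (c • x) (e • y)] := by
    simp only [serreP, hpow, smul_pow]
    apply mat2_ext <;> simp [Matrix.sum_apply]
    refine Finset.sum_congr rfl fun k _ => ?_
    simp only [smul_smul]
    congr 1
    ring
  rw [key, serreP_smul, h, smul_zero]
  apply mat2_ext <;> simp

/-- The off-diagonal entry is `x ^ (m + 1)` times the alternating sum of quantum binomials weighted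
by `u ^ (m s)`, which vanishes by the quantum binomial theorem. The three cases needed here are
checked directly. -/
lemma serreP_triangular_left {x y : A} (m : ℕ) (hm : m ≤ 2) {u : ℂ} (hu : u = p ∨ u = p⁻¹) (e : ℂ)
    (h : serreP p (m + 1) x y = 0) :
    serreP p (m + 1) !![x, 0; 0, u ^ m • x] !![y, 1; 0, e • y] = 0 := by
  have h0 := hp.ne
  have h' := serreP_diagonal (m + 1) (u ^ m) e h
  have h1 : serreP p (m + 1) !![x, 0; 0, u ^ m • x] !![y, 1; 0, e • y] =
      serreP p (m + 1) !![x, 0; 0, u ^ m • x] !![y, 0; 0, e • y] +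
      serreP p (m + 1) !![x, 0; 0, u ^ m • x] !![0, 1; 0, 0] := by
    simp only [serreP, ← Finset.sum_add_distrib, ← smul_add, ← add_mul, ← mul_add]
    congr! 5
    apply mat2_ext <;> simp
  rw [h1, h', zero_add]
  interval_cases m <;> rcases hu with rfl | rfl
  all_goals
    simp only [zero_add, Nat.reduceAdd, serreP_one, serreP_two, serreP_three]
    apply mat2_ext <;> simp [Matrix.mul_apply, Fin.sum_univ_two, smul_smul, mul_assoc]
  all_goals
    match_scalars
    field_simp
    ring

lemma serreP_triangular_right {x y : A} (m : ℕ) (hm : m ≤ 2) {u : ℂ} (hu : u = p ∨ u = p⁻¹)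
    (h : serreP p (m + 1) x y = 0) :
    serreP p (m + 1) !![x, 1; 0, (u ^ 2)⁻¹ • x] !![y, 0; 0, u ^ m • y] = 0 := by
  have h0 := hp.ne
  interval_cases m <;> rcases hu with rfl | rfl
  all_goals
    simp only [zero_add, Nat.reduceAdd, serreP_one, serreP_two, serreP_three, mul_assoc] at h ⊢
    apply mat2_ext <;> simp [Matrix.mul_apply, Fin.sum_univ_two, smul_smul, mul_assoc, mul_add]
  all_goals first
    | exact h
    | (match_scalars <;> field_simp <;> ring1)
    | linear_combination (norm := skip) ((u ^ 2)⁻¹ ^ 1 * u ^ 0) • h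
      match_scalars <;> field_simp <;> ring1
    | linear_combination (norm := skip) ((u ^ 2)⁻¹ ^ 2 * u ^ 1) • h
      match_scalars <;> field_simp <;> ring1
    | linear_combination (norm := skip) ((u ^ 2)⁻¹ ^ 3 * u ^ 2) • h
      match_scalars <;> field_simp <;> ring1
    | linear_combination (norm := skip) (((p⁻¹) ^ 2)⁻¹ ^ 1 * (p⁻¹) ^ 0) • h
      match_scalars <;> field_simp <;> ring1
    | linear_combination (norm := skip) (((p⁻¹) ^ 2)⁻¹ ^ 2 * (p⁻¹) ^ 1) • h
      match_scalars <;> field_simp <;> ring1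
    | linear_combination (norm := skip) (((p⁻¹) ^ 2)⁻¹ ^ 3 * (p⁻¹) ^ 2) • h
      match_scalars <;> field_simp <;> ring1
end Triangular

section Der
variable {t : Series} {n : ℕ} [hT : Datum t n] {q : ℂ} [hq : Generic q] {z : ℂ}

/-- A skew derivation is the off-diagonal entry of an algebra homomorphism into triangular matrices,
so its existence amounts to the Serre relations for these matrices. The identities of `z` with
powers of `qi` hold for both signs of the exponent. -/
lemma serreP_dmat (hz : z = q ∨ z = q⁻¹) (s i j : Fin n) (h : i ≠ j) :
    serreP (qi t n q i) (serreExp t n i j) (dmat t n q z s i) (dmat t n q z s j) = 0 := by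
  obtain ⟨A, hA, hc, he⟩ := cart_simpleRoot t n i j h
  have hs := serre_Fg t n q h
  have h0 := qi_ne t n q i
  obtain ⟨u, hu, h1, h2⟩ : ∃ u, (u = qi t n q i ∨ u = (qi t n q i)⁻¹) ∧
      z ^ (simpleRoot t n j ⬝ᵥ simpleRoot t n i) = u ^ A ∧
      z ^ (simpleRoot t n i ⬝ᵥ simpleRoot t n i) = (u ^ 2)⁻¹ := by
    have e1 := qi_zpow_cart t n q i (simpleRoot t n j)
    have e2 := qi_sq t n q i
    rw [hc] at e1
    rcases hz with rfl | rfl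
    · refine ⟨_, Or.inr rfl, ?_, ?_⟩
      · rw [← e1, inv_pow, zpow_neg, zpow_natCast]
      · rw [inv_pow, inv_inv, e2]; rfl
    · refine ⟨_, Or.inl rfl, ?_, ?_⟩
      · rw [inv_zpow, ← e1, zpow_neg, inv_inv, zpow_natCast]
      · rw [inv_zpow, e2]; rfl
  rw [he] at hs ⊢
  unfold dmat
  by_cases hsi : i = s
  · subst hsi
    rw [if_pos rfl, if_neg (Ne.symm h), h2, dotProduct_comm, h1]
    exact serreP_triangular_right A hA hu hs
  · by_cases hsj : j = s
    · subst hsj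
      rw [if_pos rfl, if_neg h, h1]
      exact serreP_triangular_left A hA hu _ hs
    · rw [if_neg hsi, if_neg hsj]
      exact serreP_diagonal _ _ _ hs

/-- The matrix form of a skew derivation. -/
def derMat (t : Series) (hz : z = q ∨ z = q⁻¹) [Datum t n] (s : Fin n) :
    Um t n q →ₐ[ℂ] Matrix (Fin 2) (Fin 2) (Um t n q) :=
  umLift (dmat t n q z s) (serreP_dmat hz s)

variable (hz : z = q ∨ z = q⁻¹) (s : Fin n)

lemma derMat_Fg (u : Fin n) : derMat t hz s (Fg t n q u) = dmat t n q z s u := umLift_Fg _ _ _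

lemma derMat_shape (X : Um t n q) : derMat t hz s X 0 0 = X ∧ derMat t hz s X 1 0 = 0 := by
  let N : Submodule ℂ (Um t n q) :=
    { carrier := {X | derMat t hz s X 0 0 = X ∧ derMat t hz s X 1 0 = 0}
      add_mem' := by rintro a b ⟨h1, h2⟩ ⟨h3, h4⟩; simp [h1, h2, h3, h4]
      zero_mem' := by simp
      smul_mem' := by rintro c a ⟨h1, h2⟩; simp [h1, h2] }
  refine um_induction (N := N) (fun l => ?_) X
  induction l with
  | nil => change _ ∧ _; simp [word]
  | cons u l ih =>
    obtain ⟨h1, h2⟩ := ih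
    change _ ∧ _
    rw [word_cons, map_mul, derMat_Fg]
    simp [Matrix.mul_apply, Fin.sum_univ_two, h1, h2, dmat]

/-- The skew derivation attached to a simple root. -/
def der : Um t n q →ₗ[ℂ] Um t n q :=
  (Matrix.entryLinearMap ℂ (Um t n q) 0 1) ∘ₗ (derMat t hz s).toLinearMap

/-- The twist of the skew derivation. -/
def dtw : Um t n q →ₗ[ℂ] Um t n q :=
  (Matrix.entryLinearMap ℂ (Um t n q) 1 1) ∘ₗ (derMat t hz s).toLinearMap

lemma der_apply (X : Um t n q) : der hz s X = derMat t hz s X 0 1 := rfl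

lemma dtw_apply (X : Um t n q) : dtw hz s X = derMat t hz s X 1 1 := rfl

lemma der_mul (X Y : Um t n q) : der hz s (X * Y) = X * der hz s Y + der hz s X * dtw hz s Y := by
  rw [der_apply, map_mul, Matrix.mul_apply, Fin.sum_univ_two, (derMat_shape hz s X).1]; rfl

lemma dtw_mul (X Y : Um t n q) : dtw hz s (X * Y) = dtw hz s X * dtw hz s Y := by
  rw [dtw_apply, map_mul, Matrix.mul_apply, Fin.sum_univ_two, (derMat_shape hz s X).2, zero_mul,
    zero_add]; rfl

lemma der_Fg (u : Fin n) : der hz s (Fg t n q u) = if u = s then 1 else 0 := by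
  rw [der_apply, derMat_Fg]; simp [dmat]

lemma dtw_Fg (u : Fin n) : dtw hz s (Fg t n q u) =
    z ^ (simpleRoot t n s ⬝ᵥ simpleRoot t n u : ℤ) • Fg t n q u := by
  rw [dtw_apply, derMat_Fg]; simp [dmat]

lemma dtw_one : dtw hz s (1 : Um t n q) = 1 := by rw [dtw_apply, map_one]; simp

lemma der_one : der hz s (1 : Um t n q) = 0 := by rw [der_apply, map_one]; simp

include hz hq in
lemma base_ne_zero : z ≠ 0 := by
  rcases hz with rfl | rfl
  · exact hq.ne
  · exact inv_ne_zero hq.ne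

lemma dtw_word (l : List (Fin n)) :
    dtw hz s (word t q l) = z ^ (simpleRoot t n s ⬝ᵥ wsum t l : ℤ) • word t q l := by
  have h0 := base_ne_zero hz
  induction l with
  | nil => simp [word, wsum, dtw_one]
  | cons u l ih =>
    rw [word_cons, dtw_mul, ih, dtw_Fg, wsum_cons, dotProduct_add, zpow_add₀ h0,
      smul_mul_smul_comm]

lemma dtw_hom {γ : Fin n → ℤ} {X : Um t n q} (hX : X ∈ hom t q γ) :
    dtw hz s X = z ^ (simpleRoot t n s ⬝ᵥ γ : ℤ) • X := by
  have : hom t q γ ≤ LinearMap.ker (dtw hz s - z ^ (simpleRoot t n s ⬝ᵥ γ : ℤ) • LinearMap.id) := by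
    refine hom_le fun l hl => ?_
    simp [dtw_word, hl]
  have := this hX
  simpa [sub_eq_zero] using this

lemma der_word_cons (u : Fin n) (l : List (Fin n)) : der hz s (word t q (u :: l)) =
    Fg t n q u * der hz s (word t q l) +
      if u = s then z ^ (simpleRoot t n s ⬝ᵥ wsum t l : ℤ) • word t q l else 0 := by
  rw [word_cons, der_mul, der_Fg, dtw_word]
  split_ifs <;> simp

lemma der_Fg_mul {γ : Fin n → ℤ} {X : Um t n q} (hX : X ∈ hom t q γ) :
    der hz s (Fg t n q s * X) =
      Fg t n q s * der hz s X + z ^ (simpleRoot t n s ⬝ᵥ γ : ℤ) • X := by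
  rw [der_mul, der_Fg, dtw_hom hz s hX, if_pos rfl, one_mul]

lemma der_Fg_mul_of_ne {u : Fin n} (h : u ≠ s) (X : Um t n q) :
    der hz s (Fg t n q u * X) = Fg t n q u * der hz s X := by
  rw [der_mul, der_Fg, if_neg h, zero_mul, add_zero]

lemma der_mul_Fg (X : Um t n q) (u : Fin n) : der hz s (X * Fg t n q u) =
    z ^ (simpleRoot t n s ⬝ᵥ simpleRoot t n u : ℤ) • (der hz s X * Fg t n q u) +
      if u = s then X else 0 := by
  rw [der_mul, der_Fg, dtw_Fg, mul_smul_comm, add_comm]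
  split_ifs <;> simp

lemma der_mem_hom {γ : Fin n → ℤ} {X : Um t n q} (hX : X ∈ hom t q γ) :
    der hz s X ∈ hom t q (γ - simpleRoot t n s) := by
  have key : ∀ l : List (Fin n), der hz s (word t q l) ∈ hom t q (wsum t l - simpleRoot t n s) := by
    intro l
    induction l with
    | nil => simp [word, der_one]
    | cons u l ih =>
      rw [der_word_cons]
      refine Submodule.add_mem _ ?_ ?_
      · have := mul_mem_hom (Fg_mem_hom (t := t) (q := q) u) ih
        rwa [← add_sub_assoc, ← wsum_cons] at this
      · split_ifs with h
        · subst h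
          refine Submodule.smul_mem _ _ ?_
          rw [wsum_cons, add_sub_cancel_left]
          exact word_mem_hom l
        · exact Submodule.zero_mem _
  have : hom t q γ ≤ (hom t q (γ - simpleRoot t n s)).comap (der hz s) :=
    hom_le fun l hl => by rw [Submodule.mem_comap, ← hl]; exact key l
  exact this hX

lemma hom_eq_bot_of_ht {γ : Fin n → ℤ} (h : ht t γ < 0) : hom t q γ = ⊥ := by
  rw [eq_bot_iff]
  refine hom_le fun l hl => ?_
  have := ht_wsum (t := t) l
  rw [hl] at this
  omega

lemma der_pow_mem_hom {γ : Fin n → ℤ} {X : Um t n q} (hX : X ∈ hom t q γ) (k : ℕ) :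
    (der hz s ^ k) X ∈ hom t q (γ - (k : ℤ) • simpleRoot t n s) := by
  induction k with
  | zero => simpa using hX
  | succ k ih =>
    rw [pow_succ', Module.End.mul_apply]
    convert der_mem_hom hz s ih using 1
    push_cast; rw [add_smul, one_smul, sub_sub]

end Der

/-! ### The two families of skew derivations; regularity of the generators. -/

section AB
variable {t : Series} {n : ℕ} [hT : Datum t n] {q : ℂ} [hq : Generic q]

/-- The skew derivation with parameter `q⁻¹`. -/
def dA (t : Series) [Datum t n] (q : ℂ) [Generic q] (s : Fin n) : Um t n q →ₗ[ℂ] Um t n q :=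
  der (t := t) (q := q) (z := q⁻¹) (Or.inr rfl) s

/-- The skew derivation with parameter `q`. -/
def dB (t : Series) [Datum t n] (q : ℂ) [Generic q] (s : Fin n) : Um t n q →ₗ[ℂ] Um t n q :=
  der (t := t) (q := q) (z := q) (Or.inl rfl) s

/-- For `s = u` this carries the singularity equation of a vector over to its derivative. -/
lemma dA_dB (s u : Fin n) (X : Um t n q) : dA t q s (dB t q u X) =
    q ^ (simpleRoot t n s ⬝ᵥ simpleRoot t n u : ℤ) • dB t q u (dA t q s X) := by
  have h0 := hq.ne
  let N : Submodule ℂ (Um t n q) := LinearMap.ker (dA t q s ∘ₗ dB t q u -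
    q ^ (simpleRoot t n s ⬝ᵥ simpleRoot t n u : ℤ) • dB t q u ∘ₗ dA t q s)
  have key : X ∈ N := by
    refine um_induction (fun l => ?_) X
    change (dA t q s ∘ₗ dB t q u - _ • dB t q u ∘ₗ dA t q s) (word t q l) = 0
    simp only [LinearMap.sub_apply, LinearMap.comp_apply, LinearMap.smul_apply, sub_eq_zero]
    induction l with
    | nil => simp [word, dA, dB, der_one]
    | cons v l ih =>
      have hb := der_mem_hom (z := q) (Or.inl rfl) u (word_mem_hom (t := t) (q := q) l)
      have ha := der_mem_hom (z := q⁻¹) (Or.inr rfl) s (word_mem_hom (t := t) (q := q) l)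
      have e1 : dA t q s (Fg t n q v * dB t q u (word t q l)) =
          Fg t n q v * dA t q s (dB t q u (word t q l)) + if v = s then
            (q⁻¹) ^ (simpleRoot t n s ⬝ᵥ (wsum t l - simpleRoot t n u) : ℤ) •
              dB t q u (word t q l) else 0 := by
        rw [dA, der_mul, der_Fg]
        split_ifs with h
        · rw [one_mul]; congr 1; exact dtw_hom _ s hb
        · rw [zero_mul]
      have e2 : dB t q u (Fg t n q v * dA t q s (word t q l)) =
          Fg t n q v * dB t q u (dA t q s (word t q l)) + if v = u then
            q ^ (simpleRoot t n u ⬝ᵥ (wsum t l - simpleRoot t n s) : ℤ) •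
              dA t q s (word t q l) else 0 := by
        rw [dB, der_mul, der_Fg]
        split_ifs with h
        · rw [one_mul]; congr 1; exact dtw_hom _ u ha
        · rw [zero_mul]
      have e3 : dB t q u (word t q (v :: l)) = _ := der_word_cons _ _ _ _
      have e4 : dA t q s (word t q (v :: l)) = _ := der_word_cons _ _ _ _
      change dB t q u (word t q (v :: l)) = Fg t n q v * dB t q u (word t q l) + _ at e3
      change dA t q s (word t q (v :: l)) = Fg t n q v * dA t q s (word t q l) + _ at e4
      rw [e3, e4, map_add, map_add, e1, e2, ih]
      have e5 : q⁻¹ ^ (simpleRoot t n s ⬝ᵥ (wsum t l - simpleRoot t n u) : ℤ) =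
          q ^ (simpleRoot t n s ⬝ᵥ simpleRoot t n u : ℤ) *
            q⁻¹ ^ (simpleRoot t n s ⬝ᵥ wsum t l : ℤ) := by
        rw [inv_zpow', inv_zpow', ← zpow_add₀ h0, dotProduct_sub]; congr 1; ring
      have e6 : q ^ (simpleRoot t n u ⬝ᵥ wsum t l : ℤ) =
          q ^ (simpleRoot t n s ⬝ᵥ simpleRoot t n u : ℤ) *
            q ^ (simpleRoot t n u ⬝ᵥ (wsum t l - simpleRoot t n s) : ℤ) := by
        rw [← zpow_add₀ h0, dotProduct_sub, dotProduct_comm (simpleRoot t n s) (simpleRoot t n u)]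
        congr 1; ring
      rw [e5, e6, mul_smul_comm]
      split_ifs <;> simp only [map_smul, map_zero] <;> module
  simpa [N, sub_eq_zero] using key

/-- Left multiplication by a generator is injective. -/
lemma Fg_regular (s : Fin n) (X : Um t n q) (h : Fg t n q s * X = 0) : X = 0 := by
  have h0 := hq.ne
  let d2 : ℂ := q ^ (simpleRoot t n s ⬝ᵥ simpleRoot t n s : ℤ)
  have hd : ∀ m : ℕ, 0 < m → d2 ^ m ≠ 1 := by
    intro m hm
    rw [← zpow_natCast, ← zpow_mul]
    have := (simpleRoot_isRoot t n s).nsq_pos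
    exact Generic.zpow _ (mul_ne_zero this.ne' (by omega))
  -- The automorphism `τ` undoes the twist `σ` of `dA`, so for `c = τ ∘ dA` the inhomogeneous term
  -- of `c (f Y)` is `Y` itself.
  let τ : Um t n q →ₗ[ℂ] Um t n q := dtw (t := t) (q := q) (z := q) (Or.inl rfl) s
  let σ : Um t n q →ₗ[ℂ] Um t n q := dtw (t := t) (q := q) (z := q⁻¹) (Or.inr rfl) s
  have hτσ : ∀ Y, τ (σ Y) = Y := by
    intro Y
    have : Y ∈ LinearMap.ker (τ ∘ₗ σ - LinearMap.id) := by
      refine um_induction (fun l => ?_) Y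
      simp only [LinearMap.mem_ker, LinearMap.sub_apply, LinearMap.comp_apply, τ, σ, dtw_word,
        map_smul, smul_smul, LinearMap.id_apply]
      rw [inv_zpow, inv_mul_cancel₀ (zpow_ne_zero _ h0), one_smul, sub_self]
    simpa [sub_eq_zero] using this
  let c : Module.End ℂ (Um t n q) := τ ∘ₗ dA t q s
  have hc : ∀ Y, c (Fg t n q s * Y) = d2 • (Fg t n q s * c Y) + Y := by
    intro Y
    change τ (dA t q s (Fg t n q s * Y)) = d2 • (Fg t n q s * τ (dA t q s Y)) + Y
    rw [dA, der_mul, der_Fg, if_pos rfl, one_mul, map_add]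
    congr 1
    · rw [dtw_mul, dtw_Fg, smul_mul_assoc]
    · exact hτσ Y
  -- `c` lowers the height, so it is locally nilpotent.
  have hnil : ∀ Y, ∃ N, (c ^ N) Y = 0 := by
    let M : Submodule ℂ (Um t n q) := ⨆ N, LinearMap.ker (c ^ N)
    have hmono : Monotone fun N => LinearMap.ker (c ^ N) := by
      refine monotone_nat_of_le_succ fun N Y hY => ?_
      rw [LinearMap.mem_ker] at hY ⊢
      rw [pow_succ', Module.End.mul_apply, hY, map_zero]
    intro Y
    have : Y ∈ M := by
      refine um_induction (fun l => ?_) Y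
      have hk : ∀ k : ℕ, (c ^ k) (word t q l) ∈ hom t q (wsum t l - (k : ℤ) • simpleRoot t n s) := by
        intro k
        induction k with
        | zero => simpa using word_mem_hom l
        | succ k ih =>
          rw [pow_succ', Module.End.mul_apply]
          have h1 := der_mem_hom (z := q⁻¹) (Or.inr rfl) s ih
          have h2 : c ((c ^ k) (word t q l)) = _ := dtw_hom (z := q) (Or.inl rfl) s h1
          rw [h2]
          refine Submodule.smul_mem _ _ ?_
          have e : wsum t l - ((k + 1 : ℕ) : ℤ) • simpleRoot t n s =
              wsum t l - (k : ℤ) • simpleRoot t n s - simpleRoot t n s := by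
            push_cast; rw [add_smul, one_smul, sub_sub]
          rw [e]
          exact h1
      refine Submodule.mem_iSup_of_mem (l.length + 1) ?_
      have h1 := hk (l.length + 1)
      rwa [hom_eq_bot_of_ht, Submodule.mem_bot] at h1
      rw [ht_sub, ht_smul, ht_wsum, ht_simpleRoot]; push_cast; omega
    exact (Submodule.mem_iSup_of_directed _ hmono.directed_le).mp this
  have hck : ∀ k : ℕ, (c ^ (k + 1)) (Fg t n q s * X) =
      d2 ^ (k + 1) • (Fg t n q s * (c ^ (k + 1)) X) +
        ((d2 ^ (k + 1) - 1) / (d2 - 1)) • (c ^ k) X := by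
    have h1 : d2 - 1 ≠ 0 := sub_ne_zero.mpr (by simpa using hd 1 one_pos)
    intro k
    induction k with
    | zero => simp [hc, div_self h1]
    | succ k ih =>
      have e : (d2 ^ (k + 1 + 1) - 1) / (d2 - 1) = d2 ^ (k + 1) + (d2 ^ (k + 1) - 1) / (d2 - 1) := by
        field_simp; ring
      rw [pow_succ' c (k + 1), Module.End.mul_apply, ih, map_add, map_smul, map_smul, hc,
        Module.End.mul_apply, ← Module.End.mul_apply c (c ^ k), ← pow_succ', e]
      module
  -- If `f X = 0` and `c ^ (k + 1) X = 0`, then `hck` leaves a nonzero multiple of `c ^ k X`;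
  -- descending in `k` gives `X = 0`.
  obtain ⟨N, hN⟩ := hnil X
  induction N with
  | zero => simpa using hN
  | succ k ih =>
    apply ih
    have h1 := hck k
    rw [h, map_zero, hN, mul_zero, smul_zero, zero_add] at h1
    refine (smul_eq_zero.mp h1.symm).resolve_left (div_ne_zero ?_ ?_)
    · exact sub_ne_zero.mpr (hd _ (by omega))
    · exact sub_ne_zero.mpr (by simpa using hd 1 one_pos)

end AB

section Cart
variable {t : Series} {n : ℕ} {β : Fin n → ℤ}

lemma IsRoot.cart_eq_of_mul (h : IsRoot t β) {v : Fin n → ℤ} {k : ℤ}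
    (hk : k * nsq β = 2 * (v ⬝ᵥ β)) : cart v β = k :=
  mul_right_cancel₀ h.nsq_pos.ne' ((h.cart_mul v).trans hk.symm)

lemma IsRoot.cart_add (h : IsRoot t β) (v w : Fin n → ℤ) :
    cart (v + w) β = cart v β + cart w β := by
  apply h.cart_eq_of_mul
  rw [add_mul, h.cart_mul, h.cart_mul, add_dotProduct]; ring

lemma IsRoot.cart_neg (h : IsRoot t β) (v : Fin n → ℤ) : cart (-v) β = - cart v β := by
  apply h.cart_eq_of_mul
  rw [neg_mul, h.cart_mul, neg_dotProduct]; ring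

lemma IsRoot.cart_sub (h : IsRoot t β) (v w : Fin n → ℤ) :
    cart (v - w) β = cart v β - cart w β := by
  rw [sub_eq_add_neg, h.cart_add, h.cart_neg, sub_eq_add_neg]

lemma IsRoot.cart_smul (h : IsRoot t β) (k : ℤ) (v : Fin n → ℤ) :
    cart (k • v) β = k * cart v β := by
  apply h.cart_eq_of_mul
  rw [mul_assoc, h.cart_mul, smul_dotProduct, smul_eq_mul]; ring

lemma IsRoot.cart_refl (h : IsRoot t β) (v : Fin n → ℤ) : cart (srefl β v) β = - cart v β := by
  rw [srefl, h.cart_sub, h.cart_smul, h.dot_self]; ring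

end Cart

/-! ### Eigenvector decompositions from the Serre relations. -/

section Eigen
variable {A : Type*} [Ring A] [Algebra ℂ A] {f : A} {d : ℂ}

lemma eig_mul {k l : ℤ} {X Y : A} (h0 : d ≠ 0) (hX : X ∈ eig f d k) (hY : Y ∈ eig f d l) :
    X * Y ∈ eig f d (k + l) := by
  rw [mem_eig] at *
  rw [mul_assoc, hY, mul_smul_comm, ← mul_assoc, hX, smul_mul_assoc, smul_smul, mul_assoc,
    zpow_add₀ h0, mul_comm (d ^ l)]

lemma pow_mem_eig (m : ℕ) : f ^ m ∈ eig f d 0 := by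
  rw [mem_eig]; simp [← pow_succ, ← pow_succ']

lemma pow_mul_eig {k : ℤ} {X : A} (h0 : d ≠ 0) (hX : X ∈ eig f d k) (m : ℕ) :
    f ^ m * X = d ^ (-k * m) • (X * f ^ m) := by
  induction m with
  | zero => simp
  | succ m ih =>
    have h1 : f * X = d ^ (-k) • (X * f) := by
      rw [mem_eig.mp hX, smul_smul, ← zpow_add₀ h0]; simp
    rw [pow_succ' f, mul_assoc, ih, mul_smul_comm, ← mul_assoc, h1, smul_mul_assoc, smul_smul,
      ← zpow_add₀ h0, mul_assoc]
    congr 2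
    push_cast; ring

/-- With `L`, `R` the left and right multiplication by `x`, the relation reads `(R - p L) (R - p⁻¹
L) y = 0`, and partial fractions split `L ^ 2 y`. One factor `L` would suffice here; two make the
statement uniform with the next case. The clause on `N` keeps the parts in the weight space of `y x
^ 2`. -/
lemma serre_eig_one {p : ℂ} [hp : Generic p] {x y : A} (h : serreP p 2 x y = 0) :
    ∃ Y₁ Y₂ : A, (x ^ 2 * y = Y₁ + Y₂) ∧ Y₁ ∈ eig x p 1 ∧ Y₂ ∈ eig x p (-1) ∧
      ∀ N : Submodule ℂ A, x * x * y ∈ N → x * y * x ∈ N → Y₁ ∈ N ∧ Y₂ ∈ N := by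
  have h0 := hp.ne
  have h1 : p ^ 2 - 1 ≠ 0 := sub_ne_zero.mpr (hp.pow 2 (by norm_num))
  rw [serreP_two] at h
  refine ⟨(-(p ^ 2 - 1)⁻¹) • (x * x * y - p • (x * y * x)),
    (p ^ 2 * (p ^ 2 - 1)⁻¹) • (x * x * y - p⁻¹ • (x * y * x)), ?_, ?_, ?_, ?_⟩
  · rw [pow_two]
    match_scalars <;> field_simp <;> ring
  · refine Submodule.smul_mem _ _ ?_
    have h2 : x * (x * x * y - (p + p⁻¹) • (x * y * x) + y * x * x) = 0 := by rw [h, mul_zero]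
    simp only [mem_eig, mul_sub, mul_add, sub_mul, mul_smul_comm, smul_mul_assoc, mul_assoc,
      zpow_one] at h2 ⊢
    linear_combination (norm := skip) (-p) • h2
    match_scalars <;> field_simp <;> ring
  · refine Submodule.smul_mem _ _ ?_
    have h2 : x * (x * x * y - (p + p⁻¹) • (x * y * x) + y * x * x) = 0 := by rw [h, mul_zero]
    simp only [mem_eig, mul_sub, mul_add, sub_mul, mul_smul_comm, smul_mul_assoc, mul_assoc,
      zpow_neg, zpow_one] at h2 ⊢
    linear_combination (norm := skip) (-p⁻¹) • h2
    match_scalars <;> field_simp <;> ring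
  · intro N h1 h2
    exact ⟨N.smul_mem _ (N.sub_mem h1 (N.smul_mem _ h2)),
      N.smul_mem _ (N.sub_mem h1 (N.smul_mem _ h2))⟩

/-- Now the Serre relation factors as a cubic with roots `p ^ 2`, `1`, `p⁻²`, and partial fractions
need the full factor `L ^ 2`. -/
lemma serre_eig_two {p : ℂ} [hp : Generic p] {x y : A} (h : serreP p 3 x y = 0) :
    ∃ Y₁ Y₂ Y₃ : A, (x ^ 2 * y = Y₁ + Y₂ + Y₃) ∧ Y₁ ∈ eig x p 2 ∧ Y₂ ∈ eig x p 0 ∧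
      Y₃ ∈ eig x p (-2) ∧
      ∀ N : Submodule ℂ A, x * x * y ∈ N → x * y * x ∈ N → y * x * x ∈ N →
        Y₁ ∈ N ∧ Y₂ ∈ N ∧ Y₃ ∈ N := by
  have h0 := hp.ne
  have h1 : p ^ 2 - 1 ≠ 0 := sub_ne_zero.mpr (hp.pow 2 (by norm_num))
  have h2 : p ^ 4 - 1 ≠ 0 := sub_ne_zero.mpr (hp.pow 4 (by norm_num))
  have h3 : p ^ 2 + 1 ≠ 0 := by
    intro h; apply h2; linear_combination (p ^ 2 - 1) * h
  have h4 : p ^ 4 - 1 = (p ^ 2 - 1) * (p ^ 2 + 1) := by ring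
  rw [serreP_three] at h
  have e2 : p ^ (2 : ℤ) = p ^ 2 := rfl
  have e2' : p ^ (-2 : ℤ) = (p ^ 2)⁻¹ := by rw [zpow_neg]; rfl
  refine ⟨((p ^ 2 - 1) ^ 2 * (p ^ 2 + 1))⁻¹ •
      (x * x * y - (p ^ 2 + 1) • (x * y * x) + p ^ 2 • (y * x * x)),
    (-(p ^ 2 / (p ^ 2 - 1) ^ 2)) •
      (x * x * y - (p ^ 2 + (p ^ 2)⁻¹) • (x * y * x) + y * x * x),
    (p ^ 6 / ((p ^ 2 - 1) ^ 2 * (p ^ 2 + 1))) •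
      (x * x * y - (1 + (p ^ 2)⁻¹) • (x * y * x) + (p ^ 2)⁻¹ • (y * x * x)), ?_, ?_, ?_, ?_, ?_⟩
  · rw [pow_two]
    match_scalars <;> field_simp <;> ring
  · refine Submodule.smul_mem _ _ ?_
    simp only [mem_eig, mul_sub, mul_add, sub_mul, add_mul, mul_smul_comm, smul_mul_assoc,
      mul_assoc, e2] at h ⊢
    linear_combination (norm := skip) (-p ^ 2) • h
    match_scalars <;> field_simp <;> ring
  · refine Submodule.smul_mem _ _ ?_
    simp only [mem_eig, mul_sub, mul_add, sub_mul, add_mul, mul_smul_comm, smul_mul_assoc,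
      mul_assoc, zpow_zero] at h ⊢
    linear_combination (norm := skip) (-1 : ℂ) • h
    match_scalars <;> field_simp <;> ring
  · refine Submodule.smul_mem _ _ ?_
    simp only [mem_eig, mul_sub, mul_add, sub_mul, add_mul, mul_smul_comm, smul_mul_assoc,
      mul_assoc, e2'] at h ⊢
    linear_combination (norm := skip) (-(p ^ 2)⁻¹) • h
    match_scalars <;> field_simp <;> ring
  · intro N h1 h2 h3
    exact ⟨N.smul_mem _ (N.add_mem (N.sub_mem h1 (N.smul_mem _ h2)) (N.smul_mem _ h3)),
      N.smul_mem _ (N.add_mem (N.sub_mem h1 (N.smul_mem _ h2)) h3),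
      N.smul_mem _ (N.add_mem (N.sub_mem h1 (N.smul_mem _ h2)) (N.smul_mem _ h3))⟩

end Eigen

/-! ### The rank one situation inside the negative part. -/

section RankOneInst
variable {t : Series} {n : ℕ} [hT : Datum t n] {q : ℂ} [hq : Generic q]

/-- The sums of elements that commute with a generator up to a power of `d`, in a fixed weight. -/
def eigSum (t : Series) (q : ℂ) {n : ℕ} (s : Fin n) (γ : Fin n → ℤ) : Submodule ℂ (Um t n q) :=
  ⨆ k, eig (Fg t n q s) (qi t n q s) k ⊓ hom t q γ

lemma mem_eigSum {s : Fin n} {γ : Fin n → ℤ} {k : ℤ} {X : Um t n q}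
    (h : X ∈ eig (Fg t n q s) (qi t n q s) k) (h' : X ∈ hom t q γ) : X ∈ eigSum t q s γ :=
  Submodule.mem_iSup_of_mem k ⟨h, h'⟩

lemma eigSum_le {s : Fin n} {γ : Fin n → ℤ} {N : Submodule ℂ (Um t n q)}
    (h : ∀ k, ∀ X ∈ eig (Fg t n q s) (qi t n q s) k, X ∈ hom t q γ → X ∈ N) :
    eigSum t q s γ ≤ N :=
  iSup_le fun k X hX => h k X hX.1 hX.2

lemma Fg_sq_mul_mem (s u : Fin n) : Fg t n q s ^ 2 * Fg t n q u ∈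
    eigSum t q s (simpleRoot t n u + (2 : ℤ) • simpleRoot t n s) := by
  have hf := Fg_mem_hom (t := t) (q := q) s
  have hu := Fg_mem_hom (t := t) (q := q) u
  have e1 : Fg t n q s * Fg t n q s * Fg t n q u ∈
      hom t q (simpleRoot t n u + (2 : ℤ) • simpleRoot t n s) := by
    convert mul_mem_hom (mul_mem_hom hf hf) hu using 2; module
  have e2 : Fg t n q s * Fg t n q u * Fg t n q s ∈
      hom t q (simpleRoot t n u + (2 : ℤ) • simpleRoot t n s) := by
    convert mul_mem_hom (mul_mem_hom hf hu) hf using 2; module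
  have e3 : Fg t n q u * Fg t n q s * Fg t n q s ∈
      hom t q (simpleRoot t n u + (2 : ℤ) • simpleRoot t n s) := by
    convert mul_mem_hom (mul_mem_hom hu hf) hf using 2; module
  by_cases h : s = u
  · subst h
    refine mem_eigSum (k := 0) ?_ (by rwa [pow_two])
    rw [← pow_succ]
    exact pow_mem_eig _
  · obtain ⟨A, hA, -, he⟩ := cart_simpleRoot t n s u h
    have hs := serre_Fg t n q h
    rw [he] at hs
    interval_cases A
    · refine mem_eigSum (k := 0) ?_ (by rwa [pow_two])
      rw [serreP_one, sub_eq_zero] at hs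
      rw [mem_eig, zpow_zero, one_smul, mul_assoc, ← hs, ← mul_assoc, ← mul_assoc, ← pow_succ,
        ← pow_succ']
    · obtain ⟨Y₁, Y₂, h1, h2, h3, h4⟩ := serre_eig_one hs
      rw [h1]
      have h5 := h4 _ e1 e2
      exact Submodule.add_mem _ (mem_eigSum h2 h5.1) (mem_eigSum h3 h5.2)
    · obtain ⟨Y₁, Y₂, Y₃, h1, h2, h3, h4, h5⟩ := serre_eig_two hs
      rw [h1]
      have h6 := h5 _ e1 e2 e3
      exact Submodule.add_mem _ (Submodule.add_mem _ (mem_eigSum h2 h6.1) (mem_eigSum h3 h6.2.1))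
        (mem_eigSum h4 h6.2.2)

lemma eigSum_mul {s : Fin n} {γ δ : Fin n → ℤ} {X Y : Um t n q} (hX : X ∈ eigSum t q s γ)
    (hY : Y ∈ eigSum t q s δ) : X * Y ∈ eigSum t q s (γ + δ) := by
  have h0 := qi_ne t n q s
  have h1 : eigSum t q s γ ≤ (eigSum t q s (γ + δ)).comap (LinearMap.mulRight ℂ Y) := by
    refine eigSum_le fun k X hX hX' => ?_
    have h2 : eigSum t q s δ ≤ (eigSum t q s (γ + δ)).comap (LinearMap.mulLeft ℂ X) :=
      eigSum_le fun l Y hY hY' => mem_eigSum (eig_mul h0 hX hY) (mul_mem_hom hX' hY')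
    exact h2 hY
  exact h1 hX

/-- Each letter needs a factor `f ^ 2` to split into eigenvectors, and the powers of `f` reserved
for later letters pass an eigenvector at the cost of a scalar. -/
lemma Fg_pow_mul_word_mem (s : Fin n) (l : List (Fin n)) :
    Fg t n q s ^ (2 * l.length) * word t q l ∈
      eigSum t q s (wsum t l + (2 * l.length : ℤ) • simpleRoot t n s) := by
  have h0 := qi_ne t n q s
  induction l with
  | nil =>
    refine mem_eigSum (k := 0) ?_ ?_
    · simp [word, mem_eig]
    · simpa [word, wsum] using one_mem_hom
  | cons u l ih =>
    have h1 : eigSum t q s (simpleRoot t n u + (2 : ℤ) • simpleRoot t n s) ≤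
        (eigSum t q s (wsum t (u :: l) +
          (2 * (u :: l).length : ℤ) • simpleRoot t n s)).comap
          (LinearMap.mulRight ℂ (word t q l) ∘ₗ LinearMap.mulLeft ℂ (Fg t n q s ^ (2 * l.length))) := by
      refine eigSum_le fun k X hX hX' => ?_
      rw [Submodule.mem_comap, LinearMap.comp_apply, LinearMap.mulLeft_apply,
        LinearMap.mulRight_apply, pow_mul_eig h0 hX, smul_mul_assoc, mul_assoc]
      refine Submodule.smul_mem _ _ ?_
      have := eigSum_mul (mem_eigSum hX hX') ih
      convert this using 2
      rw [wsum_cons, List.length_cons]; push_cast; module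
    have h2 := h1 (Fg_sq_mul_mem s u)
    rw [Submodule.mem_comap, LinearMap.comp_apply, LinearMap.mulLeft_apply,
        LinearMap.mulRight_apply] at h2
    rw [word_cons, List.length_cons, mul_add, mul_one, pow_add, ← mul_assoc, mul_assoc (_ ^ _)]
    exact h2

/-- A word of height `L` has `L / 2` letters, so `f ^ L` is exactly what the preceding lemma asks
for. -/
lemma Fg_pow_mul_mem (s : Fin n) {γ : Fin n → ℤ} {L : ℕ} (hL : ht t γ = L) {X : Um t n q}
    (hX : X ∈ hom t q γ) :
    Fg t n q s ^ L * X ∈ eigSum t q s (γ + (L : ℤ) • simpleRoot t n s) := by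
  have : hom t q γ ≤ (eigSum t q s (γ + (L : ℤ) • simpleRoot t n s)).comap
      (LinearMap.mulLeft ℂ (Fg t n q s ^ L)) := by
    refine hom_le fun l hl => ?_
    have h1 := ht_wsum (t := t) l
    rw [hl, hL] at h1
    have h2 := Fg_pow_mul_word_mem (t := t) (q := q) s l
    rw [hl, ← h1] at h2
    rw [show 2 * l.length = L by omega] at h2
    exact h2
  exact this hX

/-- The sum of the components whose weight has a given Cartan pairing. -/
def cartWt (t : Series) (q : ℂ) {n : ℕ} (s : Fin n) (ω : ℤ) : Submodule ℂ (Um t n q) :=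
  Submodule.span ℂ (word t q '' {l | cart (wsum t l) (simpleRoot t n s) = ω})

lemma cartWt_le {s : Fin n} {ω : ℤ} {N : Submodule ℂ (Um t n q)}
    (h : ∀ l, cart (wsum t l) (simpleRoot t n s) = ω → word t q l ∈ N) : cartWt t q s ω ≤ N := by
  refine Submodule.span_le.mpr ?_
  rintro _ ⟨l, hl, rfl⟩
  exact h l hl

lemma hom_le_cartWt (s : Fin n) (γ : Fin n → ℤ) :
    hom t q γ ≤ cartWt t q s (cart γ (simpleRoot t n s)) :=
  hom_le fun l hl => Submodule.subset_span ⟨l, by rw [← hl]; rfl, rfl⟩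

lemma hom_le_cartWt_of_eq {s : Fin n} {γ : Fin n → ℤ} {ω : ℤ}
    (h : cart γ (simpleRoot t n s) = ω) : hom t q γ ≤ cartWt t q s ω := h ▸ hom_le_cartWt s γ

/-- The rank one situation attached to a simple root. -/
def rankOne (t : Series) (q : ℂ) {n : ℕ} [hT : Datum t n] [hq : Generic q] (s : Fin n) :
    RankOne (Um t n q) where
  f := Fg t n q s
  d := qi t n q s
  a := dA t q s
  b := dB t q s
  wt := cartWt t q s
  d_ne := qi_ne t n q s
  d_pow := Generic.zpow
  reg := Fg_regular s
  a_f_mul ω X hX := by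
    have h : cartWt t q s ω ≤ LinearMap.ker (dA t q s ∘ₗ LinearMap.mulLeft ℂ (Fg t n q s) -
        LinearMap.mulLeft ℂ (Fg t n q s) ∘ₗ dA t q s - qi t n q s ^ (-ω) • LinearMap.id) := by
      refine cartWt_le fun l hl => ?_
      have h1 : dA t q s (Fg t n q s * word t q l) = _ :=
        der_Fg_mul (z := q⁻¹) (Or.inr rfl) s (word_mem_hom l)
      simp only [LinearMap.mem_ker, LinearMap.sub_apply, LinearMap.comp_apply,
        LinearMap.mulLeft_apply, LinearMap.smul_apply, LinearMap.id_apply]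
      rw [h1, ← hl, zpow_neg, qi_zpow_cart, inv_zpow, dotProduct_comm]
      change Fg t n q s * dA t q s (word t q l) + _ - _ - _ = 0
      abel
    have := h hX
    simpa [sub_sub, sub_eq_zero] using this
  b_f_mul ω X hX := by
    have h : cartWt t q s ω ≤ LinearMap.ker (dB t q s ∘ₗ LinearMap.mulLeft ℂ (Fg t n q s) -
        LinearMap.mulLeft ℂ (Fg t n q s) ∘ₗ dB t q s - qi t n q s ^ ω • LinearMap.id) := by
      refine cartWt_le fun l hl => ?_
      have h1 : dB t q s (Fg t n q s * word t q l) = _ :=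
        der_Fg_mul (z := q) (Or.inl rfl) s (word_mem_hom l)
      simp only [LinearMap.mem_ker, LinearMap.sub_apply, LinearMap.comp_apply,
        LinearMap.mulLeft_apply, LinearMap.smul_apply, LinearMap.id_apply]
      rw [h1, ← hl, qi_zpow_cart, dotProduct_comm]
      change Fg t n q s * dB t q s (word t q l) + _ - _ - _ = 0
      abel
    have := h hX
    simpa [sub_sub, sub_eq_zero] using this
  a_mul_f X := by
    have h1 : dA t q s (X * Fg t n q s) = _ := der_mul_Fg (z := q⁻¹) (Or.inr rfl) s X s
    rw [h1, if_pos rfl, inv_zpow, zpow_neg]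
    have : qi t n q s ^ (2 : ℤ) = _ := qi_sq t n q s
    rw [this]; rfl
  b_mul_f X := by
    have h1 : dB t q s (X * Fg t n q s) = _ := der_mul_Fg (z := q) (Or.inl rfl) s X s
    rw [h1, if_pos rfl]
    have : qi t n q s ^ (2 : ℤ) = _ := qi_sq t n q s
    rw [this]; rfl
  f_mem ω X hX := by
    have hr := simpleRoot_isRoot t n s
    have h : cartWt t q s ω ≤ (cartWt t q s (ω + 2)).comap (LinearMap.mulLeft ℂ (Fg t n q s)) :=
      cartWt_le fun l hl => by
        refine Submodule.subset_span ⟨s :: l, ?_, word_cons s l⟩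
        change cart _ _ = _
        rw [wsum_cons, hr.cart_add, hr.dot_self, hl, add_comm]
    exact h hX
  a_mem ω X hX := by
    have hr := simpleRoot_isRoot t n s
    have h : cartWt t q s ω ≤ (cartWt t q s (ω - 2)).comap (dA t q s) :=
      cartWt_le fun l hl => by
        refine hom_le_cartWt_of_eq ?_ (der_mem_hom (z := q⁻¹) (Or.inr rfl) s (word_mem_hom l))
        rw [hr.cart_sub, hr.dot_self, hl]
    exact h hX

end RankOneInst

/-! ### The natural representation of the negative part -/

section Mat
variable {t : Series} {n : ℕ}

/-- The square matrices of the size of the natural representation. -/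
abbrev NMat (t : Series) (n : ℕ) : Type := Matrix (Fin (dimN t n)) (Fin (dimN t n)) ℂ

/-- The matrices of a given weight. -/
def mdeg (t : Series) {n : ℕ} (γ : Fin n → ℤ) : Submodule ℂ (NMat t n) where
  carrier := {M | ∀ l r, eps t n l - eps t n r ≠ γ → M l r = 0}
  add_mem' := by
    intro a b ha hb l r h
    rw [Matrix.add_apply, ha l r h, hb l r h, add_zero]
  zero_mem' := fun _ _ _ => rfl
  smul_mem' := by
    intro c a ha l r h
    rw [Matrix.smul_apply, ha l r h, smul_zero]

lemma mul_mem_mdeg {γ δ : Fin n → ℤ} {M N : NMat t n} (hM : M ∈ mdeg t γ) (hN : N ∈ mdeg t δ) :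
    M * N ∈ mdeg t (γ + δ) := by
  intro l r h
  rw [Matrix.mul_apply]
  refine Finset.sum_eq_zero fun k _ => ?_
  by_cases h1 : eps t n l - eps t n k = γ
  · have h2 : eps t n k - eps t n r ≠ δ := by
      rintro rfl; apply h; rw [← h1]; abel
    rw [hN k r h2, mul_zero]
  · rw [hM l k h1, zero_mul]

lemma one_mem_mdeg : (1 : NMat t n) ∈ mdeg t 0 := by
  intro l r h
  refine Matrix.one_apply_ne ?_
  rintro rfl
  exact h (sub_self _)

lemma raising_mem_mdeg (γ : Fin n → ℤ) : raising t n γ ∈ mdeg t γ := by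
  intro l r h
  simp [raising, h]

lemma nsq_eps_sub (l r : Fin (dimN t n)) :
    nsq (eps t n l - eps t n r) ≤ 2 ∨ eps t n r = - eps t n l := by
  have h0 := nsq_sub (eps t n l) (eps t n r)
  have h1 := nsq_add (eps t n l) (eps t n r)
  have h2 := nsq_nonneg (eps t n l + eps t n r)
  by_cases h : nsq (eps t n l + eps t n r) = 0
  · right
    rw [nsq_eq_zero] at h
    exact eq_neg_of_add_eq_zero_right h
  · left
    rcases nsq_eps_eq t n l with hl | ⟨-, hl⟩ <;> rcases nsq_eps_eq t n r with hr | ⟨-, hr⟩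
    · omega
    · rw [hr, sub_zero, hl]; norm_num
    · rw [hl, zero_sub, nsq_neg, hr]; norm_num
    · rw [hl, hr]; simp [nsq]

lemma mdeg_eq_zero {γ : Fin n → ℤ} (h : 4 < nsq γ) {M : NMat t n} (hM : M ∈ mdeg t γ) : M = 0 := by
  ext l r
  refine hM l r ?_
  rintro rfl
  have h0 := nsq_sub (eps t n l) (eps t n r)
  have h1 := nsq_add (eps t n l) (eps t n r)
  have h2 := nsq_nonneg (eps t n l + eps t n r)
  have h3 : nsq (eps t n l) ≤ 1 := by
    rcases nsq_eps_eq t n l with hl | ⟨-, hl⟩ <;> rw [hl]; simp [nsq]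
  have h4 : nsq (eps t n r) ≤ 1 := by
    rcases nsq_eps_eq t n r with hl | ⟨-, hl⟩ <;> rw [hl]; simp [nsq]
  omega

lemma raising_mul_apply {γ : Fin n → ℤ} {l k : Fin (dimN t n)} (h : eps t n k = eps t n l - γ)
    (M : NMat t n) (r : Fin (dimN t n)) : (raising t n γ * M) l r = M k r := by
  rw [Matrix.mul_apply, Finset.sum_eq_single k]
  · simp [raising, h]
  · intro k' _ hk
    have : eps t n l - eps t n k' ≠ γ := by
      rintro rfl; apply hk; apply eps_injective t n; rw [h]; abel
    simp [raising, this]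
  · simp

lemma raising_mul_apply_eq_zero {γ : Fin n → ℤ} {l : Fin (dimN t n)}
    (h : ∀ k, eps t n k ≠ eps t n l - γ) (M : NMat t n) (r : Fin (dimN t n)) :
    (raising t n γ * M) l r = 0 := by
  rw [Matrix.mul_apply]
  refine Finset.sum_eq_zero fun k _ => ?_
  have : eps t n l - eps t n k ≠ γ := by
    rintro rfl; exact h k (by abel)
  simp [raising, this]

lemma raising_transpose (γ : Fin n → ℤ) : (raising t n γ)ᵀ = raising t n (-γ) := by
  ext l r
  simp only [raising, Matrix.transpose_apply, Matrix.of_apply]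
  refine if_congr ?_ rfl rfl
  rw [← neg_sub, neg_eq_iff_eq_neg]

lemma mul_raising_apply {γ : Fin n → ℤ} {r k : Fin (dimN t n)} (h : eps t n k = eps t n r + γ)
    (M : NMat t n) (l : Fin (dimN t n)) : (M * raising t n γ) l r = M l k := by
  have h1 := raising_mul_apply (γ := -γ) (l := r) (k := k) (by rw [h]; abel) Mᵀ l
  rw [← raising_transpose, ← Matrix.transpose_mul] at h1
  exact h1

lemma mul_raising_apply_eq_zero {γ : Fin n → ℤ} {r : Fin (dimN t n)}
    (h : ∀ k, eps t n k ≠ eps t n r + γ) (M : NMat t n) (l : Fin (dimN t n)) :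
    (M * raising t n γ) l r = 0 := by
  have h1 := raising_mul_apply_eq_zero (γ := -γ) (l := r) (fun k hk => h k (by rw [hk]; abel)) Mᵀ l
  rw [← raising_transpose, ← Matrix.transpose_mul] at h1
  exact h1

open Classical in
/-- The indicator of a proposition. -/
def ind (p : Prop) : ℂ := if p then 1 else 0

lemma ind_true {p : Prop} (h : p) : ind p = 1 := if_pos h

lemma ind_false {p : Prop} (h : ¬ p) : ind p = 0 := if_neg h

lemma raising_mul_raising_apply (γ δ : Fin n → ℤ) (l r : Fin (dimN t n)) :
    (raising t n γ * raising t n δ) l r =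
      ind (eps t n l - eps t n r = γ + δ ∧ ∃ k, eps t n k = eps t n l - γ) := by
  by_cases h : eps t n l - eps t n r = γ + δ ∧ ∃ k, eps t n k = eps t n l - γ
  · rw [ind_true h]
    obtain ⟨h1, k, hk⟩ := h
    rw [raising_mul_apply hk]
    have : eps t n k - eps t n r = δ := by
      rw [hk, sub_right_comm, h1]; abel
    simp [raising, this]
  · rw [ind_false h]
    by_cases h2 : ∃ k, eps t n k = eps t n l - γ
    · exact mul_mem_mdeg (raising_mem_mdeg γ) (raising_mem_mdeg δ) l r fun h3 => h ⟨h3, h2⟩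
    · exact raising_mul_apply_eq_zero (fun k hk => h2 ⟨k, hk⟩) _ _

/-- So long a weight can only join `w_l` to the vector of the opposite weight, and `k ↦ k.rev`
exchanges the intermediate vectors of the two products. -/
lemma raising_commute {γ δ : Fin n → ℤ} (h : 2 < nsq (γ + δ)) :
    raising t n γ * raising t n δ = raising t n δ * raising t n γ := by
  have key : ∀ γ δ : Fin n → ℤ, 2 < nsq (γ + δ) → ∀ l r : Fin (dimN t n),
      eps t n l - eps t n r = γ + δ → (∃ k, eps t n k = eps t n l - γ) →
      ∃ k, eps t n k = eps t n l - δ := by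
    rintro γ δ h l r h1 ⟨k, hk⟩
    have h2 := nsq_eps_sub (t := t) (n := n) l r
    rw [h1] at h2
    have h3 := h2.resolve_left (not_le.mpr h)
    refine ⟨k.rev, ?_⟩
    rw [eps_rev, hk]
    have h4 : γ = eps t n l - eps t n r - δ := by rw [h1]; abel
    rw [h4, h3]; abel
  ext l r
  rw [raising_mul_raising_apply, raising_mul_raising_apply]
  refine congrArg ind (propext ⟨fun h1 => ⟨?_, ?_⟩, fun h1 => ⟨?_, ?_⟩⟩)
  · rw [h1.1, add_comm]
  · exact key γ δ h l r h1.1 h1.2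
  · rw [h1.1, add_comm]
  · exact key δ γ (by rwa [add_comm]) l r h1.1 h1.2

end Mat

/-! ### The Serre and commutation relations of the representing matrices. -/

section Simple
variable (t : Series) (n : ℕ) [hT : Datum t n]

lemma nsq_simpleRoot (s : Fin n) :
    nsq (simpleRoot t n s) = if (s : ℕ) + 1 < n then 2 else
      match t with
      | .B => 1
      | .C => 4
      | .D => 2 := by
  have hs := s.2
  unfold simpleRoot
  split_ifs with h
  · rw [sub_eq_add_neg, ← Pi.single_neg, nsq_two_term]
    · norm_num
    · simp [Fin.ext_iff]
  · cases t
    · simp [nsq_single]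
    · simp [nsq_single]
    · have := hT.hD rfl
      simp only
      rw [nsq_two_term]
      · norm_num
      · simp [Fin.ext_iff]; omega

lemma nsq_simpleRoot_eq_one {s : Fin n} :
    nsq (simpleRoot t n s) = 1 ↔ t = .B ∧ (s : ℕ) + 1 = n := by
  have hs := s.2
  rw [nsq_simpleRoot]
  split_ifs with h
  · simp; intro _; omega
  · cases t <;> simp; omega

lemma three_le_nsq_add {i j : Fin n} (h : i ≠ j) :
    3 ≤ nsq (simpleRoot t n i) + nsq (simpleRoot t n j) := by
  have hi := (simpleRoot_isRoot t n i).nsq_pos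
  have hj := (simpleRoot_isRoot t n j).nsq_pos
  by_contra hc
  have h1 := (nsq_simpleRoot_eq_one t n).mp (show nsq (simpleRoot t n i) = 1 by omega)
  have h2 := (nsq_simpleRoot_eq_one t n).mp (show nsq (simpleRoot t n j) = 1 by omega)
  exact h (Fin.ext (by omega))

lemma dot_simpleRoot_nonpos {i j : Fin n} (h : i ≠ j) :
    simpleRoot t n j ⬝ᵥ simpleRoot t n i ≤ 0 := by
  obtain ⟨A, -, hc, -⟩ := cart_simpleRoot t n i j h
  have h1 := (simpleRoot_isRoot t n i).cart_mul (simpleRoot t n j)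
  have hi := (simpleRoot_isRoot t n i).nsq_pos
  rw [hc] at h1
  nlinarith

variable (q : ℂ) [hq : Generic q]

open Classical in
/-- The normalization of the lowering operators of the natural representation. -/
def coefF (s : Fin n) : ℂ := if t = .B ∧ (s : ℕ) + 1 = n then (qnum q (1 / 2))⁻¹ else 1

lemma cpow_half_sq : (q ^ (1 / 2 : ℂ)) ^ 2 = q := by
  rw [← Complex.cpow_nat_mul]; norm_num

lemma qnum_half_ne : qnum q (1 / 2) ≠ 0 := by
  have h := cpow_half_sq q
  have h0 : q ^ (1 / 2 : ℂ) ≠ 0 := by intro h1; rw [h1] at h; exact hq.ne (by simpa using h.symm)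
  refine div_ne_zero ?_ Generic.sub_inv_ne'
  rw [Complex.cpow_neg]
  intro h1
  apply hq.pow 1 one_pos
  rw [pow_one]
  nth_rw 1 [← h, pow_two, sub_eq_zero.mp h1]
  exact inv_mul_cancel₀ h0

lemma coefF_ne (s : Fin n) : coefF t n q s ≠ 0 := by
  unfold coefF
  split_ifs
  · exact inv_ne_zero (qnum_half_ne q)
  · exact one_ne_zero

/-- The transpose of the operator by which a lowering generator acts on the natural
representation. -/
def rmat (s : Fin n) : NMat t n := coefF t n q s • raising t n (simpleRoot t n s)

lemma natRep_F (s : Fin n) : natRep t n q (.F s) = (rmat t n q s)ᵀ := by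
  rw [natRep, rmat, Matrix.transpose_smul]; rfl

/-- For orthogonal roots the matrices commute by `raising_commute`. Otherwise each monomial of the
Serre polynomial has a weight longer than any difference of weights of the representation, so it
vanishes. -/
lemma serreP_rmat (i j : Fin n) (h : i ≠ j) :
    serreP (qi t n q i) (serreExp t n i j) (rmat t n q i) (rmat t n q j) = 0 := by
  obtain ⟨A, hA, hc, he⟩ := cart_simpleRoot t n i j h
  have h1 := (simpleRoot_isRoot t n i).cart_mul (simpleRoot t n j)
  have h3 := three_le_nsq_add t n h
  have hi := (simpleRoot_isRoot t n i).nsq_pos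
  have hj := (simpleRoot_isRoot t n j).nsq_pos
  have hmi := raising_mem_mdeg (t := t) (simpleRoot t n i)
  have hmj := raising_mem_mdeg (t := t) (simpleRoot t n j)
  rw [hc, dotProduct_comm] at h1
  rw [he, rmat, rmat, serreP_smul]
  have key : serreP (qi t n q i) (A + 1) (raising t n (simpleRoot t n i))
      (raising t n (simpleRoot t n j)) = 0 := by
    interval_cases A
    · rw [serreP_one, sub_eq_zero]
      apply raising_commute
      rw [nsq_add]
      push_cast at h1
      omega
    · have hn : 4 < nsq ((2 : ℤ) • simpleRoot t n i + simpleRoot t n j) := by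
        rw [nsq_add, nsq_smul, smul_dotProduct, smul_eq_mul]
        push_cast at h1
        omega
      have e1 := mdeg_eq_zero hn (by
        convert mul_mem_mdeg (mul_mem_mdeg hmi hmi) hmj using 2; module)
      have e2 := mdeg_eq_zero hn (by
        convert mul_mem_mdeg (mul_mem_mdeg hmi hmj) hmi using 2; module)
      have e3 := mdeg_eq_zero hn (by
        convert mul_mem_mdeg (mul_mem_mdeg hmj hmi) hmi using 2; module)
      rw [serreP_two, e1, e2, e3]
      simp
    · have hn : 4 < nsq ((3 : ℤ) • simpleRoot t n i + simpleRoot t n j) := by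
        rw [nsq_add, nsq_smul, smul_dotProduct, smul_eq_mul]
        push_cast at h1
        omega
      have e1 := mdeg_eq_zero hn (by
        convert mul_mem_mdeg (mul_mem_mdeg (mul_mem_mdeg hmi hmi) hmi) hmj using 2; module)
      have e2 := mdeg_eq_zero hn (by
        convert mul_mem_mdeg (mul_mem_mdeg (mul_mem_mdeg hmi hmi) hmj) hmi using 2; module)
      have e3 := mdeg_eq_zero hn (by
        convert mul_mem_mdeg (mul_mem_mdeg (mul_mem_mdeg hmi hmj) hmi) hmi using 2; module)
      have e4 := mdeg_eq_zero hn (by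
        convert mul_mem_mdeg (mul_mem_mdeg (mul_mem_mdeg hmj hmi) hmi) hmi using 2; module)
      rw [serreP_three, e1, e2, e3, e4]
      simp
  rw [key, smul_zero]

/-- The transpose of the natural representation of the negative part. -/
def rep (t : Series) (n : ℕ) [Datum t n] (q : ℂ) [Generic q] : Um t n q →ₐ[ℂ] NMat t n :=
  umLift (rmat t n q) (serreP_rmat t n q)

lemma rep_Fg (s : Fin n) : rep t n q (Fg t n q s) = rmat t n q s := umLift_Fg _ _ _

variable {t n q}

lemma rep_mem_mdeg {γ : Fin n → ℤ} {X : Um t n q} (hX : X ∈ hom t q γ) :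
    rep t n q X ∈ mdeg t γ := by
  have h : hom t q γ ≤ (mdeg t γ).comap (rep t n q).toLinearMap := by
    refine hom_le fun l hl => ?_
    rw [Submodule.mem_comap, ← hl]
    change rep t n q _ ∈ _
    clear hl
    induction l with
    | nil => simpa [word, wsum] using one_mem_mdeg
    | cons u l ih =>
      rw [word_cons, wsum_cons, map_mul, rep_Fg]
      exact mul_mem_mdeg (Submodule.smul_mem _ _ (raising_mem_mdeg _)) ih
  exact h hX

variable (t n q)

/-- The constant in the commutator of `e_α` and `e_{-α}`. -/
def coefK (s : Fin n) : ℂ :=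
  ((q - q⁻¹) * qnum q (((simpleRoot t n s ⬝ᵥ simpleRoot t n s : ℤ) : ℂ) / 2))⁻¹

/-- The diagonal matrix of `q^{h_α}`. -/
def kmat (z : ℂ) (s : Fin n) : NMat t n :=
  Matrix.diagonal fun l => z ^ (simpleRoot t n s ⬝ᵥ eps t n l : ℤ)

lemma coefK_eq (s : Fin n) : coefK t n q s = (qi t n q s - (qi t n q s)⁻¹)⁻¹ := by
  have h1 := Generic.sub_inv_ne' (p := q)
  rw [coefK, qnum, mul_div_cancel₀ _ h1, Complex.cpow_neg]
  rfl

lemma coefK_ne (s : Fin n) : coefK t n q s ≠ 0 := by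
  rw [coefK_eq]
  exact inv_ne_zero Generic.sub_inv_ne'

lemma coefF_eq (s : Fin n) (h : nsq (simpleRoot t n s) = 1) :
    coefF t n q s = coefK t n q s * (q - q⁻¹) := by
  rw [coefF, if_pos ((nsq_simpleRoot_eq_one t n).mp h), coefK_eq, qnum, inv_div, qi_eq, h,
    Complex.cpow_neg]
  push_cast
  rw [div_eq_inv_mul]

lemma coefF_eq_one (s : Fin n) (h : nsq (simpleRoot t n s) ≠ 1) : coefF t n q s = 1 := by
  rw [coefF, if_neg (fun h' => h ((nsq_simpleRoot_eq_one t n).mpr h'))]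

/-- The two indicators say whether the weight can be lowered or raised by the simple root. For the
short root of `B` the string passes through `0`, and there the factor `[1/2]_q⁻¹` is what makes the
identity hold. -/
lemma commutator_diag (s : Fin n) (l : Fin (dimN t n)) :
    coefF t n q s * (ind (∃ k, eps t n k = eps t n l - simpleRoot t n s) -
      ind (∃ k, eps t n k = eps t n l + simpleRoot t n s)) =
    coefK t n q s * (q ^ (simpleRoot t n s ⬝ᵥ eps t n l : ℤ) -
      q⁻¹ ^ (simpleRoot t n s ⬝ᵥ eps t n l : ℤ)) := by
  have hr := simpleRoot_isRoot t n s
  have hx := dot_sq_le (eps t n l) (simpleRoot t n s)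
  rw [exists_eps_iff, exists_eps_iff, ← nsq_eq_zero, ← nsq_eq_zero (v := _ + _), nsq_sub, nsq_add,
    inv_zpow]
  have hb := nsq_eps_eq t n l
  rw [dotProduct_comm (simpleRoot t n s)]
  have hcK := coefK_ne t n q s
  have hqi := qi_zpow_cart t n q s (eps t n l)
  have hcm := hr.cart_mul (eps t n l)
  have hz : eps t n l = 0 → eps t n l ⬝ᵥ simpleRoot t n s = 0 := by intro h; rw [h, zero_dotProduct]
  generalize eps t n l ⬝ᵥ simpleRoot t n s = x at *
  have h1 : coefK t n q s * (qi t n q s - (qi t n q s)⁻¹) = 1 := by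
    rw [coefK_eq]; exact inv_mul_cancel₀ Generic.sub_inv_ne'
  rw [← hqi]
  generalize hc : cart (eps t n l) (simpleRoot t n s) = c at *
  have hb' : nsq (eps t n l) = 1 ∨ t = .B ∧ nsq (eps t n l) = 0 ∧ x = 0 := by
    rcases hb with h | ⟨h1, h2⟩
    · exact Or.inl h
    · exact Or.inr ⟨h1, nsq_eq_zero.mpr h2, hz h2⟩
  generalize nsq (eps t n l) = e at *
  have hcase : ∀ y : ℤ, y ^ 2 ≤ 4 → y = -2 ∨ y = -1 ∨ y = 0 ∨ y = 1 ∨ y = 2 := by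
    intro y hy
    have : -2 ≤ y := by nlinarith
    have : y ≤ 2 := by nlinarith
    omega
  rcases hr.nsq_mem with ⟨h, hB⟩ | h | ⟨h, hC, u, hu⟩
  · rw [coefF_eq t n q s h, h]
    have hq2 : qi t n q s ^ 2 = q := by rw [qi_sq, h, zpow_one]
    have hq2' : (qi t n q s)⁻¹ ^ 2 = q⁻¹ := by rw [inv_pow, hq2]
    subst hB
    rw [h] at hx hcm
    have hx4 : x = -1 ∨ x = 0 ∨ x = 1 := by
      rcases hb' with rfl | ⟨-, rfl, rfl⟩
      · rcases hcase x (by linarith) with rfl | h | h | h | rfl <;> omega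
      · exact Or.inr (Or.inl rfl)
    have hcx : c = 2 * x := by omega
    subst hcx
    rcases hb' with rfl | ⟨-, rfl, rfl⟩
    · rcases hx4 with rfl | rfl | rfl
      · simp [ind]; rw [hq2]; ring
      · simp [ind]
      · simp [ind]; norm_cast; rw [hq2]; simp
    · simp [ind]
  · rw [coefF_eq_one t n q s (by omega), h]
    rw [h] at hx hcm
    have hcx : c = x := by omega
    subst hcx
    rcases hb' with rfl | ⟨hB, rfl, rfl⟩
    · rcases hcase c (by linarith) with rfl | rfl | rfl | rfl | rfl
      · norm_num at hx
      · simp [ind]; linear_combination h1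
      · simp [ind]
      · simp [ind]; linear_combination -h1
      · norm_num at hx
    · simp [ind]
  · rw [coefF_eq_one t n q s (by omega), h]
    subst hC
    rw [h] at hx hcm
    have hcx : x = 2 * c := by omega
    subst hcx
    rcases hb' with rfl | ⟨hB, -⟩
    · rcases hcase c (by nlinarith) with rfl | rfl | rfl | rfl | rfl
      · norm_num at hx
      · simp [ind]; linear_combination h1
      · simp [ind]
      · simp [ind]; linear_combination -h1
      · norm_num at hx
    · exact absurd hB (by simp)

/-- The commutation relation of raising and lowering operators in the natural representation. -/
lemma rmat_commutator (u s : Fin n) :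
    rmat t n q u * raising t n (-simpleRoot t n s) - raising t n (-simpleRoot t n s) * rmat t n q u =
      if u = s then coefK t n q s • (kmat t n q s - kmat t n q⁻¹ s) else 0 := by
  split_ifs with h
  · subst h
    ext l r
    rw [rmat, smul_mul_assoc, mul_smul_comm, ← smul_sub, Matrix.smul_apply, Matrix.sub_apply,
      raising_mul_raising_apply, raising_mul_raising_apply, Matrix.smul_apply, Matrix.sub_apply,
      smul_eq_mul, smul_eq_mul]
    by_cases hlr : l = r
    · subst hlr
      simpa [kmat] using commutator_diag t n q u l
    · have : eps t n l - eps t n r ≠ 0 := fun h' => hlr (eps_injective t n (sub_eq_zero.mp h'))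
      simp [kmat, hlr, this, ind]
  · rw [rmat, smul_mul_assoc, mul_smul_comm, ← smul_sub, raising_commute, sub_self, smul_zero]
    have h1 := three_le_nsq_add t n h
    have h2 := dot_simpleRoot_nonpos t n h
    rw [nsq_add, nsq_neg, dotProduct_neg, dotProduct_comm]
    omega

lemma kmat_mul (z : ℂ) (hz : z ≠ 0) (s : Fin n) {γ : Fin n → ℤ} {M : NMat t n} (hM : M ∈ mdeg t γ) :
    kmat t n z s * M = z ^ (simpleRoot t n s ⬝ᵥ γ : ℤ) • (M * kmat t n z s) := by
  ext l r
  rw [kmat, Matrix.diagonal_mul, Matrix.smul_apply, Matrix.mul_diagonal, smul_eq_mul]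
  by_cases h : eps t n l - eps t n r = γ
  · rw [← h, dotProduct_sub, zpow_sub₀ hz]
    have := zpow_ne_zero (simpleRoot t n s ⬝ᵥ eps t n r) hz
    field_simp
  · rw [hM l r h]; simp

/-- By induction on words, each occurrence of the letter `s` contributes a difference of `K` and
`K⁻¹`. Moving these to the right produces the twists that define `dB` and `dA`. -/
lemma rep_commutator (s : Fin n) (X : Um t n q) :
    rep t n q X * raising t n (-simpleRoot t n s) - raising t n (-simpleRoot t n s) * rep t n q X =
      coefK t n q s • (rep t n q (dB t q s X) * kmat t n q s -
        rep t n q (dA t q s X) * kmat t n q⁻¹ s) := by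
  have h0 := hq.ne
  set e := raising t n (-simpleRoot t n s) with he
  let N : Submodule ℂ (Um t n q) := LinearMap.ker
    (LinearMap.mulRight ℂ e ∘ₗ (rep t n q).toLinearMap - LinearMap.mulLeft ℂ e ∘ₗ (rep t n q).toLinearMap -
      coefK t n q s • (LinearMap.mulRight ℂ (kmat t n q s) ∘ₗ (rep t n q).toLinearMap ∘ₗ dB t q s -
        LinearMap.mulRight ℂ (kmat t n q⁻¹ s) ∘ₗ (rep t n q).toLinearMap ∘ₗ dA t q s))
  have key : X ∈ N := by
    refine um_induction (fun l => ?_) X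
    simp only [N, LinearMap.mem_ker, LinearMap.sub_apply, LinearMap.comp_apply,
      LinearMap.mulRight_apply, LinearMap.mulLeft_apply, LinearMap.smul_apply,
      AlgHom.toLinearMap_apply, sub_eq_zero (b := _ • _)]
    induction l with
    | nil => simp [word, dA, dB, der_one]
    | cons u l ih =>
      have hm := rep_mem_mdeg (word_mem_hom (t := t) (q := q) l)
      have e3 : dB t q s (word t q (u :: l)) = _ := der_word_cons _ _ _ _
      have e4 : dA t q s (word t q (u :: l)) = _ := der_word_cons _ _ _ _
      change dB t q s (word t q (u :: l)) = Fg t n q u * dB t q s (word t q l) + _ at e3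
      change dA t q s (word t q (u :: l)) = Fg t n q u * dA t q s (word t q l) + _ at e4
      rw [e3, e4, word_cons, map_mul, map_add, map_add, map_mul, map_mul, rep_Fg, mul_assoc,
        sub_eq_iff_eq_add.mp ih, ← mul_assoc e, ← sub_eq_iff_eq_add'.mpr
          (sub_eq_iff_eq_add.mp (rmat_commutator t n q u s)), ← he, sub_mul]
      split_ifs with h
      · have h1 := kmat_mul t n q h0 s hm
        have h2 := kmat_mul t n q⁻¹ (inv_ne_zero h0) s hm
        rw [smul_mul_assoc, sub_mul, h1, h2, map_smul, map_smul]
        simp only [mul_add, add_mul, mul_sub, mul_smul_comm, smul_mul_assoc, mul_assoc]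
        module
      · simp only [map_zero, zero_mul, add_zero, mul_add, mul_sub, mul_smul_comm, mul_assoc]
        module
  simpa [N, sub_eq_zero] using key

end Simple

/-! ### Reflection of singular vectors -/

section Weights
variable {t : Series} {n : ℕ} {β : Fin n → ℤ}

/-- With a nonnegative pairing, adding `β` gives squared length more than `1`; the excluded
exception is the zero weight with `β` short. -/
lemma eps_ne_add (hβ : IsRoot t β) {k : Fin (dimN t n)} (h : 0 ≤ cart (eps t n k) β)
    (h0 : eps t n k = 0 → nsq β ≠ 1) (l : Fin (dimN t n)) : eps t n l ≠ eps t n k + β := by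
  intro hl
  have h1 := congrArg nsq hl
  have hb := hβ.nsq_pos
  have hc := hβ.cart_mul (eps t n k)
  have hd : 0 ≤ eps t n k ⬝ᵥ β := by nlinarith
  rw [nsq_add] at h1
  have h2 : nsq (eps t n l) ≤ 1 := by
    rcases nsq_eps_eq t n l with hl | ⟨-, hl⟩ <;> rw [hl]; simp [nsq]
  rcases nsq_eps_eq t n k with hk | ⟨-, hk⟩
  · omega
  · have := h0 hk
    rw [hk, zero_dotProduct] at h1
    have : nsq (0 : Fin n → ℤ) = 0 := by simp [nsq]
    omega

lemma eps_ne_sub (hβ : IsRoot t β) {k : Fin (dimN t n)} (h : cart (eps t n k) β ≤ 0)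
    (h0 : eps t n k = 0 → nsq β ≠ 1) (l : Fin (dimN t n)) : eps t n l ≠ eps t n k - β := by
  intro hl
  refine eps_ne_add hβ (k := k.rev) (l := l.rev) ?_ ?_ ?_
  · rw [eps_rev, hβ.cart_neg]; omega
  · rw [eps_rev, neg_eq_zero]; exact h0
  · rw [eps_rev, eps_rev, hl]; abel

/-- Pairing `-2` forces `β` to be a short root of `B` and the weight to be `-β`, so the next weight
on the string is `0`. -/
lemma exists_eps_add (hβ : IsRoot t β) {k : Fin (dimN t n)} (h : cart (eps t n k) β = -2) :
    ∃ l, eps t n l = eps t n k + β := by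
  have hc := hβ.cart_mul (eps t n k)
  have hb := hβ.nsq_pos
  rw [h] at hc
  have h0 := nsq_add (eps t n k) β
  have h1 := nsq_nonneg (eps t n k + β)
  have h2 : nsq (eps t n k) = 1 := by
    rcases nsq_eps_eq t n k with hk | ⟨-, hk⟩
    · exact hk
    · rw [hk, zero_dotProduct] at hc; omega
  refine exists_eps_iff.mpr (Or.inr ?_)
  have hb1 : nsq β = 1 := by omega
  refine ⟨?_, nsq_eq_zero.mp (by omega)⟩
  rcases hβ.nsq_mem with ⟨-, h⟩ | h | ⟨h, -⟩
  · exact h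
  all_goals omega

/-- The reflection of a complex weight. -/
def crefl (β : Fin n → ℤ) (μ : Fin n → ℂ) : Fin n → ℂ :=
  fun a => μ a - 2 * pair μ β / (nsq β : ℂ) * (β a : ℂ)

lemma pair_crefl (hβ : IsRoot t β) (μ : Fin n → ℂ) (v : Fin n → ℤ) :
    pair (crefl β μ) v = pair μ (srefl β v) := by
  have hb : (nsq β : ℂ) ≠ 0 := by exact_mod_cast hβ.nsq_pos.ne'
  have h1 : crefl β μ = μ - (2 * pair μ β / (nsq β : ℂ)) • fun a => (β a : ℂ) := rfl
  have h2 : (cart v β : ℂ) * (nsq β : ℂ) = 2 * ((v ⬝ᵥ β : ℤ) : ℂ) := by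
    exact_mod_cast hβ.cart_mul v
  rw [h1, pair_sub_left, pair_smul_left, pair_intCast, srefl, pair_sub, pair_smul, dotProduct_comm]
  field_simp
  linear_combination pair μ β * h2

end Weights

section Twist
variable {A : Type*} [Ring A] [Algebra ℂ A] {f : A} {d P : ℂ}

lemma exists_mem_twist {M : Submodule ℂ A} {x : A} (hx : x ∈ ⨆ k, eig f d k ⊓ M) :
    ∃ y, (x, y) ∈ twist f d P M := by
  have h : (⨆ k, eig f d k ⊓ M) ≤ (twist f d P M).map (LinearMap.fst ℂ A A) :=
    iSup_le fun k z hz => ⟨_, mem_twist hz.1 hz.2, rfl⟩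
  obtain ⟨⟨x', y⟩, hy, rfl⟩ := h hx
  exact ⟨y, hy⟩

lemma twist_snd_mem {M : Submodule ℂ A} {x y : A} (h : (x, y) ∈ twist f d P M) : y ∈ M :=
  twist_induction M (LinearMap.snd ℂ A A) (fun _ _ _ hz => M.smul_mem _ hz) h

/-- A complex power of `f` intertwines two operators that shift the exponents. -/
lemma twist_intertwine (h0 : d ≠ 0) (hd : ∀ l : ℤ, l ≠ 0 → d ^ l ≠ 1)
    (hf : ∀ X, f * X = 0 → X = 0) (hP : P ≠ 0) {a b : A →ₗ[ℂ] A} {m : ℤ}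
    (ha : ∀ k, ∀ X ∈ eig f d k, a X ∈ eig f d (k + m))
    (hb : ∀ k, ∀ X ∈ eig f d k, b X ∈ eig f d (k - m)) {M : Submodule ℂ A} {x y : A}
    (h : (x, y) ∈ twist f d P M) {κ : ℂ} (hx : κ • a x = b x) : (κ * P ^ (2 * m)) • a y = b y := by
  have h1 : (LinearMap.prodMap (κ • a - b) (κ • P ^ m • a - P ^ (-m) • b)) (x, y) ∈
      twist f d P ⊤ := by
    refine twist_induction _ _ (fun k z hz _ => ?_) h
    have h2 := mem_twist (P := P) (ha k z hz) (M := ⊤) trivial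
    have h3 := mem_twist (P := P) (hb k z hz) (M := ⊤) trivial
    have h4 := Submodule.sub_mem _ (Submodule.smul_mem _ κ h2) h3
    convert h4 using 1
    refine Prod.ext rfl ?_
    simp only [LinearMap.prodMap_apply, LinearMap.sub_apply, LinearMap.smul_apply, Prod.snd_sub,
      Prod.smul_snd, map_smul, zpow_add₀ hP, sub_eq_add_neg k m]
    module
  have h2 : (κ • a - b) x = 0 := by simp [hx]
  rw [LinearMap.prodMap_apply, h2] at h1
  have h3 := twist_zero h0 hd hf h1
  have h4 : P ^ m • ((κ • P ^ m • a - P ^ (-m) • b) y) = 0 := by rw [h3, smul_zero]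
  have e1 : P ^ m * P ^ (-m) = 1 := by rw [← zpow_add₀ hP]; simp
  have e2 : P ^ (2 * m) = P ^ m * P ^ m := by rw [← zpow_add₀ hP]; ring_nf
  simp only [LinearMap.sub_apply, LinearMap.smul_apply, smul_sub, smul_smul] at h4
  rw [e1, one_smul, sub_eq_zero] at h4
  rw [e2, ← h4]
  module

end Twist

/-! ### Transport of singular vectors through a simple reflection. -/

section Step
variable {t : Series} {n : ℕ} [hT : Datum t n] {q : ℂ} [hq : Generic q]

/-- The elements that yield singular vectors in the Verma module of highest weight `μ - ρ`
(up to the factor `log q`). -/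
def Sing (μ : Fin n → ℂ) (θ : Um t n q) : Prop :=
  ∀ s, (Complex.exp (pair μ (simpleRoot t n s)) ^ 2 * q ^ (-nsq (simpleRoot t n s))) • dA t q s θ =
    dB t q s θ

lemma dA_pow_mul_of_ne {s u : Fin n} (h : s ≠ u) (m : ℕ) (X : Um t n q) :
    dA t q u (Fg t n q s ^ m * X) = Fg t n q s ^ m * dA t q u X := by
  induction m with
  | zero => simp
  | succ m ih => rw [pow_succ', mul_assoc, dA, der_Fg_mul_of_ne _ _ h, mul_assoc]; exact congrArg _ ih

lemma dB_pow_mul_of_ne {s u : Fin n} (h : s ≠ u) (m : ℕ) (X : Um t n q) :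
    dB t q u (Fg t n q s ^ m * X) = Fg t n q s ^ m * dB t q u X := by
  induction m with
  | zero => simp
  | succ m ih => rw [pow_succ', mul_assoc, dB, der_Fg_mul_of_ne _ _ h, mul_assoc]; exact congrArg _ ih

/-- For `u ≠ s` the derivation commutes with left multiplication by `F_s` and is twisted under right
multiplication, which shifts the exponent. -/
lemma dA_eig {s u : Fin n} (h : s ≠ u) (k : ℤ) (X : Um t n q)
    (hX : X ∈ eig (Fg t n q s) (qi t n q s) k) :
    dA t q u X ∈ eig (Fg t n q s) (qi t n q s)
      (k + cart (simpleRoot t n u) (simpleRoot t n s)) := by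
  have h1 : dA t q u (X * Fg t n q s) = _ := der_mul_Fg (Or.inr rfl) u X s
  rw [if_neg h, add_zero, mem_eig.mp hX, map_smul] at h1
  have h2 : dA t q u (Fg t n q s * X) = Fg t n q s * dA t q u X := by
    simpa using dA_pow_mul_of_ne h 1 X
  rw [h2, inv_zpow] at h1
  rw [mem_eig, zpow_add₀ (qi_ne t n q s), qi_zpow_cart, mul_comm, mul_smul, h1]
  rw [smul_smul, mul_inv_cancel₀ (zpow_ne_zero _ hq.ne), one_smul]; rfl

lemma dB_eig {s u : Fin n} (h : s ≠ u) (k : ℤ) (X : Um t n q)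
    (hX : X ∈ eig (Fg t n q s) (qi t n q s) k) :
    dB t q u X ∈ eig (Fg t n q s) (qi t n q s)
      (k - cart (simpleRoot t n u) (simpleRoot t n s)) := by
  have h1 : dB t q u (X * Fg t n q s) = _ := der_mul_Fg (Or.inl rfl) u X s
  rw [if_neg h, add_zero, mem_eig.mp hX, map_smul] at h1
  have h2 : dB t q u (Fg t n q s * X) = Fg t n q s * dB t q u X := by
    simpa using dB_pow_mul_of_ne h 1 X
  rw [h2] at h1
  rw [mem_eig, sub_eq_add_neg, zpow_add₀ (qi_ne t n q s), zpow_neg, qi_zpow_cart, mul_comm,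
    mul_smul, h1]
  rw [smul_smul, inv_mul_cancel₀ (zpow_ne_zero _ hq.ne), one_smul]; rfl

lemma Fg_pow_regular (s : Fin n) (m : ℕ) (X : Um t n q) (h : Fg t n q s ^ m * X = 0) : X = 0 := by
  induction m with
  | zero => simpa using h
  | succ m ih => rw [pow_succ', mul_assoc] at h; exact ih (Fg_regular s _ h)

/-- A complex power of a generator transforms singular vectors into singular vectors. -/
lemma exists_sing {μ : Fin n → ℂ} {s : Fin n} {γ : Fin n → ℤ} {c e : ℕ}
    (hc : cart γ (simpleRoot t n s) = -c) (hL : ht t γ = (c + e : ℕ)) {θ' : Um t n q}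
    (hθ' : θ' ∈ hom t q γ) (hs : Sing (crefl (simpleRoot t n s) μ) θ')
    (hP : ∀ k ≤ c + e, Complex.exp (pair μ (simpleRoot t n s)) ^ 2 ≠ qi t n q s ^ (2 * k)) :
    ∃ θ ∈ hom t q (srefl (simpleRoot t n s) γ), Sing μ θ ∧
      (Fg t n q s ^ (c + e) * θ', Fg t n q s ^ e * θ) ∈
        twist (Fg t n q s) (qi t n q s) (Complex.exp (pair μ (simpleRoot t n s)))
          (hom t q (srefl (simpleRoot t n s) γ + (e : ℤ) • simpleRoot t n s)) := by
  have hr := simpleRoot_isRoot t n s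
  have h0 := qi_ne t n q s
  set β := simpleRoot t n s with hβ
  set P := Complex.exp (pair μ β) with hPdef
  have hP0 : P ≠ 0 := Complex.exp_ne_zero _
  set α := srefl β γ with hα
  have hαγ : α = γ + (c : ℤ) • β := by rw [hα, srefl, hc]; module
  have hαc : cart α β = c := by rw [hα, hr.cart_refl, hc, neg_neg]
  have hq2 : q ^ (-nsq β) = qi t n q s ^ (-2 : ℤ) := by
    rw [zpow_neg, zpow_neg]; congr 1; exact (qi_sq t n q s).symm
  -- The exponent `c + e` is the height of the weight of `θ'`, so this product splits into
  -- eigenvectors and has a twist `y`.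
  have hx := Fg_pow_mul_mem (q := q) s hL hθ'
  have hw : γ + ((c + e : ℕ) : ℤ) • β = α + (e : ℤ) • β := by
    rw [hαγ]; push_cast; module
  rw [← hβ, hw] at hx
  obtain ⟨y, hy⟩ := exists_mem_twist (P := P) hx
  have hyM := twist_snd_mem hy
  have hwt : ∀ k : ℕ, hom t q (α + (k : ℤ) • β) ≤ (rankOne t q s).wt (c + 2 * k) := by
    intro k
    refine hom_le_cartWt_of_eq ?_
    rw [← hβ, hr.cart_add, hr.cart_smul, hr.dot_self, hαc]; ring
  have hθ'w : θ' ∈ (rankOne t q s).wt (-c) := hom_le_cartWt_of_eq hc hθ'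
  -- The reflection of `μ` negates its pairing with `β`, which replaces `P` by `P⁻¹`.
  have hs1 : (P ^ (-2 : ℤ) * qi t n q s ^ (-2 : ℤ)) • dA t q s θ' = dB t q s θ' := by
    have := hs s
    rw [← hβ, pair_crefl hr, hr.refl_self, pair_neg, Complex.exp_neg, ← hPdef, hq2] at this
    rw [← this, zpow_neg, inv_pow]; rfl
  have hsing := (rankOne t q s).twist_singular hP0 hθ'w hs1 rfl (hwt e) hy
  have hdown : ∀ (z : ℂ) (hz : z = q ∨ z = q⁻¹) (k : ℕ), ∀ X ∈ hom t q (α + ((k + 1 : ℕ) : ℤ) • β),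
      der hz s X ∈ hom t q (α + (k : ℤ) • β) := by
    intro z hz k X hX
    have := der_mem_hom hz s hX
    have e1 : α + ((k + 1 : ℕ) : ℤ) • β - simpleRoot t n s = α + (k : ℤ) • β := by
      rw [← hβ]; push_cast; module
    rwa [e1] at this
  obtain ⟨θ, hθ, hfy, hsθ⟩ := (rankOne t q s).exists_div (fun k => hom t q (α + (k : ℤ) • β)) hwt
    (hdown _ (Or.inr rfl)) (hdown _ (Or.inl rfl)) e
    (fun k _ hk => hP (c + k) (by omega)) y hyM hsing
  have hfy' : Fg t n q s ^ e * θ = y := hfy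
  have hsθ' : (P ^ 2 * qi t n q s ^ (-2 : ℤ)) • dA t q s θ = dB t q s θ := hsθ
  refine ⟨θ, by simpa using hθ, fun u => ?_, by rw [hfy']; exact hy⟩
  by_cases hu : s = u
  · rw [← hu, ← hβ, ← hPdef, hq2]; exact hsθ'
  · have h1 : Complex.exp (pair (crefl β μ) (simpleRoot t n u)) ^ 2 * q ^ (-nsq (simpleRoot t n u)) *
        P ^ (2 * cart (simpleRoot t n u) β) =
        Complex.exp (pair μ (simpleRoot t n u)) ^ 2 * q ^ (-nsq (simpleRoot t n u)) := by
      rw [pair_crefl hr, srefl, pair_sub, pair_smul, hPdef, ← Complex.exp_int_mul,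
        ← Complex.exp_nat_mul, ← Complex.exp_nat_mul, mul_right_comm, ← Complex.exp_add]
      congr 2; push_cast; ring
    -- For the other simple roots the twist changes the parameter of the equation exactly as the
    -- reflection of `μ` does; then `f ^ e` is cancelled.
    have h2 := twist_intertwine h0 Generic.zpow (Fg_regular s) hP0 (dA_eig hu) (dB_eig hu) hy
      (κ := Complex.exp (pair (crefl β μ) (simpleRoot t n u)) ^ 2 * q ^ (-nsq (simpleRoot t n u)))
      (by rw [dA_pow_mul_of_ne hu, dB_pow_mul_of_ne hu, ← hs u, mul_smul_comm])
    rw [h1, ← hfy', dA_pow_mul_of_ne hu, dB_pow_mul_of_ne hu, ← mul_smul_comm, ← sub_eq_zero,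
      ← mul_sub] at h2
    exact sub_eq_zero.mp (Fg_pow_regular s e _ h2)

end Step

/-! ### Matrix entries under a simple reflection. -/

section Nonvanish
variable {t : Series} {n : ℕ} [hT : Datum t n] {q : ℂ} [hq : Generic q]

/-- A row of the transposed natural representation. -/
def repRow (t : Series) {n : ℕ} [Datum t n] (q : ℂ) [Generic q] (i : Fin (dimN t n)) :
    Um t n q →ₗ[ℂ] (Fin (dimN t n) → ℂ) :=
  LinearMap.proj i ∘ₗ (rep t n q).toLinearMap

lemma repRow_apply (i : Fin (dimN t n)) (X : Um t n q) : repRow t q i X = rep t n q X i := rfl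

/-- The action of a lowering operator on row vectors. -/
def rowF (t : Series) {n : ℕ} [Datum t n] (q : ℂ) [Generic q] (s : Fin n) :
    Module.End ℂ (Fin (dimN t n) → ℂ) :=
  Matrix.vecMulLinear (rmat t n q s)

lemma repRow_mul_Fg (i : Fin (dimN t n)) (s : Fin n) (X : Um t n q) :
    repRow t q i (X * Fg t n q s) = rowF t q s (repRow t q i X) := by
  rw [repRow_apply, map_mul, rep_Fg]; rfl

lemma repRow_Fg_mul {i : Fin (dimN t n)} {s : Fin n}
    (h : ∀ k, eps t n k ≠ eps t n i - simpleRoot t n s) (X : Um t n q) :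
    repRow t q i (Fg t n q s * X) = 0 := by
  rw [repRow_apply, map_mul, rep_Fg]
  ext r
  rw [rmat, smul_mul_assoc, Matrix.smul_apply, raising_mul_apply_eq_zero h, smul_zero]; rfl

lemma rowF_apply {s : Fin n} {j k : Fin (dimN t n)} (h : eps t n k = eps t n j + simpleRoot t n s)
    (v : Fin (dimN t n) → ℂ) : rowF t q s v j = coefF t n q s * v k := by
  have h1 := mul_raising_apply h (Matrix.of fun _ : Fin (dimN t n) => v) j
  change (v ᵥ* rmat t n q s) j = _
  rw [rmat, Matrix.vecMul_smul]
  exact congrArg (coefF t n q s * ·) h1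

lemma rep_apply_eq_zero {γ : Fin n → ℤ} {X : Um t n q} (hX : X ∈ hom t q γ)
    {i j : Fin (dimN t n)} (h : eps t n i - eps t n j ≠ γ) : rep t n q X i j = 0 :=
  rep_mem_mdeg hX i j h

/-- Nonvanishing of a matrix entry moves up along a root string. -/
lemma rep_apply_ne_zero_of_dA {s : Fin n} {i i' j : Fin (dimN t n)} {X : Um t n q} {κ : ℂ}
    (hX : dB t q s X = κ • dA t q s X) (hi : eps t n i = eps t n i' + simpleRoot t n s)
    (hj : ∀ k, eps t n k ≠ eps t n j - simpleRoot t n s)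
    (hκ : κ * qi t n q s ^ (2 * cart (eps t n j) (simpleRoot t n s)) ≠ 1)
    (h : rep t n q (dA t q s X) i' j ≠ 0) : rep t n q X i j ≠ 0 := by
  have h1 := congrFun (congrFun (rep_commutator t n q s X) i') j
  -- Since `w_j` is at the bottom of its string, one term of the commutator vanishes at `(i', j)`;
  -- the other is the entry `(i, j)` of `X`.
  rw [Matrix.sub_apply, mul_raising_apply_eq_zero (by simpa [sub_eq_add_neg] using hj),
    raising_mul_apply (k := i) (by rw [hi]; abel), zero_sub, hX, map_smul, Matrix.smul_apply,
    Matrix.sub_apply, kmat, kmat, Matrix.mul_diagonal, Matrix.mul_diagonal, inv_zpow,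
    dotProduct_comm (simpleRoot t n s), ← qi_zpow_cart, Matrix.smul_apply] at h1
  intro h0
  rw [h0, neg_zero, eq_comm, smul_eq_mul, smul_eq_mul] at h1
  have h2 := (mul_eq_zero.mp h1).resolve_left (coefK_ne t n q s)
  apply hκ
  have h3 := zpow_ne_zero (cart (eps t n j) (simpleRoot t n s)) (qi_ne t n q s)
  rw [two_mul, zpow_add₀ (qi_ne t n q s)]
  generalize qi t n q s ^ cart (eps t n j) (simpleRoot t n s) = u at *
  have h4 : (κ * u - u⁻¹) * rep t n q (dA t q s X) i' j = 0 := by linear_combination h2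
  have h5 := (mul_eq_zero.mp h4).resolve_right h
  rw [sub_eq_zero] at h5
  rw [← mul_assoc, h5, inv_mul_cancel₀ h3]

/-- One reflection step: from a singular vector for the reflected weight to one for the weight
itself. -/
lemma reflect_step {μ : Fin n → ℂ} {s : Fin n} {i j i' j' : Fin (dimN t n)} {L : ℕ}
    (hi' : eps t n i' = srefl (simpleRoot t n s) (eps t n i))
    (hj' : eps t n j' = srefl (simpleRoot t n s) (eps t n j))
    (hi : 0 ≤ cart (eps t n i) (simpleRoot t n s)) (hj : cart (eps t n j) (simpleRoot t n s) ≤ 0)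
    (hi0 : eps t n i = 0 → nsq (simpleRoot t n s) ≠ 1)
    (hj0 : eps t n j = 0 → nsq (simpleRoot t n s) ≠ 1)
    (hc2 : cart (eps t n i - eps t n j) (simpleRoot t n s) ≤ 2)
    (hL : ht t (eps t n i' - eps t n j') = L) (hL2 : 2 ≤ L)
    (hP : ∀ k ≤ L, Complex.exp (pair μ (simpleRoot t n s)) ^ 2 ≠ qi t n q s ^ (2 * k))
    {θ' : Um t n q} (hθ' : θ' ∈ hom t q (eps t n i' - eps t n j'))
    (hs : Sing (crefl (simpleRoot t n s) μ) θ') (hne : rep t n q θ' i' j' ≠ 0) :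
    ∃ θ ∈ hom t q (eps t n i - eps t n j), Sing μ θ ∧ rep t n q θ i j ≠ 0 := by
  have hr := simpleRoot_isRoot t n s
  have h0 := qi_ne t n q s
  set β := simpleRoot t n s with hβ
  obtain ⟨p, hp⟩ := Int.eq_ofNat_of_zero_le hi
  obtain ⟨r, hrr⟩ := Int.eq_ofNat_of_zero_le (neg_nonneg.mpr hj)
  have hi'c : cart (eps t n i') β = -p := by rw [hi', hr.cart_refl, hp]
  have hj'c : cart (eps t n j') β = r := by rw [hj', hr.cart_refl, hrr]
  have hjc : cart (eps t n j) β = -r := by omega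
  rw [hr.cart_sub, hp, hjc] at hc2
  have hαe : srefl β (eps t n i' - eps t n j') = eps t n i - eps t n j := by
    rw [srefl, hr.cart_sub, hi'c, hj'c, hi', hj', srefl, srefl, hp, hjc]; module
  have hLe : L = (r + p) + (L - (r + p)) := by omega
  set e := L - (r + p) with he
  have hγc : cart (eps t n i' - eps t n j') β = -((r + p : ℕ) : ℤ) := by
    rw [hr.cart_sub, hi'c, hj'c]; push_cast; ring
  obtain ⟨θ, hθ, hsing, htw⟩ := exists_sing (μ := μ) (s := s) hγc (by rw [hL, hLe]) hθ' hs
    (fun k hk => hP k (by omega))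
  rw [← hβ, hαe] at hθ htw
  refine ⟨θ, hθ, hsing, ?_⟩
  have hlow : ∀ k, eps t n k ≠ eps t n i' - β := by
    refine eps_ne_sub hr (by omega) fun h => hi0 ?_
    rw [← hr.refl_refl (eps t n i), ← hi', h, srefl]
    simp [cart]
  have hhigh : ∀ k, eps t n k ≠ eps t n j' + β := by
    refine eps_ne_add hr (by omega) fun h => hj0 ?_
    rw [← hr.refl_refl (eps t n j), ← hj', h, srefl]
    simp [cart]
  have hjlow : ∀ k, eps t n k ≠ eps t n j - β := eps_ne_sub hr hj hj0
  set P := Complex.exp (pair μ β) with hPdef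
  -- Row `i'` is at the bottom of its `β`-string and hence kills left multiples of `f`. If this row
  -- vanished, the ladder would give `g ^ r = 0` on the row of `θ'`, whereas `g ^ r` moves its
  -- nonzero entry from column `j'` to column `j`.
  have hbase : repRow t q i' ((dA t q s ^ p) θ) ≠ 0 := by
    intro hzero
    have hαc : cart (eps t n i - eps t n j) β = ((r + p : ℕ) : ℤ) := by
      rw [hr.cart_sub, hp, hjc]; push_cast; ring
    have h1 := (rankOne t q s).twist_map_eq_zero (Φ := repRow t q i') (g := rowF t q s)
      (repRow_Fg_mul hlow) (repRow_mul_Fg i' s) (c := r + p) (e := e) (r := r) (s := p) rfl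
      (by omega) (hom_le_cartWt_of_eq hγc hθ') (hom_le_cartWt_of_eq hαc hθ)
      (hom_le_cartWt_of_eq (by rw [← hβ, hr.cart_add, hαc, hr.cart_smul, hr.dot_self]; ring))
      (fun z hz => by
        have h2 := der_pow_mem_hom (z := q⁻¹) (Or.inr rfl) s hz (r + p + e + 1)
        ext l
        -- One more derivative would land in the weight `ε_{j'} + β`, which does not occur.
        refine rep_apply_eq_zero h2 fun h3 => hhigh l ?_
        have h4 : eps t n l = eps t n i' - (eps t n i - eps t n j + (e : ℤ) • β -
            ((r + p + e + 1 : ℕ) : ℤ) • β) := by rw [← hβ] at h3; rw [← h3]; abel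
        rw [h4, hi', hj', srefl, srefl, hp, hjc]; push_cast; module)
      htw (Complex.exp_ne_zero _) (by simpa using hP 0 (by omega))
      (by have h := hP 1 (by omega); rw [mul_one] at h; exact h)
      hzero
    have hrow : repRow t q i' θ' j' ≠ 0 := hne
    have hF := coefF_ne t n q s
    have hr2 : r ≤ 2 := by omega
    rcases (by omega : r = 0 ∨ r = 1 ∨ r = 2) with hr0 | hr0 | hr0 <;> subst hr0
    · rw [pow_zero, Module.End.one_apply] at h1
      exact hrow (by rw [h1]; rfl)
    · rw [pow_one] at h1
      have h2 : eps t n j' = eps t n j + β := by rw [hj', srefl, hjc]; module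
      have h3 := rowF_apply (q := q) h2 (repRow t q i' θ')
      rw [h1] at h3
      exact mul_ne_zero hF hrow h3.symm
    · obtain ⟨k, hk⟩ := exists_eps_add hr (by rw [hjc]; rfl : cart (eps t n j) β = -2)
      have h2 : eps t n j' = eps t n k + β := by rw [hj', srefl, hjc, hk]; module
      have h3 := rowF_apply (q := q) h2 (repRow t q i' θ')
      have h4 := rowF_apply (q := q) hk (rowF t q s (repRow t q i' θ'))
      rw [pow_two, Module.End.mul_apply] at h1
      rw [h1, h3] at h4
      exact mul_ne_zero hF (mul_ne_zero hF hrow) h4.symm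
  have hentry : rep t n q ((dA t q s ^ p) θ) i' j ≠ 0 := by
    intro h2
    apply hbase
    ext l
    by_cases hl : l = j
    · rw [hl]; exact h2
    · refine rep_apply_eq_zero (der_pow_mem_hom (z := q⁻¹) (Or.inr rfl) s hθ p) fun h3 => hl ?_
      apply eps_injective t n
      rw [hi', srefl, hp, ← hβ] at h3
      have h4 : eps t n l = eps t n i - (p : ℤ) • β - (eps t n i - eps t n j - (p : ℤ) • β) := by
        rw [← h3]; abel
      rw [h4]; abel
  have hq2 : q ^ (-nsq β) = qi t n q s ^ (-2 : ℤ) := by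
    rw [zpow_neg, zpow_neg]; congr 1; exact (qi_sq t n q s).symm
  have hb : dB t q s θ = (P ^ 2 * qi t n q s ^ (-2 : ℤ)) • dA t q s θ := by
    rw [← hsing s, ← hβ, hq2]
  have hunit : ∀ m : ℕ, m ≤ 2 → P ^ 2 * (qi t n q s ^ (2 * m))⁻¹ ≠ 1 := by
    intro m hm h2
    apply hP m (by omega)
    rwa [mul_inv_eq_one₀ (pow_ne_zero _ h0)] at h2
  have hp2 : p ≤ 2 := by omega
  -- The nonzero entry in row `i'` is now carried up the `β`-string to row `i`, in `p` steps.
  rcases (by omega : p = 0 ∨ p = 1 ∨ p = 2) with hp0 | hp0 | hp0 <;> subst hp0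
  · have : i = i' := eps_injective t n (by rw [hi', srefl, hp]; simp)
    rw [this]
    simpa using hentry
  · rw [pow_one] at hentry
    refine rep_apply_ne_zero_of_dA hb (i' := i') ?_ hjlow ?_ hentry
    · rw [hi', srefl, hp]; module
    · rw [← hβ, hjc, mul_assoc, ← zpow_add₀ h0]
      have e1 : (-2 + 2 * -(r : ℤ)) = -((2 * (r + 1) : ℕ) : ℤ) := by push_cast; ring
      rw [e1, zpow_neg, zpow_natCast]
      exact hunit (r + 1) (by omega)
  · have hr0 : r = 0 := by omega
    subst hr0
    obtain ⟨k, hk⟩ := exists_eps_add hr (by rw [hi'c]; rfl : cart (eps t n i') β = -2)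
    -- For `p = 2` the climb passes through the zero weight, and its first step needs the
    -- proportionality of `dB` and `dA` on `dA θ`, with a shifted factor.
    have hba : dB t q s (dA t q s θ) = (P ^ 2 * qi t n q s ^ (-4 : ℤ)) • dA t q s (dA t q s θ) := by
      have h2 := dA_dB s s θ
      rw [hb, map_smul] at h2
      have h3 : q ^ (simpleRoot t n s ⬝ᵥ simpleRoot t n s : ℤ) = qi t n q s ^ 2 :=
        (qi_sq t n q s).symm
      rw [h3] at h2
      have h4 : dB t q s (dA t q s θ) = (qi t n q s ^ (-2 : ℤ)) • (qi t n q s ^ 2 •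
          dB t q s (dA t q s θ)) := by
        rw [smul_smul, ← zpow_natCast, ← zpow_add₀ h0]; simp
      have h5 : qi t n q s ^ (-4 : ℤ) = qi t n q s ^ (-2 : ℤ) * qi t n q s ^ (-2 : ℤ) := by
        rw [← zpow_add₀ h0]; rfl
      rw [h4, ← h2, h5]
      module
    rw [pow_two, Module.End.mul_apply] at hentry
    have h2 : rep t n q (dA t q s θ) k j ≠ 0 := by
      refine rep_apply_ne_zero_of_dA hba hk hjlow ?_ hentry
      have := hunit 2 le_rfl
      rw [← hβ, hjc]
      simpa [zpow_neg] using this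
    refine rep_apply_ne_zero_of_dA hb (i' := k) ?_ hjlow ?_ h2
    · rw [hk, hi', srefl, hp]; module
    · have := hunit 1 (by omega)
      rw [← hβ, hjc]
      simpa [zpow_neg] using this

end Nonvanish

/-! ### Induction on the height of the root. -/

section Core
variable {t : Series} {n : ℕ} [hT : Datum t n]

lemma crefl_add_smul (β : Fin n → ℤ) (z : ℂ) (μ ν : Fin n → ℂ) :
    crefl β (μ + z • ν) = crefl β μ + z • crefl β ν := by
  funext a
  simp only [crefl, pair_add_left, pair_smul_left, Pi.add_apply, Pi.smul_apply, smul_eq_mul]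
  ring

lemma exists_eps_refl {β : Fin n → ℤ} (h : IsRoot t β) (i : Fin (dimN t n)) :
    ∃ i', eps t n i' = srefl β (eps t n i) := by
  rw [exists_eps_iff, h.nsq_refl]
  refine (nsq_eps_eq t n i).imp id fun h0 => ⟨h0.1, ?_⟩
  rw [h0.2, srefl]
  simp [cart]

/-- The second alternative is the short root of `B`. In either case a positive pairing of `ε_i -
ε_j` forces the pairing of `ε_i` to be nonnegative and that of `ε_j` to be nonpositive. -/
lemma cart_eps {β : Fin n → ℤ} (h : IsRoot t β) :
    (∀ k, -1 ≤ cart (eps t n k) β ∧ cart (eps t n k) β ≤ 1) ∨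
    (∀ k, cart (eps t n k) β = -2 ∨ cart (eps t n k) β = 0 ∨ cart (eps t n k) β = 2) := by
  have h1 : ∀ k, (eps t n k ⬝ᵥ β) ^ 2 ≤ nsq β := by
    intro k
    have := dot_sq_le (eps t n k) β
    rcases nsq_eps_eq t n k with hk | ⟨-, hk⟩
    · rwa [hk, one_mul] at this
    · rw [hk, zero_dotProduct]; simpa using nsq_nonneg β
  have h2 := fun k => h.cart_mul (eps t n k)
  have hcase : ∀ y m : ℤ, 0 ≤ m → y ^ 2 < (m + 1) ^ 2 → -m ≤ y ∧ y ≤ m := by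
    intro y m hm hy
    have := abs_lt_of_sq_lt_sq hy (by omega)
    rw [abs_lt] at this
    omega
  rcases h.nsq_mem with ⟨hb, -⟩ | hb | ⟨hb, -⟩
  · right
    intro k
    have := h2 k
    have h4 := hcase _ 1 (by omega) ((h1 k).trans_lt (by rw [hb]; norm_num))
    rw [hb] at this
    omega
  · left
    intro k
    have := h2 k
    have h4 := hcase _ 1 (by omega) ((h1 k).trans_lt (by rw [hb]; norm_num))
    rw [hb] at this
    omega
  · left
    intro k
    have := h2 k
    have h4 := hcase _ 2 (by omega) ((h1 k).trans_lt (by rw [hb]; norm_num))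
    rw [hb] at this
    omega

/-- The specialization conditions on a pair of weights, relative to a positive root. -/
structure Cond (t : Series) (n : ℕ) (ν₀ ν₁ : Fin n → ℂ) (α : Fin n → ℤ) : Prop where
  mem : α ∈ posRoots t n
  exp_eq : Complex.exp (2 * pair ν₀ α) = 1
  pair_eq : pair ν₁ α = (nsq α : ℂ) / 2
  exp_ne : ∀ δ ∈ posRoots t n, α - δ ∈ posRoots t n → Complex.exp (2 * pair ν₀ δ) ≠ 1

lemma sub_mem_posRoots {α : Fin n → ℤ} {s : Fin n} (hα : α ∈ posRoots t n)
    (hne : α ≠ simpleRoot t n s) (hc : 0 < cart α (simpleRoot t n s)) :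
    α - simpleRoot t n s ∈ posRoots t n := by
  have hr := ((simpleRoot_isRoot t n s).sub_of_cart_pos (mem_posRoots_iff.mp hα).1 hne hc).1
  refine hr.pos_or_neg.resolve_right fun h => ?_
  refine (simpleRoot_mem hT.hD s).2 ⟨α, ?_, _, ?_, (add_sub_cancel α _).symm⟩
  · rwa [posRootsK_one]
  · rw [posRootsK_one]; rwa [neg_sub] at h

/-- The reflection permutes the positive roots other than `β`, so a splitting of the reflected root
that avoids `β` comes from a splitting of `α`. If one part is `β`, the condition reduces to the one
for `β`, which holds because `α = β + (α - β)` splits `α`. -/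
lemma Cond.reflect {ν₀ ν₁ : Fin n → ℂ} {α : Fin n → ℤ} (h : Cond t n ν₀ ν₁ α) {s : Fin n}
    (hne : α ≠ simpleRoot t n s) (hc : 0 < cart α (simpleRoot t n s)) :
    Cond t n (crefl (simpleRoot t n s) ν₀) (crefl (simpleRoot t n s) ν₁)
      (srefl (simpleRoot t n s) α) := by
  have hr := simpleRoot_isRoot t n s
  have hβ : simpleRoot t n s ∈ posRoots t n := by
    have := (simpleRoot_mem hT.hD s).1
    rwa [posRootsK_one] at this
  have hexp := h.exp_ne _ hβ (sub_mem_posRoots h.mem hne hc)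
  set β := simpleRoot t n s with hβdef
  refine ⟨refl_mem_posRoots hT.hD s h.mem hne, ?_, ?_, ?_⟩
  · rw [pair_crefl hr, hr.refl_refl, h.exp_eq]
  · rw [pair_crefl hr, hr.refl_refl, hr.nsq_refl, h.pair_eq]
  · intro δ hδ hδ'
    rw [pair_crefl hr]
    by_cases h1 : δ = β
    · rw [h1, hr.refl_self, pair_neg, mul_neg, Complex.exp_neg, Ne, inv_eq_one]
      exact hexp
    · by_cases h2 : srefl β α - δ = β
      · have h3 : srefl β δ = α + β := by
          have h4 : δ = srefl β α - β := by rw [eq_sub_iff_add_eq, add_comm]; exact (sub_eq_iff_eq_add.mp h2).symm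
          have h5 : cart (srefl β α - β) β = - cart α β - 2 := by
            rw [hr.cart_sub, hr.cart_refl, hr.dot_self]
          rw [h4, srefl, h5, srefl]; module
        rw [h3, pair_add, mul_add, Complex.exp_add, h.exp_eq, one_mul]
        exact hexp
      · refine h.exp_ne _ (refl_mem_posRoots hT.hD s hδ h1) ?_
        have h3 := refl_mem_posRoots hT.hD s hδ' h2
        have h4 : srefl β (srefl β α - δ) = α - srefl β δ := by
          rw [srefl, hr.cart_sub, hr.cart_refl, srefl, srefl]; module
        rwa [← hβdef, h4] at h3

lemma exists_wsum_of_ne_zero {q : ℂ} {γ : Fin n → ℤ} {X : Um t n q} (hX : X ∈ hom t q γ)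
    (h : X ≠ 0) : ∃ l : List (Fin n), wsum t l = γ := by
  by_contra hc
  push Not at hc
  apply h
  have : hom t q γ ≤ ⊥ := hom_le fun l hl => absurd hl (hc l)
  exact (Submodule.mem_bot ℂ).mp (this hX)

/-- Both sides are continuous at `q = 1`, where the right side is `1` and the left side is the
exponential in the hypothesis. -/
lemma eventually_exp_ne {ν₀ ν₁ : Fin n → ℂ} {β : Fin n → ℤ} (s : Fin n)
    (h : Complex.exp (2 * pair ν₀ β) ≠ 1) (k : ℕ) : ∀ᶠ q in 𝓝 (1 : ℂ),
      Complex.exp (pair (ν₀ + Complex.log q • ν₁) β) ^ 2 ≠ qi t n q s ^ (2 * k) := by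
  have hlog : ContinuousAt Complex.log 1 := continuousAt_clog Complex.one_mem_slitPlane
  have h1 : ContinuousAt (fun q : ℂ => Complex.exp (pair (ν₀ + Complex.log q • ν₁) β) ^ 2) 1 := by
    simp only [pair_add_left, pair_smul_left]
    fun_prop
  have h2 : ContinuousAt (fun q : ℂ => qi t n q s ^ (2 * k)) 1 := by
    simp only [pow_mul, qi_sq]
    exact (continuousAt_zpow₀ (1 : ℂ) _ (Or.inl one_ne_zero)).pow k
  have h3 := (h1.sub h2).eventually_ne (y := 0) (by
    simp only [Pi.sub_apply, Complex.log_one, zero_smul, add_zero, pow_mul, qi_sq, one_zpow, one_pow]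
    rw [← Complex.exp_nat_mul, sub_ne_zero]
    exact h)
  filter_upwards [h3] with q hq
  exact sub_ne_zero.mp hq

/-- Existence of a singular vector with a nonzero matrix entry. -/
theorem eventually_exists_sing (m : ℕ) : ∀ (ν₀ ν₁ : Fin n → ℂ) (i j : Fin (dimN t n)),
    Cond t n ν₀ ν₁ (eps t n i - eps t n j) → ht t (eps t n i - eps t n j) ≤ m →
    ∀ᶠ q in 𝓝 (1 : ℂ), ∀ _ : Generic q, ∃ θ ∈ hom t q (eps t n i - eps t n j),
      Sing (ν₀ + Complex.log q • ν₁) θ ∧ rep t n q θ i j ≠ 0 := by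
  induction m with
  | zero =>
    intro ν₀ ν₁ i j h hm
    have := (mem_posRoots_iff.mp h.mem).2
    exact absurd this (by push_cast at hm; omega)
  | succ m ih =>
    intro ν₀ ν₁ i j h hm
    obtain ⟨s, hs⟩ := exists_simpleRoot_dot_pos h.mem
    have hr := simpleRoot_isRoot t n s
    have hb := hr.nsq_pos
    set α := eps t n i - eps t n j with hα
    have hrα := (mem_posRoots_iff.mp h.mem).1
    by_cases hne : α = simpleRoot t n s
    -- If `α` is simple, `θ` is its generator, and the singularity equation becomes `e^{2(μ, α)}
    -- q^{-(α, α)} = 1`, which follows from `exp_eq` and `pair_eq`.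
    · refine Filter.Eventually.of_forall fun q hq => ⟨Fg t n q s, hne ▸ Fg_mem_hom s, fun u => ?_, ?_⟩
      · rw [dA, dB, der_Fg, der_Fg]
        split_ifs with hu
        · subst hu
          have h1 : Complex.exp (pair (ν₀ + Complex.log q • ν₁) (simpleRoot t n s)) ^ 2 *
              q ^ (-nsq (simpleRoot t n s)) = 1 := by
            rw [← hne, pair_add_left, pair_smul_left, h.pair_eq, ← Complex.exp_nat_mul, mul_add,
              Complex.exp_add]
            have h2 : ((2 : ℕ) : ℂ) * pair ν₀ α = 2 * pair ν₀ α := by norm_num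
            have h3 : ((2 : ℕ) : ℂ) * (Complex.log q * ((nsq α : ℂ) / 2)) =
                (nsq α : ℂ) * Complex.log q := by push_cast; ring
            rw [h2, h.exp_eq, h3, Complex.exp_int_mul, Complex.exp_log hq.ne, one_mul,
              ← zpow_add₀ hq.ne]
            simp
          rw [h1, one_smul]
        · rw [smul_zero]
      · rw [rep_Fg, rmat, Matrix.smul_apply]
        refine mul_ne_zero (coefF_ne t n q s) ?_
        simp [raising, ← hα, hne]
    · have hcm := hr.cart_mul α
      have hc : 0 < cart α (simpleRoot t n s) := by
        by_contra hcc
        have : cart α (simpleRoot t n s) * nsq (simpleRoot t n s) ≤ 0 :=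
          mul_nonpos_of_nonpos_of_nonneg (not_lt.mp hcc) hb.le
        omega
      have hc2 := (hr.sub_of_cart_pos hrα hne hc).2
      have hcond := h.reflect hne hc
      have hβ : simpleRoot t n s ∈ posRoots t n := by
        have := (simpleRoot_mem hT.hD s).1
        rwa [posRootsK_one] at this
      have hexp := h.exp_ne _ hβ (sub_mem_posRoots h.mem hne hc)
      obtain ⟨i', hi'⟩ := exists_eps_refl hr i
      obtain ⟨j', hj'⟩ := exists_eps_refl hr j
      have hij : srefl (simpleRoot t n s) α = eps t n i' - eps t n j' := by
        rw [hi', hj', hα, srefl, srefl, srefl, hr.cart_sub]; module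
      rw [hij] at hcond
      have hht : ht t (eps t n i' - eps t n j') = ht t α - 2 * cart α (simpleRoot t n s) := by
        rw [← hij, srefl, ht_sub, ht_smul, ht_simpleRoot]; ring
      have hpos := (mem_posRoots_iff.mp hcond.mem).2
      obtain ⟨L, hL⟩ := Int.eq_ofNat_of_zero_le hpos.le
      -- Two distinct roots of length `1` cannot pair positively. This excludes the zero weight from
      -- the string lemmas when `β` is short.
      have hzero : nsq α = 1 → nsq (simpleRoot t n s) ≠ 1 := by
        intro h1 h2
        apply hne
        rw [← sub_eq_zero, ← nsq_eq_zero]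
        have h3 := nsq_sub α (simpleRoot t n s)
        have h4 := nsq_nonneg (α - simpleRoot t n s)
        omega
      have hcar := cart_eps hr
      have hsub := hr.cart_sub (eps t n i) (eps t n j)
      rw [← hα] at hsub
      have hP : ∀ᶠ q in 𝓝 (1 : ℂ), ∀ k ≤ L,
          Complex.exp (pair (ν₀ + Complex.log q • ν₁) (simpleRoot t n s)) ^ 2 ≠
            qi t n q s ^ (2 * k) := by
        have := (Filter.eventually_all_finset (Finset.range (L + 1))).mpr
          fun k _ => eventually_exp_ne (t := t) (ν₁ := ν₁) s hexp k
        filter_upwards [this] with q hq k hk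
        exact hq k (Finset.mem_range.mpr (by omega))
      filter_upwards [ih _ _ i' j' hcond (by push_cast at hm; omega), hP] with q h1 h2 hq
      obtain ⟨θ', hθ', hs', hn'⟩ := h1 hq
      rw [← crefl_add_smul] at hs'
      -- The nonzero vector `θ'` involves at least one letter.
      have hL2 : 2 ≤ L := by
        obtain ⟨l, hl⟩ := exists_wsum_of_ne_zero hθ' (by rintro rfl; simp at hn')
        have := ht_wsum (t := t) l
        rw [hl, hL] at this
        omega
      refine reflect_step hi' hj' ?_ ?_ ?_ ?_ (by rw [← hα]; omega) hL hL2 h2 hθ' hs' hn'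
      · rcases hcar with h | h
        · have := h i; have := h j
          by_contra hc'
          omega
        · have := h i; have := h j; omega
      · rcases hcar with h | h
        · have := h i; have := h j
          by_contra hc'
          omega
        · have := h i; have := h j; omega
      · intro h0
        apply hzero
        have h3 := nsq_eps_eq t n j
        rw [h0, zero_sub] at hα
        rw [hα, nsq_neg]
        refine h3.resolve_right fun h4 => ?_
        rw [hα, h4.2, neg_zero] at hs
        simp at hs
      · intro h0
        apply hzero
        have h3 := nsq_eps_eq t n i
        rw [h0, sub_zero] at hα
        rw [hα]
        refine h3.resolve_right fun h4 => ?_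
        rw [hα, h4.2] at hs
        simp at hs

end Core

/-! ### Singular vectors of Verma modules through skew derivations. -/

section Verma
variable {t : Series} {n : ℕ} {q : ℂ}

lemma ugen_rel {a b : Free n} (h : UqRel t n q a b) :
    RingQuot.mkAlgHom ℂ (UqRel t n q) a = RingQuot.mkAlgHom ℂ (UqRel t n q) b :=
  RingQuot.mkAlgHom_rel ℂ h

/-- The embedding of the negative part. -/
def iota (t : Series) (n : ℕ) (q : ℂ) : Um t n q →ₐ[ℂ] Uq t n q :=
  umLift (fun i => ugen t n q (.F i)) fun i j h => by
    have h1 := ugen_rel (UqRel.serre_F (t := t) (q := q) i j h)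
    rw [map_zero] at h1
    rw [← h1]
    exact (map_serreP (RingQuot.mkAlgHom ℂ (UqRel t n q)) _ _ _ _).symm

lemma iota_Fg (s : Fin n) : iota t n q (Fg t n q s) = ugen t n q (.F s) := umLift_Fg _ _ _

lemma ugen_K_Kinv (s : Fin n) : ugen t n q (.K s) * ugen t n q (.Kinv s) = 1 := by
  have := ugen_rel (UqRel.K_Kinv (t := t) (q := q) s)
  rwa [map_mul, map_one] at this

lemma ugen_Kinv_K (s : Fin n) : ugen t n q (.Kinv s) * ugen t n q (.K s) = 1 := by
  have := ugen_rel (UqRel.Kinv_K (t := t) (q := q) s)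
  rwa [map_mul, map_one] at this

lemma ugen_K_F (s u : Fin n) : ugen t n q (.K s) * ugen t n q (.F u) =
    q⁻¹ ^ (simpleRoot t n s ⬝ᵥ simpleRoot t n u : ℤ) • (ugen t n q (.F u) * ugen t n q (.K s)) := by
  have h := ugen_rel (UqRel.K_F (t := t) (q := q) s u)
  rw [map_mul, map_mul, map_smul] at h
  have h1 := congrArg (· * ugen t n q (.K s)) h
  simp only [smul_mul_assoc] at h1
  change ugen t n q (.K s) * ugen t n q (.F u) * ugen t n q (.Kinv s) * ugen t n q (.K s) =
    _ • (ugen t n q (.F u) * _) at h1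
  rwa [mul_assoc, ugen_Kinv_K, mul_one, zpow_neg, ← inv_zpow] at h1

variable [hT : Datum t n] [hq : Generic q]

lemma ugen_K_iota (s : Fin n) {γ : Fin n → ℤ} {X : Um t n q} (hX : X ∈ hom t q γ) :
    ugen t n q (.K s) * iota t n q X =
      q⁻¹ ^ (simpleRoot t n s ⬝ᵥ γ : ℤ) • (iota t n q X * ugen t n q (.K s)) := by
  have h : hom t q γ ≤ LinearMap.ker (LinearMap.mulLeft ℂ (ugen t n q (.K s)) ∘ₗ
      (iota t n q).toLinearMap - q⁻¹ ^ (simpleRoot t n s ⬝ᵥ γ : ℤ) •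
        LinearMap.mulRight ℂ (ugen t n q (.K s)) ∘ₗ (iota t n q).toLinearMap) := by
    refine hom_le fun l hl => ?_
    simp only [LinearMap.mem_ker, LinearMap.sub_apply, LinearMap.comp_apply,
      LinearMap.mulRight_apply, LinearMap.mulLeft_apply, LinearMap.smul_apply,
      AlgHom.toLinearMap_apply, sub_eq_zero]
    clear hX
    subst hl
    induction l with
    | nil => simp [word, wsum]
    | cons u l ih =>
      rw [word_cons, map_mul, iota_Fg, ← mul_assoc, ugen_K_F, smul_mul_assoc, mul_assoc, ih,
        wsum_cons, dotProduct_add, zpow_add₀ (inv_ne_zero hq.ne), mul_smul_comm, smul_smul,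
        mul_assoc]
  simpa [sub_eq_zero] using h hX

lemma ugen_Kinv_iota (s : Fin n) {γ : Fin n → ℤ} {X : Um t n q} (hX : X ∈ hom t q γ) :
    ugen t n q (.Kinv s) * iota t n q X =
      q ^ (simpleRoot t n s ⬝ᵥ γ : ℤ) • (iota t n q X * ugen t n q (.Kinv s)) := by
  have h := ugen_K_iota s hX
  have h1 := congrArg (fun Y => ugen t n q (.Kinv s) * Y * ugen t n q (.Kinv s)) h
  simp only [mul_smul_comm, smul_mul_assoc] at h1
  rw [← mul_assoc, ugen_Kinv_K, one_mul, mul_assoc, mul_assoc, ugen_K_Kinv, mul_one] at h1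
  rw [h1, smul_smul, inv_zpow, mul_inv_cancel₀ (zpow_ne_zero _ hq.ne), one_smul]

lemma ugen_E_F (s u : Fin n) : ugen t n q (.E s) * ugen t n q (.F u) =
    ugen t n q (.F u) * ugen t n q (.E s) +
      if u = s then coefK t n q s • (ugen t n q (.K s) - ugen t n q (.Kinv s)) else 0 := by
  split_ifs with h
  · subst h
    have h := ugen_rel (UqRel.E_F_same (t := t) (q := q) u)
    rw [map_sub, map_mul, map_mul, map_smul, map_sub] at h
    exact sub_eq_iff_eq_add'.mp h
  · have h := ugen_rel (UqRel.E_F (t := t) (q := q) s u (Ne.symm h))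
    rw [map_sub, map_mul, map_mul, map_zero, sub_eq_zero] at h
    rw [add_zero]
    exact h

lemma ugen_E_iota (s : Fin n) (X : Um t n q) :
    ugen t n q (.E s) * iota t n q X = iota t n q X * ugen t n q (.E s) +
      coefK t n q s • (iota t n q (dA t q s X) * ugen t n q (.K s) -
        iota t n q (dB t q s X) * ugen t n q (.Kinv s)) := by
  let N : Submodule ℂ (Um t n q) := LinearMap.ker
    (LinearMap.mulLeft ℂ (ugen t n q (.E s)) ∘ₗ (iota t n q).toLinearMap -
      (LinearMap.mulRight ℂ (ugen t n q (.E s)) ∘ₗ (iota t n q).toLinearMap +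
      coefK t n q s • (LinearMap.mulRight ℂ (ugen t n q (.K s)) ∘ₗ (iota t n q).toLinearMap ∘ₗ
        dA t q s - LinearMap.mulRight ℂ (ugen t n q (.Kinv s)) ∘ₗ (iota t n q).toLinearMap ∘ₗ
        dB t q s)))
  have key : X ∈ N := by
    refine um_induction (fun l => ?_) X
    simp only [N, LinearMap.mem_ker, LinearMap.sub_apply, LinearMap.add_apply,
      LinearMap.comp_apply, LinearMap.mulRight_apply, LinearMap.mulLeft_apply,
      LinearMap.smul_apply, AlgHom.toLinearMap_apply, sub_eq_zero (a := ugen t n q (.E s) * _)]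
    induction l with
    | nil => simp [word, dA, dB, der_one]
    | cons u l ih =>
      have hm := word_mem_hom (t := t) (q := q) l
      have e3 : dB t q s (word t q (u :: l)) = _ := der_word_cons _ _ _ _
      have e4 : dA t q s (word t q (u :: l)) = _ := der_word_cons _ _ _ _
      change dB t q s (word t q (u :: l)) = Fg t n q u * dB t q s (word t q l) + _ at e3
      change dA t q s (word t q (u :: l)) = Fg t n q u * dA t q s (word t q l) + _ at e4
      rw [e3, e4, word_cons, map_mul, map_add, map_add, map_mul, map_mul, iota_Fg, ← mul_assoc,
        ugen_E_F, add_mul, mul_assoc _ (ugen t n q (.E s)), ih]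
      split_ifs with h
      · rw [smul_mul_assoc, sub_mul, ugen_K_iota s hm, ugen_Kinv_iota s hm, map_smul, map_smul]
        simp only [mul_add, add_mul, mul_sub, mul_smul_comm, smul_mul_assoc, mul_assoc]
        module
      · simp only [map_zero, zero_mul, add_zero, mul_add, mul_sub, mul_smul_comm, mul_assoc]
  simpa [N, sub_eq_zero] using key

variable {lam : Fin n → ℂ}

/-- The highest weight vector of the Verma module. -/
def vac (t : Series) (n : ℕ) (q : ℂ) (lam : Fin n → ℂ) : Verma t n q lam :=
  (vermaIdeal t n q lam).mkQ 1

lemma mkQ_eq_zero_of_mem {X : Uq t n q} (h : X ∈ vermaIdeal t n q lam) :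
    X • vac t n q lam = 0 := by
  rw [vac, ← map_smul, smul_eq_mul, mul_one]
  exact (Submodule.Quotient.mk_eq_zero _).mpr h

lemma E_vac (s : Fin n) : ugen t n q (.E s) • vac t n q lam = 0 :=
  mkQ_eq_zero_of_mem (Submodule.subset_span (Or.inl ⟨s, rfl⟩))

lemma K_vac (s : Fin n) : ugen t n q (.K s) • vac t n q lam =
    (q ^ pair lam (simpleRoot t n s)) • vac t n q lam := by
  have h : (ugen t n q (.K s) - algebraMap ℂ (Uq t n q) (q ^ pair lam (simpleRoot t n s))) •
      vac t n q lam = 0 := mkQ_eq_zero_of_mem (Submodule.subset_span (Or.inr ⟨s, rfl⟩))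
  rw [sub_smul, sub_eq_zero, algebraMap_smul] at h
  exact h

section Module
variable {M : Type*} [AddCommGroup M] [Module ℂ M] [Module (Uq t n q) M]
  [IsScalarTower ℂ (Uq t n q) M]

lemma Kinv_smul_of_K_smul {s : Fin n} {v : M} {c : ℂ} (hc : c ≠ 0)
    (hv : ugen t n q (.K s) • v = c • v) : ugen t n q (.Kinv s) • v = c⁻¹ • v := by
  have : SMulCommClass ℂ (Uq t n q) M := IsScalarTower.to_smulCommClass
  have h : ugen t n q (.Kinv s) • ugen t n q (.K s) • v = ugen t n q (.Kinv s) • c • v := by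
    rw [hv]
  rw [smul_smul, ugen_Kinv_K, one_smul, ← smul_comm c] at h
  nth_rw 2 [h]
  rw [inv_smul_smul₀ hc]

lemma K_iota_smul {s : Fin n} {v : M} {c : ℂ} (hv : ugen t n q (.K s) • v = c • v)
    {γ : Fin n → ℤ} {X : Um t n q} (hX : X ∈ hom t q γ) :
    ugen t n q (.K s) • iota t n q X • v =
      (q⁻¹ ^ (simpleRoot t n s ⬝ᵥ γ : ℤ) * c) • iota t n q X • v := by
  have : SMulCommClass ℂ (Uq t n q) M := IsScalarTower.to_smulCommClass
  rw [smul_smul, ugen_K_iota s hX, smul_assoc, mul_smul, hv, ← smul_comm c, mul_smul]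

/-- On a highest weight vector the commutator with `E` reduces to a multiple of `c dA X - c⁻¹ dB X`.
This is the origin of the equation in `Sing`. -/
lemma E_iota_smul {s : Fin n} {v : M} {c : ℂ} (hc : c ≠ 0)
    (hv : ugen t n q (.K s) • v = c • v) (hE : ugen t n q (.E s) • v = 0) (X : Um t n q)
    (hX : c ^ 2 • dA t q s X = dB t q s X) :
    ugen t n q (.E s) • iota t n q X • v = 0 := by
  have : SMulCommClass ℂ (Uq t n q) M := IsScalarTower.to_smulCommClass
  rw [smul_smul, ugen_E_iota, ← hX, map_smul, add_smul, smul_assoc, sub_smul, mul_smul, hE,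
    smul_zero, mul_smul, hv, smul_mul_assoc, smul_assoc, mul_smul, Kinv_smul_of_K_smul hc hv,
    ← smul_comm c, ← smul_comm c⁻¹, smul_smul, pow_two, mul_assoc, mul_inv_cancel₀ hc, mul_one,
    sub_self, smul_zero, add_zero]

lemma Kinv_iota_smul {s : Fin n} {v : M} {c : ℂ} (hc : c ≠ 0)
    (hv : ugen t n q (.K s) • v = c • v)
    {γ : Fin n → ℤ} {X : Um t n q} (hX : X ∈ hom t q γ) :
    ugen t n q (.Kinv s) • iota t n q X • v =
      (q ^ (simpleRoot t n s ⬝ᵥ γ : ℤ) * c⁻¹) • iota t n q X • v := by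
  rw [Kinv_smul_of_K_smul (mul_ne_zero (zpow_ne_zero _ (inv_ne_zero hq.ne)) hc)
    (K_iota_smul hv hX), mul_inv, inv_zpow, inv_inv]

end Module

lemma cpow_ne_zero (z : ℂ) : q ^ z ≠ 0 := by
  rw [Ne, Complex.cpow_eq_zero_iff]; exact fun h => hq.ne h.1

/-- The weight vectors of the Verma module obtained from `Sing` are singular. -/
lemma isSingular_iota {μ : Fin n → ℂ} {γ : Fin n → ℤ} {θ : Um t n q} (hθ : θ ∈ hom t q γ)
    (hs : Sing μ θ)
    (hμ : ∀ s, Complex.exp (pair μ (simpleRoot t n s)) ^ 2 * q ^ (-nsq (simpleRoot t n s)) =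
      (q ^ pair lam (simpleRoot t n s)) ^ 2) :
    IsSingular (lam - fun a => (γ a : ℂ)) (iota t n q θ • vac t n q lam) := by
  refine ⟨fun s => ?_, fun s => ?_⟩
  · refine E_iota_smul (cpow_ne_zero _) (K_vac s) (E_vac s) θ ?_
    rw [← hμ]
    exact hs s
  · rw [K_iota_smul (K_vac s) hθ, pair_sub_left, pair_intCast, Complex.cpow_sub _ _ hq.ne,
      Complex.cpow_intCast, inv_zpow, mul_comm, dotProduct_comm, div_eq_mul_inv]

end Verma

/-! ### Reduction of relations in the tensor product. -/

section Tensor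
variable {t : Series} {n : ℕ} {q : ℂ} {x : Fin n → ℂˣ} {lam : Fin n → ℂ}

lemma gen_smul (g : Gen n) (z : Tens t n q x lam) : gen g • z = actT t n q x lam g z := by
  change FreeAlgebra.lift ℂ (actT t n q x lam) (gen g) z = _
  rw [gen, FreeAlgebra.lift_ι_apply]

lemma algebraMap_smul_tens (c : ℂ) (z : Tens t n q x lam) :
    algebraMap ℂ (Free n) c • z = c • z := by
  change FreeAlgebra.lift ℂ (actT t n q x lam) (algebraMap ℂ (Free n) c) z = _
  rw [AlgHom.commutes]
  rfl

lemma smul_mem_tens (S : Submodule (Free n) (Tens t n q x lam)) (c : ℂ) {z : Tens t n q x lam}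
    (hz : z ∈ S) : c • z ∈ S := by
  rw [← algebraMap_smul_tens]
  exact S.smul_mem _ hz

/-- The map `y ↦ w_k ⊗ y`. -/
def tw (k : Fin (dimN t n)) : ParVerma t n q x lam →ₗ[ℂ] Tens t n q x lam :=
  TensorProduct.mk ℂ (Fin (dimN t n) → ℂ) (ParVerma t n q x lam) (Pi.single k 1)

lemma tw_hwVec (k : Fin (dimN t n)) : tw k (hwVec t n q x lam) = wv t n q x lam k := rfl

variable [hT : Datum t n] [hq : Generic q]

lemma F_smul_tw (s : Fin n) (k : Fin (dimN t n)) (y : ParVerma t n q x lam) :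
    gen (.F s) • tw k y = (∑ l, rmat t n q s k l • tw l (ugen t n q (.Kinv s) • y)) +
      tw k (ugen t n q (.F s) • y) := by
  rw [gen_smul]
  change (show Module.End ℂ ((Fin (dimN t n) → ℂ) ⊗[ℂ] ParVerma t n q x lam) from
      TensorProduct.map (actN t n q (.F s)) (actM t n q x lam (.Kinv s)) +
      TensorProduct.map LinearMap.id (actM t n q x lam (.F s)))
      ((Pi.single k 1 : Fin (dimN t n) → ℂ) ⊗ₜ[ℂ] y) = _
  rw [LinearMap.add_apply, TensorProduct.map_tmul, TensorProduct.map_tmul]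
  congr 1
  have h : actN t n q (.F s) (Pi.single k 1) =
      ∑ l, rmat t n q s k l • (Pi.single l 1 : Fin (dimN t n) → ℂ) := by
    rw [actN, natRep_F, Matrix.toLin'_apply, Matrix.mulVec_single_one]
    conv_lhs => rw [← Finset.univ_sum_single (M := fun _ => ℂ) (Matrix.col _ k)]
    refine Finset.sum_congr rfl fun l _ => ?_
    rw [← Pi.single_smul, smul_eq_mul, mul_one]
    rfl
  rw [h]
  refine (TensorProduct.sum_tmul _ _ _).trans ?_
  refine Finset.sum_congr rfl fun l _ => ?_
  exact (TensorProduct.smul_tmul' _ _ _).symm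

/-- The scalar comparing `w_k ⊗ X v` with `∑ X_{kl} w_l ⊗ v`. -/
def hwScalar (t : Series) {n : ℕ} (q : ℂ) (lam : Fin n → ℂ) (ω : Fin n → ℤ) : ℂ :=
  Complex.exp (Complex.log q * ((nsq ω : ℂ) / 2 - pair lam ω - pair (halfSum (posRoots t n)) ω) +
    Real.pi * Complex.I * (ht t ω : ℂ) / 2)

lemma hwScalar_ne_zero (ω : Fin n → ℤ) : hwScalar t q lam ω ≠ 0 := Complex.exp_ne_zero _

/-- The closed form solves this recursion. The quadratic term yields the pairing with `ω`, the `ρ`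
term cancels `(α, α)/2`, and the imaginary term gives one sign per letter because `ht` is `2` on
simple roots. -/
lemma hwScalar_simpleRoot_add (s : Fin n) (ω : Fin n → ℤ) :
    hwScalar t q lam (simpleRoot t n s + ω) =
      -(q ^ (simpleRoot t n s ⬝ᵥ ω : ℤ) * (q ^ pair lam (simpleRoot t n s))⁻¹ *
        hwScalar t q lam ω) := by
  have h0 := hq.ne
  rw [← Complex.cpow_intCast, ← Complex.cpow_neg, Complex.cpow_def_of_ne_zero h0,
    Complex.cpow_def_of_ne_zero h0, hwScalar, hwScalar, ← Complex.exp_add, ← Complex.exp_add,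
    neg_eq_neg_one_mul, ← Complex.exp_pi_mul_I, ← Complex.exp_add]
  congr 1
  have h1 : nsq (simpleRoot t n s + ω) =
      nsq (simpleRoot t n s) + 2 * (simpleRoot t n s ⬝ᵥ ω) + nsq ω := by
    simp only [nsq, dotProduct_add, add_dotProduct, dotProduct_comm ω]
    ring
  have h2 : ht t (simpleRoot t n s + ω) = 2 + ht t ω := by rw [ht_add, ht_simpleRoot]
  rw [h1, h2, pair_add, pair_add, pair_rho_simpleRoot hT.hD]
  push_cast
  ring

/-- The submodule generated by the `w_l ⊗ v` with `ε_l` of height more than `h`. -/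
def higher (t : Series) (n : ℕ) (q : ℂ) (x : Fin n → ℂˣ) (lam : Fin n → ℂ) (h : ℤ) :
    Submodule (Free n) (Tens t n q x lam) :=
  Submodule.span (Free n) (wv t n q x lam '' {l | h < ht t (eps t n l)})

lemma higher_anti {h h' : ℤ} (hh : h ≤ h') : higher t n q x lam h' ≤ higher t n q x lam h :=
  Submodule.span_mono (Set.image_mono fun _ hl => lt_of_le_of_lt hh hl)

lemma K_hwVec (s : Fin n) : ugen t n q (.K s) • hwVec t n q x lam =
    (q ^ pair lam (simpleRoot t n s)) • hwVec t n q x lam := by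
  have h := congrArg (singularSubmodule t n q x lam).mkQ (K_vac (t := t) (q := q) (lam := lam) s)
  rw [map_smul] at h
  exact h

lemma iota_hwVec_eq_zero {X : Um t n q}
    (h : iota t n q X • vac t n q lam ∈ singularSubmodule t n q x lam) :
    iota t n q X • hwVec t n q x lam = 0 := by
  have h1 := (Submodule.Quotient.mk_eq_zero _).mpr h
  exact h1

/-- By `w ⊗ F y = F (w ⊗ y) - F w ⊗ K⁻¹ y` a letter passes from the right factor to the left. The
term `F (w ⊗ y)` lies, by induction, in the submodule generated by strictly higher vectors. Letters
reach the left factor in reversed order, hence the transposed representation. -/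
lemma tw_word_sub_mem (l : List (Fin n)) (k : Fin (dimN t n)) :
    tw k (iota t n q (word t q l) • hwVec t n q x lam) - hwScalar t q lam (wsum t l) •
      ∑ m, rep t n q (word t q l) k m • wv t n q x lam m ∈
      higher t n q x lam (ht t (eps t n k) - ht t (wsum t l)) := by
  induction l generalizing k with
  | nil =>
    have h : hwScalar t q lam (wsum t []) = 1 := by
      simp [hwScalar, wsum, nsq, pair_zero, ht_zero]
    rw [h, word, List.map_nil, List.prod_nil, map_one, map_one, one_smul, one_smul, tw_hwVec,
      Finset.sum_eq_single k]
    · rw [Matrix.one_apply_eq, one_smul, sub_self]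
      exact Submodule.zero_mem _
    · intro b _ hb
      rw [Matrix.one_apply_ne hb.symm, zero_smul]
    · simp
  | cons s l ih =>
    have hs := ht_simpleRoot (t := t) (n := n) s
    have hω : ht t (wsum t (s :: l)) = 2 + ht t (wsum t l) := by rw [wsum_cons, ht_add, hs]
    set c : ℂ := q ^ (simpleRoot t n s ⬝ᵥ wsum t l : ℤ) *
      (q ^ pair lam (simpleRoot t n s))⁻¹ with hc
    set y := iota t n q (word t q l) • hwVec t n q x lam with hy
    have hK : ugen t n q (.Kinv s) • y = c • y :=
      Kinv_iota_smul (cpow_ne_zero _) (K_hwVec s) (word_mem_hom l)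
    have e1 : iota t n q (word t q (s :: l)) • hwVec t n q x lam = ugen t n q (.F s) • y := by
      rw [word_cons, map_mul, iota_Fg, mul_smul]
    have e2 : tw k (ugen t n q (.F s) • y) = gen (.F s) • tw k y -
        ∑ m, (rmat t n q s k m * c) • tw m y := by
      rw [F_smul_tw, hK]
      simp only [map_smul, smul_smul, add_sub_cancel_left]
    have e3 : hwScalar t q lam (wsum t (s :: l)) •
        ∑ m, rep t n q (word t q (s :: l)) k m • wv t n q x lam m =
        -∑ p, (rmat t n q s k p * c) • hwScalar t q lam (wsum t l) •
          ∑ m, rep t n q (word t q l) p m • wv t n q x lam m := by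
      rw [wsum_cons, hwScalar_simpleRoot_add, ← hc, word_cons, map_mul, rep_Fg]
      simp only [Matrix.mul_apply, Finset.sum_smul, Finset.smul_sum, smul_smul]
      rw [Finset.sum_comm, ← Finset.sum_neg_distrib]
      refine Finset.sum_congr rfl fun p _ => ?_
      rw [← Finset.sum_neg_distrib]
      refine Finset.sum_congr rfl fun m _ => ?_
      rw [← neg_smul]
      congr 1
      ring
    have e4 : tw k (ugen t n q (.F s) • y) - hwScalar t q lam (wsum t (s :: l)) •
        ∑ m, rep t n q (word t q (s :: l)) k m • wv t n q x lam m = gen (.F s) • tw k y -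
        ∑ p, (rmat t n q s k p * c) • (tw p y - hwScalar t q lam (wsum t l) •
          ∑ m, rep t n q (word t q l) p m • wv t n q x lam m) := by
      rw [e2, e3]
      simp only [smul_sub, Finset.sum_sub_distrib]
      abel
    rw [e1, e4]
    refine Submodule.sub_mem _ (Submodule.smul_mem _ _ ?_) (Submodule.sum_mem _ fun p _ => ?_)
    · rw [← sub_add_cancel (tw k y) (hwScalar t q lam (wsum t l) •
          ∑ m, rep t n q (word t q l) k m • wv t n q x lam m)]
      refine Submodule.add_mem _ (higher_anti (by omega) (ih k))
        (smul_mem_tens _ _ (Submodule.sum_mem _ fun m _ => ?_))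
      by_cases h0 : rep t n q (word t q l) k m = 0
      · rw [h0, zero_smul]; exact Submodule.zero_mem _
      · have hm : eps t n k - eps t n m = wsum t l := by
          by_contra hne
          exact h0 (rep_apply_eq_zero (word_mem_hom l) hne)
        have hm' := congrArg (ht t) hm
        rw [ht_sub] at hm'
        exact smul_mem_tens _ _ (Submodule.subset_span ⟨m, by
          rw [Set.mem_ofPred_eq]; omega, rfl⟩)
    · by_cases h0 : rmat t n q s k p = 0
      · rw [h0, zero_mul, zero_smul]; exact Submodule.zero_mem _
      · have hm : eps t n k - eps t n p = simpleRoot t n s := by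
          by_contra hne
          rw [← rep_Fg] at h0
          exact h0 (rep_apply_eq_zero (Fg_mem_hom s) hne)
        have hm' := congrArg (ht t) hm
        rw [ht_sub] at hm'
        exact smul_mem_tens _ _ (higher_anti (by omega) (ih p))

lemma tw_iota_sub_mem {ω : Fin n → ℤ} {X : Um t n q} (hX : X ∈ hom t q ω)
    (k : Fin (dimN t n)) :
    tw k (iota t n q X • hwVec t n q x lam) - hwScalar t q lam ω •
      ∑ m, rep t n q X k m • wv t n q x lam m ∈
      higher t n q x lam (ht t (eps t n k) - ht t ω) := by
  refine Submodule.span_induction (p := fun X _ => tw k (iota t n q X • hwVec t n q x lam) -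
      hwScalar t q lam ω • ∑ m, rep t n q X k m • wv t n q x lam m ∈
      higher t n q x lam (ht t (eps t n k) - ht t ω)) ?_ ?_ ?_ ?_ hX
  · rintro _ ⟨l, hl, rfl⟩
    rw [← hl]
    exact tw_word_sub_mem l k
  · simp
  · intro X Y _ _ h1 h2
    convert Submodule.add_mem _ h1 h2 using 1
    simp only [map_add, add_smul, Matrix.add_apply, Finset.sum_add_distrib, smul_add]
    abel
  · intro c X _ h
    convert smul_mem_tens _ c h using 1
    simp only [map_smul, Matrix.smul_apply, smul_assoc, smul_sub, Finset.smul_sum]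
    congr 1
    exact Finset.sum_congr rfl fun m _ => smul_comm _ _ _

/-- A relation of weight `ε_i - ε_j` on the highest weight vector puts `w_j ⊗ v` into the
submodule generated by the preceding vectors. -/
lemma wv_mem_Vprev {i j : Fin (dimN t n)} {X : Um t n q}
    (hX : X ∈ hom t q (eps t n i - eps t n j))
    (h0 : iota t n q X • hwVec t n q x lam = 0) (hX0 : rep t n q X i j ≠ 0) :
    wv t n q x lam j ∈ Vprev t n q x lam j := by
  have h := tw_iota_sub_mem (x := x) (lam := lam) hX i
  -- The relation kills the tensor, and `j` is the only index of the right weight, so a nonzero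
  -- multiple of `w_j ⊗ v` lies in the span of higher vectors.
  rw [h0, map_zero, zero_sub, Submodule.neg_mem_iff, ht_sub, sub_sub_cancel,
    Finset.sum_eq_single j, smul_smul] at h
  · have h1 := smul_mem_tens _ (hwScalar t q lam (eps t n i - eps t n j) * rep t n q X i j)⁻¹ h
    rw [inv_smul_smul₀ (mul_ne_zero (hwScalar_ne_zero _) hX0)] at h1
    exact Submodule.span_mono (Set.image_mono fun l hl => lt_of_ht_eps_lt hl) h1
  · intro l _ hl
    rw [rep_apply_eq_zero hX fun h => hl (eps_injective t n (sub_right_injective h)), zero_smul]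
  · simp

end Tensor

/-! ### Indices outside `I_𝔨` and simple roots of `𝔨`. -/

section Index
variable {t : Series} {n : ℕ} {x : Fin n → ℂˣ}

lemma form_rev_comm (ht : t ≠ .C) (l : Fin (dimN t n)) :
    form t n l.rev l = form t n l l.rev ∧ form t n l l.rev ≠ 0 := by
  cases t
  · have hl := l.2
    have hr : (l.rev : ℕ) = dimN .B n - (l + 1) := Fin.val_rev l
    have hN : dimN .B n = 2 * n + 1 := rfl
    have h : ((-1 : ℂ)) ^ (l.rev : ℕ) = (-1) ^ (l : ℕ) := by
      refine neg_one_pow_congr ?_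
      rw [Nat.even_iff, Nat.even_iff]
      omega
    simp only [form, Matrix.of_apply, Fin.rev_rev, if_true, h]
    exact ⟨trivial, pow_ne_zero _ (by norm_num)⟩
  · exact absurd rfl ht
  · simp only [form, Matrix.of_apply, Fin.rev_rev, if_true]
    exact ⟨by rw [min_comm], pow_ne_zero _ (by norm_num)⟩

/-- If every element of `𝔨₋` had zero row `j`, the hyperplane of vectors with zero `j`-th coordinate
would contain each `lowerSpan`. -/
lemma exists_kMinus_ne_zero {j : Fin (dimN t n)} (hj : j ∉ indexK t n x) :
    ∃ A ∈ kMinus t n x, ∃ l, A j l ≠ 0 := by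
  by_contra! h
  refine hj fun i hi => ?_
  let W : Submodule ℂ (Fin (dimN t n) → ℂ) := LinearMap.ker (LinearMap.proj j)
  have hA : ∀ A ∈ kMinus t n x, ∀ v, A *ᵥ v ∈ W := by
    intro A hA v
    rw [LinearMap.mem_ker, LinearMap.proj_apply, Matrix.mulVec, dotProduct]
    exact Finset.sum_eq_zero fun l _ => by rw [h A hA l, zero_mul]
  have hW : lowerSpan t n x i ≤ W := sInf_le fun A h => ⟨hA A h _, fun v _ => hA A h v⟩
  have h1 : (Pi.single j 1 : Fin (dimN t n) → ℂ) j = 0 := hW hi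
  simp at h1

lemma isRoot_eps_sub {l j : Fin (dimN t n)} (hlj : l ≠ j) (h : l = j.rev → t = .C) :
    IsRoot t (eps t n l - eps t n j) := by
  have hne : eps t n l ≠ eps t n j := fun h => hlj (eps_injective t n h)
  have hsub := nsq_sub (eps t n l) (eps t n j)
  rcases nsq_eps_eq t n l with hl | ⟨hB, hl⟩ <;> rcases nsq_eps_eq t n j with hj | ⟨hB', hj⟩
  · have h1 := dot_sq_le (eps t n l) (eps t n j)
    rw [hl, hj] at h1 hsub
    have h2 : eps t n l ⬝ᵥ eps t n j ≤ 1 := by nlinarith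
    have h3 : -1 ≤ eps t n l ⬝ᵥ eps t n j := by nlinarith
    have h4 : eps t n l ⬝ᵥ eps t n j = -1 ∨ eps t n l ⬝ᵥ eps t n j = 0 ∨
      eps t n l ⬝ᵥ eps t n j = 1 := by omega
    rcases h4 with h4 | h4 | h4
    · have h5 : eps t n l = - eps t n j := by
        have h6 := nsq_add (eps t n l) (eps t n j)
        rw [hl, hj, h4] at h6
        exact eq_neg_of_add_eq_zero_left (nsq_eq_zero.mp h6)
      have h7 : l = j.rev := eps_injective t n (by rw [eps_rev, h5])
      obtain rfl := h h7
      refine Or.inr ⟨by rw [hsub, h4]; rfl, -eps .C n j, ?_⟩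
      rw [h5, two_smul]; abel
    · exact IsRoot.of_nsq_two (by rw [hsub, h4]; rfl)
    · rw [h4] at hsub
      exact absurd (sub_eq_zero.mp (nsq_eq_zero.mp hsub)) hne
  · subst hB'
    exact Or.inl (by rw [hj, sub_zero, hl])
  · subst hB
    exact Or.inl (by rw [hl, zero_sub, nsq_neg, hj])
  · exact absurd (hl.trans hj.symm) hne

lemma exists_posRootsK {j : Fin (dimN t n)} (hj : j ∉ indexK t n x) :
    ∃ l, eps t n l - eps t n j ∈ posRootsK t n x := by
  obtain ⟨A, ⟨⟨hA, hc⟩, hlow⟩, l, hl⟩ := exists_kMinus_ne_zero hj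
  have hlj : l < j := by
    by_contra h
    exact hl (hlow j l (not_lt.mp h))
  have hchar : char x (eps t n l) = char x (eps t n j) := by
    have h1 := congrFun (congrFun hc j) l
    rw [torusMat, Matrix.mul_diagonal, Matrix.diagonal_mul, mul_comm] at h1
    exact Units.ext (mul_right_cancel₀ hl h1)
  -- For the orthogonal series the form is symmetric on the antidiagonal, so skew-adjointness kills
  -- the antidiagonal entries.
  have hC : l = j.rev → t = .C := by
    intro h
    by_contra ht
    rw [gAlg, mem_skewAdjointMatricesSubmodule] at hA
    have h1 : Aᵀ * form t n = form t n * (-A) := hA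
    have h2 := congrFun (congrFun h1 l) l
    have hjl : j = l.rev := by rw [h, Fin.rev_rev]
    obtain ⟨h3, h4⟩ := form_rev_comm ht l
    rw [Matrix.mul_apply, Matrix.mul_apply, Finset.sum_eq_single j, Finset.sum_eq_single j,
      Matrix.transpose_apply, Matrix.neg_apply, hjl, h3] at h2
    · rw [hjl] at hl
      have h5 : 2 * (form t n l l.rev * A l.rev l) = 0 := by linear_combination h2
      simp [h4, hl] at h5
    · intro b _ hb
      rw [form, Matrix.of_apply, if_neg (by rwa [hjl] at hb), zero_mul]
    · simp
    · intro b _ hb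
      rw [form, Matrix.of_apply, if_neg, mul_zero]
      intro h5
      exact hb (by rw [hjl, h5, Fin.rev_rev])
    · simp
  have hr := isRoot_eps_sub hlj.ne hC
  refine ⟨l, mem_posRootsK.mpr ⟨mem_posRoots_iff.mpr ⟨hr, ?_⟩, ?_⟩⟩
  · have h1 := ht_eps_mono (t := t) (n := n) hlj.le
    have h2 := hr.ht_ne_zero
    rw [ht_sub] at h2 ⊢
    omega
  · rw [char_sub, hchar, mul_inv_cancel]

lemma nsq_eps_add_of_dot_neg {j : Fin (dimN t n)} (hj : nsq (eps t n j) = 1) {δ : Fin n → ℤ}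
    (hδ : IsRoot t δ) (h : eps t n j ⬝ᵥ δ < 0) : ∃ k, eps t n k = eps t n j + δ := by
  rw [exists_eps_iff]
  have h1 := nsq_add (eps t n j) δ
  have h2 := dot_sq_le (eps t n j) δ
  rw [hj] at h1 h2
  rcases hδ.nsq_mem with ⟨h3, hB⟩ | h3 | ⟨h3, -, u, rfl⟩
  · have h4 : eps t n j ⬝ᵥ δ = -1 := by nlinarith
    exact Or.inr ⟨hB, nsq_eq_zero.mp (by rw [h1, h3, h4]; rfl)⟩
  · have h4 : eps t n j ⬝ᵥ δ = -1 := by nlinarith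
    exact Or.inl (by rw [h1, h3, h4]; rfl)
  · rw [dotProduct_smul, smul_eq_mul] at h h1 h2
    have h4 : eps t n j ⬝ᵥ u = -1 := by nlinarith
    exact Or.inl (by rw [h1, h3, h4]; rfl)

/-- If both roots paired nonnegatively with `ε_j`, then `ε_i` would have length more than `1`; a
root that pairs negatively can be added to `ε_j`. If `ε_j = 0`, one of the two roots must be short,
hence a weight. -/
lemma exists_eps_add_of_sub_eq {i j : Fin (dimN t n)} {δ₁ δ₂ : Fin n → ℤ} (h₁ : IsRoot t δ₁)
    (h₂ : IsRoot t δ₂) (hij : i ≠ j) (h : eps t n i - eps t n j = δ₁ + δ₂) :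
    (∃ k, eps t n k = eps t n j + δ₁) ∨ ∃ k, eps t n k = eps t n j + δ₂ := by
  have hi : eps t n i = eps t n j + (δ₁ + δ₂) := by rw [← h]; abel
  have hne : eps t n i ≠ eps t n j := fun h => hij (eps_injective t n h)
  rcases nsq_eps_eq t n j with hj | ⟨rfl, hj⟩
  · have h3 := nsq_add (eps t n j) (δ₁ + δ₂)
    rw [← hi, hj, dotProduct_add] at h3
    have h4 : nsq (δ₁ + δ₂) ≠ 0 := by
      rw [← h, Ne, nsq_eq_zero, sub_eq_zero]; exact hne
    have h5 : 0 ≤ nsq (δ₁ + δ₂) := nsq_nonneg _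
    have h6 : nsq (eps t n i) ≤ 1 := by
      rcases nsq_eps_eq t n i with hi | ⟨-, hi⟩ <;> rw [hi]
      simp [nsq]
    by_cases h7 : eps t n j ⬝ᵥ δ₁ < 0
    · exact Or.inl (nsq_eps_add_of_dot_neg hj h₁ h7)
    · exact Or.inr (nsq_eps_add_of_dot_neg hj h₂ (by omega))
  · rw [hj, zero_add] at hi
    rw [hj, zero_add, zero_add, exists_eps_iff, exists_eps_iff]
    have h6 : nsq (eps .B n i) = 1 := by
      rcases nsq_eps_eq .B n i with hi | ⟨-, hi⟩
      · exact hi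
      · exact absurd (hi.trans hj.symm) hne
    rw [hi, nsq_add] at h6
    rcases h₁ with h1 | h1 <;> rcases h₂ with h2 | h2
    · exact Or.inl (Or.inl h1)
    · exact Or.inl (Or.inl h1)
    · exact Or.inr (Or.inl h2)
    · omega

/-- Take `ε_i` of least height among the weights with `ε_i - ε_j` a positive root of `𝔨`. A
splitting of this root would give a lower weight of the same kind. -/
lemma exists_simpleRootsK {j : Fin (dimN t n)} (hj : j ∉ indexK t n x) :
    ∃ i, eps t n i - eps t n j ∈ simpleRootsK t n x := by
  classical
  obtain ⟨l, hl⟩ := exists_posRootsK hj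
  obtain ⟨i, hi, hmin⟩ := Finset.exists_min_image
    (Finset.univ.filter fun i => eps t n i - eps t n j ∈ posRootsK t n x)
    (fun i => ht t (eps t n i)) ⟨l, by simpa using hl⟩
  rw [Finset.mem_filter] at hi
  refine ⟨i, hi.2, ?_⟩
  rintro ⟨δ₁, h₁, δ₂, h₂, h⟩
  have hij : i ≠ j := by
    rintro rfl
    have := (mem_posRoots_iff.mp (mem_posRootsK.mp hi.2).1).2
    rw [sub_self, ht_zero] at this
    exact lt_irrefl _ this
  have p₁ := (mem_posRoots_iff.mp (mem_posRootsK.mp h₁).1).2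
  have p₂ := (mem_posRoots_iff.mp (mem_posRootsK.mp h₂).1).2
  have hh := congrArg (ht t) h
  rw [ht_sub, ht_add] at hh
  rcases exists_eps_add_of_sub_eq (isRoot_of_posRootsK h₁) (isRoot_of_posRootsK h₂) hij h with
    ⟨k, hk⟩ | ⟨k, hk⟩
  · have h3 := hmin k (by simpa [hk] using h₁)
    rw [hk, ht_add] at h3
    omega
  · have h3 := hmin k (by simpa [hk] using h₂)
    rw [hk, ht_add] at h3
    omega

end Index

/-! ### Regular weights meet the specialization conditions. -/

section Final
variable {t : Series} {n : ℕ} {x : Fin n → ℂˣ} {lam0 lam1 : Fin n → ℂ}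

/-- The second regularity condition gives `(λ¹ + ρ, α) = (ρ_𝔨, α) = (α, α)/2`. If `e^{2(λ⁰, δ)} =
1`, then `δ` and `α - δ` are both roots of `𝔨`, against the simplicity of `α`. -/
lemma cond_of_simpleRootsK (hlam : IsRegWeight t n x lam0 lam1) {α : Fin n → ℤ}
    (hα : α ∈ simpleRootsK t n x) : Cond t n lam0 (lam1 + halfSum (posRoots t n)) α where
  mem := (mem_posRootsK.mp hα.1).1
  exp_eq := (hlam.1 α (mem_posRootsK.mp hα.1).1).mpr hα.1
  pair_eq := by
    have h := hlam.2 α hα.1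
    have h1 := pair_halfSum (posRootsK t n x) α
    rw [sum_posRootsK_dot hα] at h1
    rw [pair_add_left, pair_sub_left, h1] at h
    rw [pair_add_left]
    linear_combination h
  exp_ne := fun δ hδ hδ' h1 => by
    have hK := (hlam.1 δ hδ).mp h1
    refine hα.2 ⟨δ, hK, α - δ, mem_posRootsK.mpr ⟨hδ', ?_⟩, by abel⟩
    rw [char_sub, (mem_posRootsK.mp hα.1).2, (mem_posRootsK.mp hK).2, mul_inv_cancel]

variable [hT : Datum t n]

lemma eventually_wv_mem (hlam : IsRegWeight t n x lam0 lam1) {j : Fin (dimN t n)}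
    (hj : j ∉ indexK t n x) : ∀ᶠ q in 𝓝 (1 : ℂ), ∀ _ : Generic q,
      wv t n q x (wt lam0 lam1 q) j ∈ Vprev t n q x (wt lam0 lam1 q) j := by
  obtain ⟨i, hi⟩ := exists_simpleRootsK hj
  filter_upwards [eventually_exists_sing (ht t (eps t n i - eps t n j)).toNat lam0
    (lam1 + halfSum (posRoots t n)) i j (cond_of_simpleRootsK hlam hi) (Int.self_le_toNat _)]
    with q hq hG
  obtain ⟨θ, hθ, hs, h0⟩ := hq hG
  refine wv_mem_Vprev hθ (iota_hwVec_eq_zero (Submodule.subset_span ⟨_, hi, ?_⟩)) h0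
  refine isSingular_iota hθ hs fun s => ?_
  have hq0 := hG.ne
  -- The parameter `μ` equals `log q` times `λ + ρ`; cancelling `log q` against `ħ⁻¹` in `λ`
  -- requires that it not vanish.
  have hlog : Complex.log q ≠ 0 := by
    intro h
    have h1 := Complex.exp_log hq0
    rw [h, Complex.exp_zero] at h1
    exact hG.pow 1 one_pos (by rw [← h1, one_pow])
  rw [← Complex.cpow_intCast, Complex.cpow_def_of_ne_zero hq0, Complex.cpow_def_of_ne_zero hq0,
    ← Complex.exp_nat_mul, ← Complex.exp_nat_mul, ← Complex.exp_add, wt, pair_add_left,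
    pair_smul_left, pair_add_left, pair_add_left, pair_smul_left, pair_rho_simpleRoot hT.hD]
  congr 1
  push_cast
  field_simp
  ring

end Final

/-! ### Formal consequences for the filtration. -/

section Filtration
variable {t : Series} {n : ℕ} {q : ℂ} {x : Fin n → ℂˣ} {lam : Fin n → ℂ}

lemma V_eq_span_indexK
    (h : ∀ j, j ∉ indexK t n x → wv t n q x lam j ∈ Vprev t n q x lam j) (j : Fin (dimN t n)) :
    V t n q x lam j = Submodule.span (Free n)
      (wv t n q x lam '' {i | i ≤ j ∧ i ∈ indexK t n x}) := by
  refine le_antisymm ?_ (Submodule.span_mono (Set.image_mono fun i hi => hi.1))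
  rw [V, Submodule.span_le]
  rintro _ ⟨i, hi, rfl⟩
  have key : ∀ (m : ℕ) (i : Fin (dimN t n)), (i : ℕ) = m → i ≤ j → wv t n q x lam i ∈
      Submodule.span (Free n) (wv t n q x lam '' {i | i ≤ j ∧ i ∈ indexK t n x}) := by
    intro m
    induction m using Nat.strong_induction_on with
    | _ m ih =>
      intro i him hij
      by_cases hi : i ∈ indexK t n x
      · exact Submodule.subset_span ⟨i, ⟨hij, hi⟩, rfl⟩
      · refine (Submodule.span_le.mpr ?_ : Vprev t n q x lam i ≤ _) (h i hi)
        rintro _ ⟨k, hk, rfl⟩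
        have hk' : k < i := hk
        exact ih k (by rw [← him]; exact hk') k rfl (hk'.le.trans hij)
  exact key i i rfl hi

lemma subsingleton_GrV {j : Fin (dimN t n)}
    (h : wv t n q x lam j ∈ Vprev t n q x lam j) : Subsingleton (GrV t n q x lam j) := by
  rw [Submodule.Quotient.subsingleton_iff, Submodule.submoduleOf, Submodule.comap_subtype_eq_top, V,
    Submodule.span_le]
  rintro _ ⟨i, hi, rfl⟩
  rcases (show i ≤ j from hi).lt_or_eq with hi | rfl
  · exact Submodule.subset_span ⟨i, hi, rfl⟩
  · exact h

lemma grInclusion_bijective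
    (h : ∀ j, j ∉ indexK t n x → wv t n q x lam j ∈ Vprev t n q x lam j) :
    Function.Bijective (grInclusion t n q x lam) := by
  classical
  constructor
  -- Injectivity holds because the map preserves coordinates; surjectivity below uses the vanishing
  -- of the remaining graded pieces.
  · have hc : ∀ (z : ⨁ j : indexK t n x, GrV t n q x lam j) (j : indexK t n x),
        grInclusion t n q x lam z j = z j := by
      intro z j
      induction z using DirectSum.induction_on with
      | zero => simp
      | of i y =>
        change grInclusion t n q x lam (DirectSum.lof (Free n) _
          (fun j : indexK t n x => GrV t n q x lam j) i y) _ =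
          (DirectSum.lof (Free n) _ (fun j : indexK t n x => GrV t n q x lam j) i y) j
        rw [grInclusion, DirectSum.toModule_lof]
        by_cases hij : i = j
        · subst hij
          rw [DirectSum.lof_apply, DirectSum.lof_apply]
        · rw [DirectSum.lof_eq_of, DirectSum.lof_eq_of, DirectSum.of_eq_of_ne _ _ _ (Ne.symm hij),
            DirectSum.of_eq_of_ne]
          exact fun h => hij (Subtype.ext h.symm)
      | add y z hy hz => rw [map_add, DirectSum.add_apply, DirectSum.add_apply, hy, hz]
    intro z z' hz
    ext1 j
    rw [← hc, ← hc, hz]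
  · rw [← LinearMap.range_eq_top, eq_top_iff]
    rintro z -
    induction z using DirectSum.induction_on with
    | zero => exact Submodule.zero_mem _
    | add y z hy hz => exact Submodule.add_mem _ hy hz
    | of j y =>
      by_cases hj : j ∈ indexK t n x
      · refine ⟨DirectSum.lof (Free n) (indexK t n x) (fun j => GrV t n q x lam j) ⟨j, hj⟩ y, ?_⟩
        rw [grInclusion, DirectSum.toModule_lof]
        rfl
      · have := subsingleton_GrV (h j hj)
        rw [Subsingleton.elim y 0, map_zero]
        exact Submodule.zero_mem _

end Filtration

end QOrtho

end

open QOrtho in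
theorem mainTheorem3 (t : Series) (n : ℕ) (hn : 1 ≤ n) (hD : t = Series.D → 3 ≤ n)
    (x : Fin n → ℂˣ) (lam0 lam1 : Fin n → ℂ) (hlam : IsRegWeight t n x lam0 lam1) :
    ∃ Ω ∈ 𝓝 (1 : ℂ), ∀ q ∈ Ω, (∀ m : ℕ, 0 < m → q ^ m ≠ 1) →
      (∀ j : Fin (dimN t n),
        V t n q x (wt lam0 lam1 q) j =
          Submodule.span (Free n)
            (wv t n q x (wt lam0 lam1 q) '' {i | i ≤ j ∧ i ∈ indexK t n x})) ∧
      Function.Bijective (grInclusion t n q x (wt lam0 lam1 q)) := by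
  have : Datum t n := ⟨hD⟩
  have hev : ∀ᶠ q in 𝓝 (1 : ℂ), ∀ j, j ∉ indexK t n x → ∀ _ : Generic q,
      wv t n q x (wt lam0 lam1 q) j ∈ Vprev t n q x (wt lam0 lam1 q) j := by
    -- There are finitely many `j`, so the neighbourhoods can be intersected.
    rw [Filter.eventually_all]
    intro j
    by_cases hj : j ∈ indexK t n x
    · exact Filter.Eventually.of_forall fun q h => absurd hj h
    · filter_upwards [eventually_wv_mem hlam hj] with q hq _
      exact hq
  -- The value `q = 0` passes the root of unity hypothesis, so it is removed from the neighbourhood.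
  refine ⟨_, hev.and (eventually_ne_nhds one_ne_zero), fun q hq hroot => ?_⟩
  have h := fun j hj => hq.1 j hj ⟨hq.2, hroot⟩
  exact ⟨V_eq_span_indexK h, grInclusion_bijective h⟩
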